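/- Let $G$ and $K$ be finite-dimensional Lie groups and let $M$ be a smooth manifold with a smooth left $G$-action (manifolds are finite-dimensional, Hausdorff, second countable and without boundary; Lie groups are such manifolds too). For a manifold $X$, let $(M/\!\!/_{\nabla}G)(X)$ be the groupoid whose objects are the pairs $(\alpha,f)$ with $\alpha\in\Omega^1(X;\mathfrak g)$ and $f\colon X\to M$ smooth, and whose morphisms are $(g,\alpha,f)\colon(\alpha,f)\to(\alpha\cdot g^{-1},gf)$ for smooth $g\colon X\to G$, where $\alpha\cdot g=\mathrm{Ad}_{g^{-1}}\alpha+g^*\theta_{\mathfrak g}$ and $\theta_{\mathfrak g}$ is the Maurer–Cartan form. Let $\mathrm{Bun}_{K,\nabla}(X)$ be the groupoid of principal $K$-bundles with connection on $X$. A *$K$-bundle with connection* $\mathcal Q_\nabla$ on $M/\!\!/_{\nabla}G$ is a morphism of prestacks $M/\!\!/_{\nabla}G\to \mathrm{Bun}_{K,\nabla}$: functors $(M/\!\!/_{\nabla}G)(X)\to\mathrm{Bun}_{K,\nabla}(X)$ for all $X$ and natural isomorphisms $\mathcal Q_\nabla(\varphi^*\alpha,f\circ\varphi)\cong\varphi^*\mathcal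 Q_\nabla(\alpha,f)$ for all smooth $\varphi\colon Y\to X$, compatible with identities and composition. Put $(Q,\Theta)=\mathcal Q_\nabla(0,\mathrm{id}_M)$. Then the maps $h\colon Q\xrightarrow{\mathcal Q_\nabla(h,0,\mathrm{id}_M)}\mathcal Q_\nabla(0,h\cdot\mathrm{id}_M)\cong h^*Q\to Q$, $h\in G$, make $Q$ a smooth $G$-equivariant principal $K$-bundle with $G$-invariant connection $\Theta$. With $\rho_q(A)=\frac{d}{dt}\big|_{t=0}e^{-tA}q$ for $A\in\mathfrak g$, let $(1-\iota_{\rho(\alpha)})f^*(Q,\Theta)$ be the bundle $f^*Q$ on $X$ with the connection $v\mapsto\Theta(v')-\Theta\big(\rho_{q}(\alpha(\bar v))\big)$ for $v$ tangent to $f^*Q$ at $(x,q)$, where $v'\in T_qQ$ and $\bar v\in T_xX$ are the images of $v$. There is an isomorphism in $\mathrm{Bun}_{K,\nabla}(X)$ $$\mathcal Q_\nabla(\alpha,f)\;\cong\;(1-\iota_{\rho(\alpha)})f^*(Q,\Theta)\qquad\text{for all } X,\ \alpha\in\Omega^1(X;\mathfrak g),\ f\colon X\to M,$$ which is the canonical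 one for $(0,\mathrm{id}_M)$ and is natural under base change $\varphi\colon Y\to X$, in the morphisms $(g,\alpha,f)$ of $M/\!\!/_{\nabla}G$ (which act on the right-hand side by $(x,q)\mapsto(x,g(x)q)$), and in $\mathcal Q_\nabla$. Consequently $\mathcal Q_\nabla$ is determined by the $G$-equivariant bundle with connection $(Q,\Theta)$: every $G$-equivariant isomorphism $\mathcal Q_\nabla(0,\mathrm{id}_M)\cong\mathcal Q'_\nabla(0,\mathrm{id}_M)$ of bundles with connection is the value at $(0,\mathrm{id}_M)$ of exactly one morphism $\mathcal Q_\nabla\to\mathcal Q'_\nabla$. -/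

import Mathlib

open scoped Manifold ContDiff Topology
open CategoryTheory Bundle

universe u

section Comp
variable {E H N Z : Type u} [NormedAddCommGroup E] [NormedSpace ℝ E] [TopologicalSpace H]
  (I : ModelWithCorners ℝ E H) [TopologicalSpace N] [ChartedSpace H N] [IsManifold I ∞ N]
  [TopologicalSpace Z] [ChartedSpace N Z]

theorem isManifold_comp
    (h : ∀ e ∈ atlas N Z, ∀ e' ∈ atlas N Z, ContMDiffOn I I ∞ (e.symm ≫ₕ e') (e.symm ≫ₕ e').source) :
    @IsManifold ℝ _ E _ _ H _ I ∞ Z _ (ChartedSpace.comp H N Z) := by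
  let _ := ChartedSpace.comp H N Z
  refine isManifold_of_contDiffOn I ∞ Z ?_
  rintro _ _ ⟨e, he, d, hd, rfl⟩ ⟨e', he', d', hd', rfl⟩
  rw [← contMDiffOn_iff_contDiffOn]
  have h1 := h e he e' he'
  have hd1 := contMDiffOn_symm_of_mem_maximalAtlas (I := I) (n := ∞)
    (StructureGroupoid.subset_maximalAtlas _ hd)
  have hd2 := contMDiffOn_of_mem_maximalAtlas (I := I) (n := ∞)
    (StructureGroupoid.subset_maximalAtlas _ hd')
  apply I.contMDiff.comp_contMDiffOn
  refine (hd2.comp (h1.comp (hd1.comp (I.contMDiffOn_symm.mono ?_) ?_) ?_) ?_)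
  · exact fun x hx => hx.2
  · intro x hx
    simp only [mfld_simps] at hx ⊢
    grind
  · intro x hx
    simp only [mfld_simps] at hx ⊢
    grind
  · intro x hx
    simp only [mfld_simps] at hx ⊢
    grind

theorem contMDiffAt_of_atlas
    (h : ∀ e ∈ atlas N Z, ∀ e' ∈ atlas N Z, ContMDiffOn I I ∞ (e.symm ≫ₕ e') (e.symm ≫ₕ e').source)
    (e : OpenPartialHomeomorph Z N) (he : e ∈ atlas N Z) :
    let _ := ChartedSpace.comp H N Z
    ContMDiffOn I I ∞ e e.source ∧ ContMDiffOn I I ∞ e.symm e.target := by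
  let _ := ChartedSpace.comp H N Z
  have := isManifold_comp I h
  have key : ∀ z : Z, ContMDiffAt I I ∞ (chartAt N z) z ∧
      ContMDiffAt I I ∞ (chartAt N z).symm (chartAt N z z) := by
    intro z
    have hz := mem_chart_source H (chartAt N z z)
    have hz' := mem_chart_source N z
    have a1 : ContMDiffAt I I ∞ (chartAt H z) z :=
      (contMDiffOn_chart (I := I) (n := ∞)).contMDiffAt (chart_source_mem_nhds H z)
    have a2 : ContMDiffAt I I ∞ (chartAt H z).symm (chartAt H z z) :=
      (contMDiffOn_chart_symm (I := I) (n := ∞)).contMDiffAt (chart_target_mem_nhds H z)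
    have b1 : ContMDiffAt I I ∞ (chartAt H (chartAt N z z)) (chartAt N z z) :=
      (contMDiffOn_chart (I := I) (n := ∞)).contMDiffAt (chart_source_mem_nhds H _)
    have b2 : ContMDiffAt I I ∞ (chartAt H (chartAt N z z)).symm (chartAt H z z) :=
      (contMDiffOn_chart_symm (I := I) (n := ∞)).contMDiffAt
        (chart_target_mem_nhds H (chartAt N z z) :)
    constructor
    · refine (b2.comp z a1).congr_of_eventuallyEq ?_
      have : (chartAt H z).source ∈ 𝓝 z := chart_source_mem_nhds H z
      filter_upwards [this] with w hw
      change w ∈ ((chartAt N z) ≫ₕ (chartAt H (chartAt N z z))).source at hw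
      simp only [mfld_simps] at hw
      exact ((chartAt H (chartAt N z z)).left_inv hw.2).symm
    · refine (a2.comp (chartAt N z z) b1).congr_of_eventuallyEq ?_
      filter_upwards [chart_source_mem_nhds H (chartAt N z z)] with w hw
      change _ = (chartAt N z).symm ((chartAt H (chartAt N z z)).symm _)
      exact congrArg _ ((chartAt H (chartAt N z z)).left_inv hw).symm
  constructor
  · intro z hz
    refine ContMDiffAt.contMDiffWithinAt ?_
    have hs : ((chartAt N z).symm ≫ₕ e).source ∈ 𝓝 (chartAt N z z) := by
      refine ((chartAt N z).symm ≫ₕ e).open_source.mem_nhds ?_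
      simp only [mfld_simps, hz]
    have := ((h _ (chart_mem_atlas N z) e he).contMDiffAt hs).comp z (key z).1
    refine this.congr_of_eventuallyEq ?_
    filter_upwards [chart_source_mem_nhds N z] with w hw
    change _ = e ((chartAt N z).symm (chartAt N z w))
    rw [(chartAt N z).left_inv hw]
  · intro y hy
    refine ContMDiffAt.contMDiffWithinAt ?_
    set z := e.symm y with hz
    have hze : z ∈ e.source := e.map_target hy
    have hs : (e.symm ≫ₕ chartAt N z).source ∈ 𝓝 y := by
      refine (e.symm ≫ₕ chartAt N z).open_source.mem_nhds ?_
      simp only [mfld_simps, hy, ← hz]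
    have h1 := ((h e he _ (chart_mem_atlas N z)).contMDiffAt hs)
    have h2 := (key z).2
    have : ContMDiffAt I I ∞ ((chartAt N z).symm ∘ (e.symm ≫ₕ chartAt N z)) y :=
      ContMDiffAt.comp y (by simpa [← hz] using h2) h1
    refine this.congr_of_eventuallyEq ?_
    filter_upwards [hs] with w hw
    simp only [mfld_simps] at hw ⊢
    rw [(chartAt N z).left_inv hw.2]
end Comp

/-- A finite-dimensional smooth manifold: Hausdorff, second countable, without boundary, modelled on a
finite-dimensional real normed space `E` through `I`. -/
structure Mfd : Type (u + 1) where
  carrier : Type u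
  E : Type u
  H : Type u
  [normed : NormedAddCommGroup E]
  [space : NormedSpace ℝ E]
  [finDim : FiniteDimensional ℝ E]
  [topH : TopologicalSpace H]
  I : ModelWithCorners ℝ E H
  [noBoundary : I.Boundaryless]
  [top : TopologicalSpace carrier]
  [charted : ChartedSpace H carrier]
  [smooth : IsManifold I ∞ carrier]
  [hausdorff : T2Space carrier]
  [countable : SecondCountableTopology carrier]

namespace Mfd

instance : CoeSort Mfd.{u} (Type u) := ⟨Mfd.carrier⟩

attribute [instance] normed space finDim topH noBoundary top charted smooth hausdorff countable

/-- Smooth maps `X → Y`. -/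
abbrev Map (X Y : Mfd.{u}) : Type u := C^∞⟮X.I, X; Y.I, Y⟯

theorem trivAt_self (X : Mfd.{u}) (x : X) (A : X.E) :
    (trivializationAt X.E (TangentSpace X.I) x (⟨x, A⟩ : TangentBundle X.I X)).2 = A :=
  tangentCoordChange_self (I := X.I) (x := x) (z := x) (v := A) (by simp)

theorem tangent_incl (X : Mfd.{u}) (x : X) :
    ContMDiff 𝓘(ℝ, X.E) X.I.tangent ∞
      (fun A : X.E => (⟨x, A⟩ : TangentBundle X.I X)) := by
  intro A
  rw [Bundle.contMDiffAt_totalSpace]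
  refine ⟨contMDiffAt_const, ?_⟩
  simp only [trivAt_self]
  exact contMDiffAt_id

theorem tangent_snd (X : Mfd.{u}) {E' H' N : Type*} [NormedAddCommGroup E'] [NormedSpace ℝ E'] [TopologicalSpace H'] {J : ModelWithCorners ℝ E' H'} [TopologicalSpace N] [ChartedSpace H' N]
    (x : X) (F : N → TangentBundle X.I X) (hF : ContMDiff J X.I.tangent ∞ F) (hx : ∀ n, (F n).1 = x) : 
    ContMDiff J 𝓘(ℝ, X.E) ∞ (fun n => ((F n).2 : X.E)) := by
  intro n
  have h := (Bundle.contMDiffAt_totalSpace.1 (hF n)).2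
  refine h.congr_of_eventuallyEq (Filter.Eventually.of_forall fun m => ?_)
  dsimp only
  have h1 : (F n).1 = (F m).1 := (hx n).trans (hx m).symm
  rw [h1]
  exact (X.trivAt_self _ _).symm

theorem family_deriv (A B C : Mfd.{u}) {E' H' N : Type*} [NormedAddCommGroup E']
    [NormedSpace ℝ E'] [TopologicalSpace H'] {J : ModelWithCorners ℝ E' H'} [TopologicalSpace N]
    [ChartedSpace H' N] (F : A → B → C)
    (hF : ContMDiff (A.I.prod B.I) C.I ∞ (fun p : A × B => F p.1 p.2))
    (a : N → A) (ha : ContMDiff J A.I ∞ a)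
    (w : N → TangentBundle B.I B) (hw : ContMDiff J B.I.tangent ∞ w) :
    ContMDiff J C.I.tangent ∞ (fun n =>
      (⟨F (a n) (w n).1, mfderiv B.I C.I (F (a n)) (w n).1 (w n).2⟩ : TangentBundle C.I C)) := by
  have h0 : ContMDiff J A.I.tangent ∞
      (fun n => (⟨a n, 0⟩ : TangentBundle A.I A)) :=
    (contMDiff_zeroSection ℝ (TangentSpace A.I)).comp ha
  have h1 : ContMDiff J (A.I.prod B.I).tangent ∞
      (fun n => (equivTangentBundleProd A.I A B.I B).symm (⟨a n, 0⟩, w n)) :=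
    contMDiff_equivTangentBundleProd_symm.comp (h0.prodMk hw)
  have h2 := (hF.contMDiff_tangentMap (m := ∞) (by simp)).comp h1
  refine h2.congr fun n => ?_
  have hd : MDifferentiableAt (A.I.prod B.I) C.I (fun p : A × B => F p.1 p.2) (a n, (w n).1) :=
    hF.mdifferentiableAt (by simp)
  change _ = (⟨F (a n) (w n).1, mfderiv (A.I.prod B.I) C.I (fun p : A × B => F p.1 p.2)
    (a n, (w n).1) (0, (w n).2)⟩ : TangentBundle C.I C)
  let v2 : B.E := (w n).2
  let v : A.E × B.E := (0, v2)
  have h3 := mfderiv_prod_eq_add_apply hd (v := v)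
  have h4 : mfderiv A.I C.I (fun z => F z (w n).1) (a n) 0 = 0 := map_zero _
  exact congrArg (fun z : C.E => (⟨F (a n) (w n).1, z⟩ : TangentBundle C.I C))
    (h3.trans ((congrArg (· + _) h4).trans (zero_add _))).symm

end Mfd

/-- A smooth `F`-valued 1-form on `X`: a family of linear maps `T_x X → F` that is smooth as a function
on the tangent bundle. -/
structure OneForm (X : Mfd.{u}) (F : Type u) [NormedAddCommGroup F] [NormedSpace ℝ F] where
  toFun : ∀ x : X, TangentSpace X.I x →L[ℝ] F
  smooth : ContMDiff X.I.tangent 𝓘(ℝ, F) ∞ (fun v : TangentBundle X.I X => toFun v.1 v.2)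

namespace OneForm
variable {X Y : Mfd.{u}} {F : Type u} [NormedAddCommGroup F] [NormedSpace ℝ F]

instance : CoeFun (OneForm X F) (fun _ => ∀ x : X, TangentSpace X.I x →L[ℝ] F) := ⟨toFun⟩

@[ext] theorem ext {α β : OneForm X F} (h : ∀ x v, α x v = β x v) : α = β := by
  cases α; cases β; congr; funext x; exact ContinuousLinearMap.ext (h x)

noncomputable instance : Zero (OneForm X F) := ⟨⟨fun _ => 0, contMDiff_const⟩⟩

@[simp] theorem zero_apply (x : X) (v : TangentSpace X.I x) : (0 : OneForm X F) x v = 0 := rfl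

/-- The pullback `φ^*α` of a 1-form. -/
noncomputable def pull (α : OneForm X F) (φ : Y.Map X) : OneForm Y F where
  toFun y := (α (φ y)).comp (mfderiv Y.I X.I φ y)
  smooth := α.smooth.comp (φ.contMDiff.contMDiff_tangentMap (m := ∞) (by simp))

end OneForm

namespace Mfd

/-- The derivative `mfderiv`, with the tangent spaces replaced by the model spaces to which they are
definitionally equal; only used in proofs. -/
noncomputable def der {X Y : Mfd.{u}} (f : X → Y) (x : X) : X.E →L[ℝ] Y.E := mfderiv X.I Y.I f x

theorem mdiff {X Y : Mfd.{u}} {f : X → Y} (hf : ContMDiff X.I Y.I ∞ f) (x : X) :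
    MDifferentiableAt X.I Y.I f x := hf.mdifferentiableAt (by simp)

theorem der_comp {X Y Z : Mfd.{u}} {f : X → Y} {g : Y → Z} (hg : ContMDiff Y.I Z.I ∞ g)
    (hf : ContMDiff X.I Y.I ∞ f) (x : X) (v : X.E) :
    der (fun x => g (f x)) x v = der g (f x) (der f x v) :=
  mfderiv_comp_apply (I' := Y.I) x (mdiff hg _) (mdiff hf _) v

theorem der_id {X : Mfd.{u}} (x : X) (v : X.E) : der (fun x : X => x) x v = v := by
  have : mfderiv X.I X.I (fun x : X => x) x = ContinuousLinearMap.id ℝ (TangentSpace X.I x) :=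
    mfderiv_id
  unfold der
  rw [this]; rfl

theorem der_const {X Y : Mfd.{u}} (c : Y) (x : X) (v : X.E) : der (fun _ : X => c) x v = 0 := by
  have : mfderiv X.I Y.I (fun _ : X => c) x = 0 := mfderiv_const
  unfold der
  rw [this]; rfl

theorem der_two {X A B C : Mfd.{u}} {F : A → B → C}
    (hF : ContMDiff (A.I.prod B.I) C.I ∞ (fun p : A × B => F p.1 p.2))
    {a : X → A} (ha : ContMDiff X.I A.I ∞ a) {b : X → B} (hb : ContMDiff X.I B.I ∞ b)
    (x : X) (v : X.E) :
    der (fun x => F (a x) (b x)) x v =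
      der (fun a' => F a' (b x)) (a x) (der a x v) + der (F (a x)) (b x) (der b x v) := by
  have hd : MDifferentiableAt (A.I.prod B.I) C.I (fun p : A × B => F p.1 p.2) (a x, b x) :=
    hF.mdifferentiableAt (by simp)
  have hp : MDifferentiableAt X.I (A.I.prod B.I) (fun x => (a x, b x)) x :=
    (ha.prodMk hb).mdifferentiableAt (by simp)
  have h1 := mfderiv_comp_apply (I' := A.I.prod B.I) x hd hp v
  have h2 := mfderiv_prod_eq_add_apply hd (v := (mfderiv X.I (A.I.prod B.I) (fun x => (a x, b x)) x v))
  rw [h2] at h1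
  have h3 : mfderiv X.I (A.I.prod B.I) (fun x => (a x, b x)) x =
      (mfderiv X.I A.I a x).prod (mfderiv X.I B.I b x) :=
    mfderiv_prodMk (mdiff ha x) (mdiff hb x)
  rw [h3] at h1
  exact h1

end Mfd

open Mfd

theorem OneForm.pull_id {X : Mfd.{u}} {F : Type u} [NormedAddCommGroup F] [NormedSpace ℝ F]
    (α : OneForm X F) : α.pull (ContMDiffMap.id) = α := by
  refine OneForm.ext fun x (v : X.E) => ?_
  exact congrArg (α x) (der_id x v)

theorem OneForm.pull_comp {X Y Z : Mfd.{u}} {F : Type u} [NormedAddCommGroup F]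
    [NormedSpace ℝ F] (α : OneForm X F) (φ : Y.Map X) (ψ : Z.Map Y) :
    α.pull (φ.comp ψ) = (α.pull φ).pull ψ := by
  refine OneForm.ext fun z (v : Z.E) => ?_
  exact congrArg (α (φ (ψ z))) (der_comp φ.contMDiff ψ.contMDiff z v)

/-- The adjoint action of `g` on the Lie algebra `𝔤 = T_1 G`, the derivative at `1` of `h ↦ g h g⁻¹`.
The tangent space `T_1 G` is definitionally the model space `G.E`; the latter is used as the name of
the Lie algebra since it carries a norm. -/
noncomputable def Ad (G : Mfd.{u}) [Group G] (g : G) : G.E →L[ℝ] G.E :=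
  mfderiv G.I G.I (fun h : G => g * h * g⁻¹) 1

/-- The Maurer-Cartan form `θ_g : T_g G → 𝔤`, the derivative of left translation by `g⁻¹`. -/
noncomputable def maurerCartan (G : Mfd.{u}) [Group G] (g : G) : TangentSpace G.I g →L[ℝ] G.E :=
  mfderiv G.I G.I (fun h : G => g⁻¹ * h) g

section LieLemmas

theorem Ad_one (G : Mfd.{u}) [Group G] (A : G.E) : Ad G (1 : G) A = A := by
  have : (fun h : G => 1 * h * 1⁻¹) = fun h => h := by funext h; simp
  change der (fun h : G => 1 * h * 1⁻¹) 1 A = A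
  rw [this, der_id]

variable {G : Mfd.{u}} [Group G] [LieGroup G.I ∞ G]

theorem conj_smooth (g : G) : ContMDiff G.I G.I ∞ (fun h : G => g * h * g⁻¹) :=
  (contMDiff_const.mul contMDiff_id).mul contMDiff_const

theorem Ad_mul (g h : G) (A : G.E) : Ad G (g * h) A = Ad G g (Ad G h A) := by
  have e : (fun k : G => (g * h) * k * (g * h)⁻¹) =
      (fun k : G => (fun k : G => g * k * g⁻¹) (h * k * h⁻¹)) := by
    funext k; simp [mul_assoc]
  change der (fun k : G => (g * h) * k * (g * h)⁻¹) 1 A =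
    der (fun k : G => g * k * g⁻¹) 1 (der (fun k : G => h * k * h⁻¹) 1 A)
  rw [e, der_comp (conj_smooth g) (conj_smooth h)]
  simp

variable {X Y : Mfd.{u}}

theorem maurerCartan_mul (a b : X.Map G) (x : X) (v : X.E) :
    maurerCartan G ((a * b) x) (der (a * b : X.Map G) x v) =
      Ad G (b x)⁻¹ (maurerCartan G (a x) (der a x v)) + maurerCartan G (b x) (der b x v) := by
  have hl : ∀ g : G, ContMDiff G.I G.I ∞ (fun h : G => g * h) :=
    fun g => contMDiff_const.mul contMDiff_id
  have hr : ∀ g : G, ContMDiff G.I G.I ∞ (fun h : G => h * g) :=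
    fun g => contMDiff_id.mul contMDiff_const
  change der (fun h : G => (a x * b x)⁻¹ * h) (a x * b x) (der (fun x => a x * b x) x v) =
    der (fun k : G => (b x)⁻¹ * k * ((b x)⁻¹)⁻¹) 1
      (der (fun h : G => (a x)⁻¹ * h) (a x) (der a x v)) +
      der (fun h : G => (b x)⁻¹ * h) (b x) (der b x v)
  rw [der_two (F := fun g h : G => g * h) (contMDiff_mul G.I ∞) a.contMDiff b.contMDiff, map_add]
  congr 1
  · have e1 := der_comp (hl (a x * b x)⁻¹) (hr (b x)) (a x) (der a x v)
    have e2 := der_comp (conj_smooth (b x)⁻¹) (hl (a x)⁻¹) (a x) (der a x v)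
    rw [inv_mul_cancel] at e2
    rw [← e1, ← e2]
    congr 2
    funext h
    simp [mul_assoc]
  · have e1 := der_comp (hl (a x * b x)⁻¹) (hl (a x)) (b x) (der b x v)
    rw [← e1]
    congr 2
    funext h
    simp [mul_assoc]

namespace OneForm

/-- The right action of gauge transformations on `𝔤`-valued forms, `α · g = Ad_{g⁻¹} α + g^* θ`. -/
noncomputable def gauge (α : OneForm X G.E) (g : X.Map G) : OneForm X G.E where
  toFun x := (Ad G (g x)⁻¹).comp (α x) + (maurerCartan G (g x)).comp (mfderiv X.I G.I g x)
  smooth := by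
    have hπ : ContMDiff X.I.tangent X.I ∞ (fun v : TangentBundle X.I X => v.1) :=
      contMDiff_proj (TangentSpace X.I)
    have hg := g.contMDiff.comp hπ
    have h1 := family_deriv G G G (fun a h => a * h * a⁻¹)
      ((contMDiff_fst.mul contMDiff_snd).mul contMDiff_fst.inv) _ hg.inv _
      ((tangent_incl G 1).comp α.smooth)
    have h2 := family_deriv G G G (fun a h => a⁻¹ * h)
      (contMDiff_fst.inv.mul contMDiff_snd) _ hg _
      (g.contMDiff.contMDiff_tangentMap (m := ∞) (by simp))
    exact (tangent_snd G 1 _ h1 (by simp)).add (tangent_snd G 1 _ h2 (by simp [tangentMap]))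

theorem gauge_one (α : OneForm X G.E) : α.gauge (1 : X.Map G) = α := by
  refine OneForm.ext fun x (v : X.E) => ?_
  have h : maurerCartan G (1 : G) (der (fun _ : X => (1 : G)) x v) = 0 :=
    (congrArg (maurerCartan G (1 : G)) (der_const (1 : G) x v)).trans (map_zero _)
  have h' : Ad G (1 : G)⁻¹ (α x v) = α x v := by rw [inv_one]; exact Ad_one G _
  exact (congrArg (_ + ·) h).trans ((add_zero _).trans h')

theorem gauge_mul (α : OneForm X G.E) (a b : X.Map G) :
    α.gauge (a * b) = (α.gauge a).gauge b := by
  refine OneForm.ext fun x (v : X.E) => ?_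
  have := maurerCartan_mul a b x v
  change Ad G (a x * b x)⁻¹ (α x v) + maurerCartan G ((a * b) x) (der (a * b : X.Map G) x v) =
    Ad G (b x)⁻¹ (Ad G (a x)⁻¹ (α x v) + maurerCartan G (a x) (der a x v)) +
      maurerCartan G (b x) (der b x v)
  rw [this, map_add, mul_inv_rev, Ad_mul, add_assoc]

theorem pull_gauge (α : OneForm X G.E) (g : X.Map G) (φ : Y.Map X) :
    (α.gauge g).pull φ = (α.pull φ).gauge (g.comp φ) := by
  refine OneForm.ext fun y (v : Y.E) => ?_
  have := der_comp g.contMDiff φ.contMDiff y v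
  change _ + maurerCartan G (g (φ y)) (der g (φ y) (der φ y v)) =
    _ + maurerCartan G (g (φ y)) (der (fun y => g (φ y)) y v)
  rw [this]
  rfl

theorem zero_gauge_const (g : G) :
    (0 : OneForm X G.E).gauge (ContMDiffMap.const g) = 0 := by
  refine OneForm.ext fun x (v : X.E) => ?_
  have h : maurerCartan G g (der (fun _ : X => g) x v) = 0 :=
    (congrArg (maurerCartan G g) (der_const g x v)).trans (map_zero _)
  have h' : Ad G g⁻¹ 0 = 0 := map_zero _
  exact (congrArg (Ad G g⁻¹ 0 + ·) h).trans ((add_zero _).trans h')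

end OneForm
end LieLemmas

/-- An object `(α, f)` over `X` of the differential action groupoid `M//_∇ G`: a 1-form
`α ∈ Ω¹(X; 𝔤)` and a smooth map `f : X → M`. -/
structure DiffAct (G M X : Mfd.{u}) where
  form : OneForm X G.E
  map : X.Map M

namespace DiffAct

/-- Base change of objects along `φ : Y → X`: `φ^*(α, f) = (φ^*α, f ∘ φ)`. -/
noncomputable def pull {G M X Y : Mfd.{u}} (a : DiffAct G M X) (φ : Y.Map X) : DiffAct G M Y :=
  ⟨a.form.pull φ, a.map.comp φ⟩

theorem pull_id {G M X : Mfd.{u}} (a : DiffAct G M X) : a.pull ContMDiffMap.id = a := by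
  cases a; simp only [pull, OneForm.pull_id]; rfl

theorem pull_comp {G M X Y Z : Mfd.{u}} (a : DiffAct G M X) (φ : Y.Map X) (ψ : Z.Map Y) :
    a.pull (φ.comp ψ) = (a.pull φ).pull ψ := by
  cases a; simp only [pull, OneForm.pull_comp]; rfl

variable {G M X Y Z : Mfd.{u}} [Group G] [LieGroup G.I ∞ G] [MulAction G M]

/-- A morphism `(g, α, f) : (α, f) ⟶ (α · g⁻¹, g f)` over `X`, given by a smooth map `g : X → G`. -/
structure Hom (a b : DiffAct G M X) where
  g : X.Map G
  form_eq : b.form = a.form.gauge g⁻¹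
  map_eq : ∀ x, b.map x = g x • a.map x

@[ext] theorem Hom.ext' {a b : DiffAct G M X} {f h : Hom a b} (e : f.g = h.g) : f = h := by
  cases f; cases h; congr

/-- The groupoid `(M//_∇ G)(X)`; composition is multiplication in `G`. -/
noncomputable instance : Category (DiffAct G M X) where
  Hom := Hom
  id a := ⟨1, by rw [inv_one, OneForm.gauge_one], fun x => (one_smul G _).symm⟩
  comp f h := ⟨h.g * f.g, by
    rw [h.form_eq, f.form_eq, mul_inv_rev, OneForm.gauge_mul], fun x => by
    rw [h.map_eq, f.map_eq, smul_smul]; rfl⟩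
  id_comp f := Hom.ext' (mul_one f.g)
  comp_id f := Hom.ext' (one_mul f.g)
  assoc f h k := Hom.ext' (mul_assoc k.g h.g f.g).symm

/-- Base change of morphisms: `φ^*(g, α, f) = (g ∘ φ, φ^*α, f ∘ φ)`. -/
noncomputable def pullMap {a b : DiffAct G M X} (f : a ⟶ b) (φ : Y.Map X) : a.pull φ ⟶ b.pull φ :=
  ⟨f.g.comp φ, by
    change b.form.pull φ = _
    rw [f.form_eq, OneForm.pull_gauge]; rfl, fun y => f.map_eq (φ y)⟩

/-- The identity morphism between equal objects, with `g = 1`. -/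
noncomputable def ofEq {a b : DiffAct G M X} (h : a = b) : a ⟶ b :=
  ⟨1, by rw [inv_one, OneForm.gauge_one, h], fun x => by rw [h]; exact (one_smul G _).symm⟩

end DiffAct

/-- A smooth principal `K`-bundle over `X`: a smooth map from the total space to `X`, a smooth right
`K`-action, and smooth `K`-equivariant local trivializations. -/
structure PrincipalBundle (K X : Mfd.{u}) [Group K] where
  total : Mfd.{u}
  proj : total → X
  proj_smooth : ContMDiff total.I X.I ∞ proj
  act : total → K → total
  act_smooth : ContMDiff (total.I.prod K.I) total.I ∞ (fun z : total × K => act z.1 z.2)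
  act_one : ∀ p, act p 1 = p
  act_mul : ∀ p k l, act p (k * l) = act (act p k) l
  proj_act : ∀ p k, proj (act p k) = proj p
  locally_trivial : ∀ x : X, ∃ e : Trivialization K proj, x ∈ e.baseSet ∧
    ContMDiffOn total.I (X.I.prod K.I) ∞ e e.source ∧
    ContMDiffOn (X.I.prod K.I) total.I ∞ e.toOpenPartialHomeomorph.symm e.target ∧
    ∀ p ∈ e.source, ∀ k, e (act p k) = ((e p).1, (e p).2 * k)

namespace PrincipalBundle
variable {K X Y : Mfd.{u}} [Group K] (P : PrincipalBundle K Y)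

/-- The property of the local trivializations of a principal bundle: smooth in both directions and
`K`-equivariant. -/
structure IsTriv (e : Trivialization K P.proj) : Prop where
  smooth : ContMDiffOn P.total.I (Y.I.prod K.I) ∞ e e.source
  smooth_symm : ContMDiffOn (Y.I.prod K.I) P.total.I ∞ e.toOpenPartialHomeomorph.symm e.target
  equivariant : ∀ p ∈ e.source, ∀ k, e (P.act p k) = ((e p).1, (e p).2 * k)

theorem exists_fiber (y : Y) : ∃ p : P.total, P.proj p = y := by
  obtain ⟨e, he, -⟩ := P.locally_trivial y
  exact ⟨e.toOpenPartialHomeomorph.symm (y, 1), e.proj_symm_apply' he⟩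

/-- The set `X ×_Y P` underlying the pullback of `P`. -/
abbrev PullSpace (φ : X → Y) : Type u := {z : X × P.total // φ z.1 = P.proj z.2}

open Classical in
/-- The local trivialization of `X ×_Y P` over `X` induced by one of `P`. -/
noncomputable def pullTriv (φ : X.Map Y) (e : Trivialization K P.proj) :
    OpenPartialHomeomorph (P.PullSpace φ) (X × K) where
  toFun z := (z.1.1, (e z.1.2).2)
  invFun q := if h : φ q.1 ∈ e.baseSet then
      ⟨(q.1, e.toOpenPartialHomeomorph.symm (φ q.1, q.2)), (e.proj_symm_apply' h).symm⟩
    else ⟨(q.1, Classical.choose (P.exists_fiber (φ q.1))),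
      (Classical.choose_spec (P.exists_fiber (φ q.1))).symm⟩
  source := {z | φ z.1.1 ∈ e.baseSet}
  target := {q | φ q.1 ∈ e.baseSet}
  map_source' z hz := hz
  map_target' q hq := by
    have hq' : φ q.1 ∈ e.baseSet := hq
    change φ (dite _ _ _ : P.PullSpace φ).1.1 ∈ e.baseSet
    rw [dif_pos hq']
    exact hq'
  left_inv' z hz := by
    have hz' : φ z.1.1 ∈ e.baseSet := hz
    simp only [hz', dite_true]
    apply Subtype.ext
    refine Prod.ext rfl ?_
    have : z.1.2 ∈ e.source := e.mem_source.2 (z.2 ▸ hz')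
    change e.toOpenPartialHomeomorph.symm (φ z.1.1, (e z.1.2).2) = z.1.2
    rw [z.2, ← e.coe_fst this]
    exact e.left_inv this
  right_inv' q hq := by
    have hq' : φ q.1 ∈ e.baseSet := hq
    simp only [hq', dite_true]
    refine Prod.ext rfl ?_
    change (e (e.toOpenPartialHomeomorph.symm (φ q.1, q.2))).2 = q.2
    rw [e.apply_symm_apply' hq']
  open_source := e.open_baseSet.preimage
    (φ.contMDiff.continuous.comp (continuous_fst.comp continuous_subtype_val))
  open_target := e.open_baseSet.preimage (φ.contMDiff.continuous.comp continuous_fst)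
  continuousOn_toFun := by
    refine (continuous_fst.comp continuous_subtype_val).continuousOn.prodMk ?_
    have : ContinuousOn (fun z : P.PullSpace φ => e z.1.2) {z | φ z.1.1 ∈ e.baseSet} := by
      refine e.toOpenPartialHomeomorph.continuousOn.comp (t := e.source)
        (continuous_snd.comp continuous_subtype_val).continuousOn ?_
      intro z hz
      exact e.mem_source.2 (z.2 ▸ hz)
    exact continuous_snd.comp_continuousOn this
  continuousOn_invFun := by
    refine Topology.IsInducing.subtypeVal.continuousOn_iff.2 ?_
    have : ContinuousOn (fun q : X × K => (q.1, e.toOpenPartialHomeomorph.symm (φ q.1, q.2)))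
        {q | φ q.1 ∈ e.baseSet} := by
      refine continuous_fst.continuousOn.prodMk (e.toOpenPartialHomeomorph.symm.continuousOn.comp
        ((φ.contMDiff.continuous.comp continuous_fst).prodMk continuous_snd).continuousOn ?_)
      intro q hq
      exact e.mem_target.2 hq
    refine this.congr fun q hq => ?_
    have hq' : φ q.1 ∈ e.baseSet := hq
    simp only [Function.comp_apply, hq', dite_true]

theorem pullTriv_symm (φ : X.Map Y) (e : Trivialization K P.proj) (q : X × K)
    (hq : φ q.1 ∈ e.baseSet) :
    (((P.pullTriv φ e).symm q).1 : X × P.total) =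
      (q.1, e.toOpenPartialHomeomorph.symm (φ q.1, q.2)) := by
  classical
  change (dite _ _ _ : P.PullSpace φ).1 = _
  rw [dif_pos hq]

theorem exists_triv (y : Y) : ∃ e : Trivialization K P.proj, y ∈ e.baseSet ∧ P.IsTriv e := by
  obtain ⟨e, h1, h2, h3, h4⟩ := P.locally_trivial y
  exact ⟨e, h1, h2, h3, h4⟩

/-- The atlas of `X ×_Y P` with values in `X × K` given by the induced trivializations. -/
@[reducible] noncomputable def pullCharts (φ : X.Map Y) : ChartedSpace (X × K) (P.PullSpace φ) where
  atlas := {c | ∃ e, P.IsTriv e ∧ c = P.pullTriv φ e}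
  chartAt z := P.pullTriv φ (Classical.choose (P.exists_triv (φ z.1.1)))
  mem_chart_source z := (Classical.choose_spec (P.exists_triv (φ z.1.1))).1
  chart_mem_atlas z := ⟨_, (Classical.choose_spec (P.exists_triv (φ z.1.1))).2, rfl⟩

theorem pullCharts_compatible (φ : X.Map Y) :
    let _ := P.pullCharts φ
    ∀ c ∈ atlas (X × K) (P.PullSpace φ), ∀ c' ∈ atlas (X × K) (P.PullSpace φ),
      ContMDiffOn (X.I.prod K.I) (X.I.prod K.I) ∞ (c.symm ≫ₕ c') (c.symm ≫ₕ c').source := by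
  intro _ c hc c' hc'
  obtain ⟨e, he, rfl⟩ := hc
  obtain ⟨e', he', rfl⟩ := hc'
  have key : ∀ q ∈ ((P.pullTriv φ e).symm ≫ₕ P.pullTriv φ e').source,
      φ q.1 ∈ e.baseSet ∧ φ q.1 ∈ e'.baseSet := by
    intro q hq
    have h1 : φ q.1 ∈ e.baseSet := hq.1
    refine ⟨h1, ?_⟩
    have h2 : φ (((P.pullTriv φ e).symm q).1.1) ∈ e'.baseSet := hq.2
    rwa [P.pullTriv_symm φ e q h1] at h2
  have hφ : ContMDiff (X.I.prod K.I) (Y.I.prod K.I) ∞ (fun q : X × K => (φ q.1, q.2)) :=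
    (φ.contMDiff.comp contMDiff_fst).prodMk contMDiff_snd
  have : ContMDiffOn (X.I.prod K.I) (X.I.prod K.I) ∞
      (fun q : X × K => (q.1, (e' (e.toOpenPartialHomeomorph.symm (φ q.1, q.2))).2))
      ((P.pullTriv φ e).symm ≫ₕ P.pullTriv φ e').source := by
    refine contMDiff_fst.contMDiffOn.prodMk (contMDiff_snd.comp_contMDiffOn
      (he'.smooth.comp (he.smooth_symm.comp hφ.contMDiffOn ?_) ?_))
    · intro q hq
      exact e.mem_target.2 (key q hq).1
    · intro q hq
      refine e'.mem_source.2 ?_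
      change P.proj (e.toOpenPartialHomeomorph.symm (φ q.1, q.2)) ∈ _
      rw [e.proj_symm_apply' (key q hq).1]
      exact (key q hq).2
  refine this.congr fun q hq => ?_
  change ((((P.pullTriv φ e).symm q).1 : X × P.total).1,
    (e' (((P.pullTriv φ e).symm q).1 : X × P.total).2).2) = _
  rw [P.pullTriv_symm φ e q (key q hq).1]

/-- The manifold `X ×_Y P`. -/
noncomputable def pullTotal (φ : X.Map Y) : Mfd.{u} :=
  letI := P.pullCharts φ
  letI : ChartedSpace (ModelProd X.H K.H) (P.PullSpace φ) :=
    ChartedSpace.comp (ModelProd X.H K.H) (X × K) (P.PullSpace φ)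
  haveI := isManifold_comp (X.I.prod K.I) (P.pullCharts_compatible φ)
  { carrier := P.PullSpace φ
    E := X.E × K.E
    H := ModelProd X.H K.H
    I := X.I.prod K.I
    countable := Topology.IsEmbedding.subtypeVal.secondCountableTopology }

section Pull
variable {P} {φ : X.Map Y}

/-- The projection `X ×_Y P → X`. -/
def pullFst (z : P.pullTotal φ) : X := (Subtype.val (p := fun w : X × P.total => φ w.1 = P.proj w.2) z).1

/-- The projection `X ×_Y P → P`. -/
def pullSnd (z : P.pullTotal φ) : P.total := (Subtype.val (p := fun w : X × P.total => φ w.1 = P.proj w.2) z).2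

theorem pull_eq (z : P.pullTotal φ) : φ (pullFst z) = P.proj (pullSnd z) :=
  Subtype.property (p := fun w : X × P.total => φ w.1 = P.proj w.2) z

/-- The point `(x, p)` of `X ×_Y P`. -/
def pullMk (x : X) (p : P.total) (h : φ x = P.proj p) : P.pullTotal φ :=
  (⟨(x, p), h⟩ : P.PullSpace φ)

theorem pull_ext {z w : P.pullTotal φ} (h1 : pullFst z = pullFst w) (h2 : pullSnd z = pullSnd w) :
    z = w := Subtype.ext (Prod.ext h1 h2)

variable (φ) in
/-- `pullTriv` on the manifold `X ×_Y P`. -/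
noncomputable def pullChart (e : Trivialization K P.proj) :
    OpenPartialHomeomorph (P.pullTotal φ) (X × K) := P.pullTriv φ e

theorem pullChart_apply (e : Trivialization K P.proj) (z : P.pullTotal φ) :
    pullChart φ e z = (pullFst z, (e (pullSnd z)).2) := rfl

theorem mem_pullChart_source (e : Trivialization K P.proj) (z : P.pullTotal φ) :
    z ∈ (pullChart φ e).source ↔ φ (pullFst z) ∈ e.baseSet := Iff.rfl

theorem mem_pullChart_target (e : Trivialization K P.proj) (q : X × K) :
    q ∈ (pullChart φ e).target ↔ φ q.1 ∈ e.baseSet := Iff.rfl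

theorem pullSnd_symm (e : Trivialization K P.proj) (q : X × K) (hq : φ q.1 ∈ e.baseSet) :
    pullSnd ((pullChart φ e).symm q) = e.toOpenPartialHomeomorph.symm (φ q.1, q.2) :=
  congrArg Prod.snd (P.pullTriv_symm φ e q hq)

theorem pullChart_smooth {e : Trivialization K P.proj} (he : P.IsTriv e) :
    ContMDiffOn (P.pullTotal φ).I (X.I.prod K.I) ∞ (pullChart φ e) (pullChart φ e).source ∧
    ContMDiffOn (X.I.prod K.I) (P.pullTotal φ).I ∞ (pullChart φ e).symm
      (pullChart φ e).target :=
  letI := P.pullCharts φ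
  contMDiffAt_of_atlas (X.I.prod K.I) (P.pullCharts_compatible φ) _ ⟨e, he, rfl⟩

theorem pullFst_smooth : ContMDiff (P.pullTotal φ).I X.I ∞ (pullFst (P := P) (φ := φ)) := by
  intro z
  obtain ⟨e, hz, he⟩ := P.exists_triv (φ (pullFst z))
  have := ((pullChart_smooth he).1.contMDiffAt ((pullChart φ e).open_source.mem_nhds hz))
  change ContMDiffAt (P.pullTotal φ).I X.I ∞ (fun z => (pullChart φ e z).1) z
  exact contMDiff_fst.contMDiffAt.comp z this

theorem pullSnd_smooth :
    ContMDiff (P.pullTotal φ).I P.total.I ∞ (pullSnd (P := P) (φ := φ)) := by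
  intro z
  obtain ⟨e, hz, he⟩ := P.exists_triv (φ (pullFst z))
  have hn := (pullChart φ e).open_source.mem_nhds hz
  have h1 := (pullChart_smooth he).1.contMDiffAt hn
  have hφ : ContMDiff (X.I.prod K.I) (Y.I.prod K.I) ∞ (fun q : X × K => (φ q.1, q.2)) :=
    (φ.contMDiff.comp contMDiff_fst).prodMk contMDiff_snd
  have h2 : ContMDiffAt (Y.I.prod K.I) P.total.I ∞ e.toOpenPartialHomeomorph.symm
      (φ (pullFst z), (e (pullSnd z)).2) :=
    he.smooth_symm.contMDiffAt (e.open_target.mem_nhds (e.mem_target.2 hz))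
  have h3 := ContMDiffAt.comp z (g := e.toOpenPartialHomeomorph.symm) h2
    (hφ.contMDiffAt.comp z h1)
  refine h3.congr_of_eventuallyEq ?_
  filter_upwards [hn] with w hw
  have hw' : pullSnd w ∈ e.source := e.mem_source.2 (pull_eq w ▸ hw)
  change _ = e.toOpenPartialHomeomorph.symm (φ (pullFst w), (e (pullSnd w)).2)
  rw [pull_eq w, ← e.coe_fst hw']
  exact (e.left_inv hw').symm

theorem pullMk_smooth {E' H' N : Type*} [NormedAddCommGroup E']
    [NormedSpace ℝ E'] [TopologicalSpace H'] {J : ModelWithCorners ℝ E' H'} [TopologicalSpace N]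
    [ChartedSpace H' N] {a : N → X} {b : N → P.total} (ha : ContMDiff J X.I ∞ a)
    (hb : ContMDiff J P.total.I ∞ b) (h : ∀ n, φ (a n) = P.proj (b n)) :
    ContMDiff J (P.pullTotal φ).I ∞ (fun n => pullMk (a n) (b n) (h n)) := by
  intro n
  obtain ⟨e, hz, he⟩ := P.exists_triv (φ (a n))
  have hbn : b n ∈ e.source := e.mem_source.2 (h n ▸ hz)
  have h1 : ContMDiffAt J (Y.I.prod K.I) ∞ (fun m => e (b m)) n :=
    (he.smooth.contMDiffAt (e.open_source.mem_nhds hbn)).comp n hb.contMDiffAt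
  have h2 : ContMDiffAt J (X.I.prod K.I) ∞ (fun m => (a m, (e (b m)).2)) n :=
    ha.contMDiffAt.prodMk (contMDiff_snd.contMDiffAt.comp n h1)
  have h3 := (pullChart_smooth (φ := φ) he).2.contMDiffAt (x := (a n, (e (b n)).2))
    ((pullChart φ e).open_target.mem_nhds hz)
  refine (h3.comp n h2).congr_of_eventuallyEq ?_
  have : ∀ᶠ m in 𝓝 n, b m ∈ e.source :=
    hb.continuous.continuousAt.eventually (e.open_source.mem_nhds hbn)
  filter_upwards [this] with m hm
  exact ((pullChart φ e).left_inv (x := pullMk (a m) (b m) (h m))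
    (show φ (a m) ∈ e.baseSet from h m ▸ e.mem_source.1 hm)).symm

end Pull

/-- The pullback bundle `φ^*P`, with total space `X ×_Y P`. -/
noncomputable def pull (φ : X.Map Y) : PrincipalBundle K X where
  total := P.pullTotal φ
  proj := pullFst
  proj_smooth := pullFst_smooth
  act z k := pullMk (pullFst z) (P.act (pullSnd z) k) (by rw [P.proj_act]; exact pull_eq z)
  act_smooth := pullMk_smooth (pullFst_smooth.comp contMDiff_fst)
    (P.act_smooth.comp ((pullSnd_smooth.comp contMDiff_fst).prodMk contMDiff_snd)) _
  act_one z := pull_ext rfl (P.act_one _)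
  act_mul z k l := pull_ext rfl (P.act_mul _ k l)
  proj_act z k := rfl
  locally_trivial x := by
    obtain ⟨e, hx, he⟩ := P.exists_triv (φ x)
    let t : Trivialization K (pullFst (P := P) (φ := φ)) :=
      { toOpenPartialHomeomorph := pullChart φ e
        baseSet := φ ⁻¹' e.baseSet
        open_baseSet := e.open_baseSet.preimage φ.contMDiff.continuous
        source_eq := rfl
        target_eq := by
          ext q
          change φ q.1 ∈ e.baseSet ↔ _
          simp
        proj_toFun := fun z hz => rfl }
    refine ⟨t, hx, (pullChart_smooth he).1, (pullChart_smooth he).2, fun z hz k => ?_⟩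
    have hz' : pullSnd z ∈ e.source := e.mem_source.2 (pull_eq z ▸ hz)
    refine Prod.ext rfl ?_
    change (e (P.act (pullSnd z) k)).2 = (e (pullSnd z)).2 * k
    rw [he.equivariant _ hz' k]

end PrincipalBundle

open PrincipalBundle (pullFst pullSnd pullMk pull_eq pull_ext pullFst_smooth pullSnd_smooth
  pullMk_smooth)

/-- A principal `K`-bundle with connection `(P, Θ)` over `X`: the 1-form `Θ ∈ Ω¹(P; 𝔨)` reproduces the
generators of the fundamental vector fields and satisfies `R_k^* Θ = Ad_{k⁻¹} Θ`. -/
structure BunConn (K X : Mfd.{u}) [Group K] extends PrincipalBundle K X where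
  conn : OneForm total K.E
  conn_vertical : ∀ (p : total) (A : K.E),
    conn (act p 1) (mfderiv K.I total.I (act p) 1 A) = A
  conn_equivariant : ∀ (p : total) (k : K) (v : TangentSpace total.I p),
    conn (act p k) (mfderiv total.I total.I (fun q => act q k) p v) = Ad K k⁻¹ (conn p v)

namespace BunConn
variable {K X Y : Mfd.{u}} [Group K]

/-- A morphism of principal bundles with connection covering the identity of `X`: a smooth
`K`-equivariant map over `X` that preserves the connection. It is automatically invertible. -/
structure Hom (P Q : BunConn K X) where
  toFun : P.total → Q.total
  smooth : ContMDiff P.total.I Q.total.I ∞ toFun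
  proj_eq : ∀ p, Q.proj (toFun p) = P.proj p
  equivariant : ∀ p k, toFun (P.act p k) = Q.act (toFun p) k
  conn_eq : ∀ (p : P.total) (v : TangentSpace P.total.I p),
    Q.conn (toFun p) (mfderiv P.total.I Q.total.I toFun p v) = P.conn p v

theorem Hom.ext' {P Q : BunConn K X} {f g : Hom P Q} (h : ∀ p, f.toFun p = g.toFun p) : f = g := by
  cases f; cases g; congr; exact funext h

/-- The groupoid of principal `K`-bundles with connection on `X`. -/
noncomputable instance : Category (BunConn K X) where
  Hom := Hom
  id P := ⟨fun p => p, contMDiff_id, fun _ => rfl, fun _ _ => rfl,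
    fun p (v : P.total.E) => congrArg (P.conn p) (der_id p v)⟩
  comp {P Q R} f g := ⟨fun p => g.toFun (f.toFun p), g.smooth.comp f.smooth,
    fun p => (g.proj_eq _).trans (f.proj_eq p),
    fun p k => by rw [f.equivariant, g.equivariant], fun p (v : P.total.E) =>
      (congrArg (R.conn _) (der_comp g.smooth f.smooth p v)).trans
        ((g.conn_eq (f.toFun p) _).trans (f.conn_eq p v))⟩
  id_comp f := rfl
  comp_id f := rfl
  assoc f g h := rfl

/-- The pullback `φ^*(P, Θ)`; its connection is the pullback of `Θ` along `φ^*P → P`. -/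
noncomputable def pull (P : BunConn K Y) (φ : X.Map Y) : BunConn K X where
  toPrincipalBundle := P.toPrincipalBundle.pull φ
  conn := P.conn.pull ⟨pullSnd, pullSnd_smooth⟩
  conn_vertical z A := by
    have h := der_comp (f := fun k : K => (P.toPrincipalBundle.pull φ).act z k)
      (pullSnd_smooth (P := P.toPrincipalBundle) (φ := φ))
      (((P.toPrincipalBundle.pull φ).act_smooth).comp (contMDiff_const.prodMk contMDiff_id)) 1 A
    exact (congrArg (P.conn (P.act (pullSnd z) 1)) h.symm).trans (P.conn_vertical _ A)
  conn_equivariant z k (v : (P.pullTotal φ).E) := by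
    have hs := pullSnd_smooth (P := P.toPrincipalBundle) (φ := φ)
    have h := der_comp (f := fun q => (P.toPrincipalBundle.pull φ).act q k) hs
      (((P.toPrincipalBundle.pull φ).act_smooth).comp (contMDiff_id.prodMk contMDiff_const)) z v
    have h' := der_comp (g := fun q => P.act q k)
      (P.act_smooth.comp (contMDiff_id.prodMk contMDiff_const)) hs z v
    exact (congrArg (P.conn (P.act (pullSnd z) k)) (h.symm.trans h')).trans
      (P.conn_equivariant _ k _)

/-- The pullback `φ^*` on morphisms. -/
noncomputable def pullMap {P Q : BunConn K Y} (φ : X.Map Y) (f : P ⟶ Q) : P.pull φ ⟶ Q.pull φ where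
  toFun z := pullMk (pullFst z) (f.toFun (pullSnd z)) ((pull_eq z).trans (f.proj_eq _).symm)
  smooth := pullMk_smooth pullFst_smooth (f.smooth.comp pullSnd_smooth) _
  proj_eq _ := rfl
  equivariant z k := pull_ext rfl (f.equivariant (pullSnd z) k)
  conn_eq z (v : (P.pullTotal φ).E) := by
    have hs := pullSnd_smooth (P := P.toPrincipalBundle) (φ := φ)
    have hm : ContMDiff (P.pullTotal φ).I (Q.pullTotal φ).I ∞ (fun z : P.pullTotal φ =>
      (pullMk (pullFst z) (f.toFun (pullSnd z)) ((pull_eq z).trans (f.proj_eq _).symm) :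
        Q.pullTotal φ)) := pullMk_smooth pullFst_smooth (f.smooth.comp pullSnd_smooth) _
    have h := der_comp (pullSnd_smooth (P := Q.toPrincipalBundle) (φ := φ)) hm z v
    have h' := der_comp f.smooth hs z v
    exact (congrArg (Q.conn (f.toFun (pullSnd z))) (h.symm.trans h')).trans (f.conn_eq _ _)

/-- The canonical isomorphism `id^*P ≅ P`. -/
noncomputable def pullId (P : BunConn K X) : P.pull ContMDiffMap.id ⟶ P where
  toFun z := pullSnd z
  smooth := pullSnd_smooth
  proj_eq z := (pull_eq z).symm
  equivariant _ _ := rfl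
  conn_eq _ _ := rfl

/-- The canonical isomorphism `(φ ∘ ψ)^*P ≅ ψ^*φ^*P`. -/
noncomputable def pullComp {Z : Mfd.{u}} (P : BunConn K Y) (φ : X.Map Y) (ψ : Z.Map X) :
    P.pull (φ.comp ψ) ⟶ (P.pull φ).pull ψ where
  toFun z := pullMk (pullFst z)
    (pullMk (ψ (pullFst z)) (pullSnd z) (pull_eq z) : P.pullTotal φ) rfl
  smooth := pullMk_smooth pullFst_smooth
    (pullMk_smooth (ψ.contMDiff.comp pullFst_smooth) pullSnd_smooth _) _
  proj_eq _ := rfl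
  equivariant _ _ := rfl
  conn_eq z (v : (P.pullTotal (φ.comp ψ)).E) := by
    have hm : ContMDiff (P.pullTotal (φ.comp ψ)).I (P.pullTotal φ).I ∞
        (fun z : P.pullTotal (φ.comp ψ) =>
          (pullMk (ψ (pullFst z)) (pullSnd z) (pull_eq z) : P.pullTotal φ)) :=
      pullMk_smooth (ψ.contMDiff.comp pullFst_smooth) pullSnd_smooth _
    have hm' : ContMDiff (P.pullTotal (φ.comp ψ)).I ((P.pull φ).pullTotal ψ).I ∞
        (fun z : P.pullTotal (φ.comp ψ) =>
          (pullMk (pullFst z) (pullMk (ψ (pullFst z)) (pullSnd z) (pull_eq z) : P.pullTotal φ) rfl :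
            (P.pull φ).pullTotal ψ)) := pullMk_smooth pullFst_smooth hm _
    have h := der_comp (pullSnd_smooth (P := (P.pull φ).toPrincipalBundle) (φ := ψ)) hm' z v
    have h' := der_comp (pullSnd_smooth (P := P.toPrincipalBundle) (φ := φ)) hm z v
    exact congrArg (P.conn (pullSnd z)) ((congrArg (der pullSnd _) h).symm.trans h'.symm)

theorem conn_congr (P : BunConn K X) {p q : P.total} (h : p = q) (v : P.total.E) :
    P.conn p v = P.conn q v := by subst h; rfl

end BunConn

/-- The structure of a `G`-equivariant principal `K`-bundle with `G`-invariant connection on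
`Q = (Q, Θ)`: a smooth left `G`-action on the total space that covers the action on `M`, commutes with
`K` and preserves `Θ`. -/
structure EquivStr (G : Mfd.{u}) {K M : Mfd.{u}} [Group G] [Group K] [MulAction G M]
    (Q : BunConn K M) where
  act : G → Q.total → Q.total
  act_smooth : ContMDiff (G.I.prod Q.total.I) Q.total.I ∞ (fun z : G × Q.total => act z.1 z.2)
  one_act : ∀ q, act 1 q = q
  mul_act : ∀ g h q, act (g * h) q = act g (act h q)
  proj_act : ∀ g q, Q.proj (act g q) = g • Q.proj q
  act_comm : ∀ g q k, act g (Q.act q k) = Q.act (act g q) k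
  conn_invariant : ∀ (g : G) (q : Q.total) (v : TangentSpace Q.total.I q),
    Q.conn (act g q) (mfderiv Q.total.I Q.total.I (act g) q v) = Q.conn q v

namespace EquivStr
variable {G K M X : Mfd.{u}} [Group G] [LieGroup G.I ∞ G] [Group K] [MulAction G M]
  {Q : BunConn K M} (S : EquivStr G Q)

/-- The vector field `ρ(A)` at `q`: the derivative at `t = 0` of `e^{-tA} q`. As `t ↦ e^{tA}` is a curve
through `1` with velocity `A`, this is the derivative of `g ↦ g⁻¹ q` at `1` in direction `A`. -/
noncomputable def rho (q : Q.total) : G.E →L[ℝ] TangentSpace Q.total.I q :=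
  mfderiv G.I Q.total.I (fun g : G => S.act g⁻¹ q) 1

theorem act_inv_smooth : ContMDiff (Q.total.I.prod G.I) Q.total.I ∞
    (fun z : Q.total × G => S.act z.2⁻¹ z.1) :=
  S.act_smooth.comp (contMDiff_snd.inv.prodMk contMDiff_fst)

/-- The form `ι_{ρ(α)} f^*Θ`, as a horizontal equivariant form on the total space of `f^*Q`: at a point
`z = (x, q)` it sends `v` to `Θ(ρ_q(α(v̄)))`, where `v̄ ∈ T_x X` is the image of `v`. -/
noncomputable def contraction (α : OneForm X G.E) (f : X.Map M) :
    OneForm (Q.pullTotal f) K.E where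
  toFun z := (Q.conn (pullSnd z)).comp ((S.rho (pullSnd z)).comp ((α (pullFst z)).comp
    (mfderiv (Q.pullTotal f).I X.I pullFst z)))
  smooth := by
    have hπ : ContMDiff (Q.pullTotal f).I.tangent (Q.pullTotal f).I ∞
        (fun v : TangentBundle (Q.pullTotal f).I (Q.pullTotal f) => v.1) :=
      contMDiff_proj (TangentSpace (Q.pullTotal f).I)
    have h1 := (OneForm.pull α ⟨pullFst (P := Q.toPrincipalBundle) (φ := f), pullFst_smooth⟩).smooth
    have h2 := family_deriv Q.total G Q.total (fun q g => S.act g⁻¹ q) S.act_inv_smooth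
      _ (pullSnd_smooth.comp hπ) _ ((tangent_incl G 1).comp h1)
    refine (Q.conn.smooth.comp h2).congr fun v => ?_
    exact Q.conn_congr (by simp [S.one_act]) _

/-- The form `(1 - ι_{ρ(α)}) f^*Θ` on the total space of `f^*Q`. -/
noncomputable def twistForm (α : OneForm X G.E) (f : X.Map M) :
    OneForm (Q.pullTotal f) K.E where
  toFun z := (Q.conn.pull ⟨pullSnd (φ := f), pullSnd_smooth⟩) z - S.contraction α f z
  smooth := (Q.conn.pull ⟨pullSnd (φ := f), pullSnd_smooth⟩).smooth.sub
    (S.contraction α f).smooth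

theorem contraction_vertical (α : OneForm X G.E) (f : X.Map M) (z : Q.pullTotal f) (A : K.E) :
    S.contraction α f ((Q.pull f).act z 1) (der ((Q.pull f).act z) 1 A) = 0 := by
  have h := der_comp (f := fun k : K => (Q.pull f).act z k)
    (pullFst_smooth (P := Q.toPrincipalBundle) (φ := f))
    (((Q.pull f).act_smooth).comp (contMDiff_const.prodMk contMDiff_id)) 1 A
  have h0 : der (fun _ : K => pullFst z) 1 A = 0 := der_const _ _ _
  have h1 := h.symm.trans h0
  refine (congrArg (fun w => Q.conn (Q.act (pullSnd z) 1) (S.rho (Q.act (pullSnd z) 1)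
    (α (pullFst z) w))) h1).trans ?_
  have a1 : α (pullFst z) 0 = 0 := map_zero _
  have a2 : S.rho (Q.act (pullSnd z) 1) 0 = 0 := map_zero _
  have a3 : Q.conn (Q.act (pullSnd z) 1) 0 = 0 := map_zero _
  exact (congrArg (fun w => Q.conn (Q.act (pullSnd z) 1) (S.rho (Q.act (pullSnd z) 1) w))
    a1).trans ((congrArg (fun w => Q.conn (Q.act (pullSnd z) 1) w) a2).trans a3)

theorem rho_act (q : Q.total) (k : K) (A : G.E) :
    S.rho (Q.act q k) A = der (fun p => Q.act p k) q (S.rho q A) := by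
  have h := der_comp (f := fun g : G => S.act g⁻¹ q) (g := fun p => Q.act p k)
    (Q.act_smooth.comp (contMDiff_id.prodMk contMDiff_const))
    (S.act_inv_smooth.comp (contMDiff_const.prodMk contMDiff_id)) 1 A
  have e : S.act (1 : G)⁻¹ q = q := by rw [inv_one, S.one_act]
  rw [e] at h
  refine Eq.trans ?_ h
  change der (fun g : G => S.act g⁻¹ (Q.act q k)) 1 A = _
  congr 2
  funext g
  exact S.act_comm _ _ _

theorem contraction_equivariant (α : OneForm X G.E) (f : X.Map M) (z : Q.pullTotal f) (k : K)
    (v : (Q.pullTotal f).E) :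
    S.contraction α f ((Q.pull f).act z k) (der (fun w => (Q.pull f).act w k) z v) =
      Ad K k⁻¹ (S.contraction α f z v) := by
  have h := der_comp (f := fun w => (Q.pull f).act w k)
    (pullFst_smooth (P := Q.toPrincipalBundle) (φ := f))
    (((Q.pull f).act_smooth).comp (contMDiff_id.prodMk contMDiff_const)) z v
  refine Eq.trans ?_ (Q.conn_equivariant (pullSnd z) k
    (S.rho (pullSnd z) (α (pullFst z) (der pullFst z v))))
  refine (congrArg (fun w => Q.conn (Q.act (pullSnd z) k) (S.rho (Q.act (pullSnd z) k)
    (α (pullFst z) w))) h.symm).trans ?_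
  exact congrArg (fun w => Q.conn (Q.act (pullSnd z) k) w) (S.rho_act _ k _)

/-- The bundle with connection `(1 - ι_{ρ(α)}) f^*(Q, Θ)` on `X`: the bundle `f^*Q` with the connection
`(1 - ι_{ρ(α)}) f^*Θ`. -/
noncomputable def twist (α : OneForm X G.E) (f : X.Map M) : BunConn K X where
  toPrincipalBundle := Q.toPrincipalBundle.pull f
  conn := S.twistForm α f
  conn_vertical z A := by
    have h1 := (Q.pull f).conn_vertical z A
    have h2 := S.contraction_vertical α f z A
    exact (congrArg₂ (fun a b : K.E => a - b) h1 h2).trans (sub_zero A)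
  conn_equivariant z k v := by
    have h1 := (Q.pull f).conn_equivariant z k v
    have h2 := S.contraction_equivariant α f z k v
    exact (congrArg₂ (fun a b : K.E => a - b) h1 h2).trans (map_sub (Ad K k⁻¹) _ _).symm

end EquivStr

/-- A `K`-bundle with connection on `M//_∇ G`, that is, a morphism of prestacks from `M//_∇ G` to the
stack of principal `K`-bundles with connection: functors `Q_X` on the groupoids over every test
manifold `X`, and natural isomorphisms `Q_Y(φ^*a) ≅ φ^*(Q_X a)` for every smooth `φ : Y → X` that are
compatible with identities and composition. -/
structure BunConnOnQuot (G K M : Mfd.{u}) [Group G] [LieGroup G.I ∞ G] [MulAction G M]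
    [Group K] where
  functor (X : Mfd.{u}) : DiffAct G M X ⥤ BunConn K X
  base {X Y : Mfd.{u}} (φ : Y.Map X) (a : DiffAct G M X) :
    (functor Y).obj (a.pull φ) ≅ ((functor X).obj a).pull φ
  base_natural {X Y : Mfd.{u}} (φ : Y.Map X) {a b : DiffAct G M X} (f : a ⟶ b) :
    (functor Y).map (DiffAct.pullMap f φ) ≫ (base φ b).hom =
      (base φ a).hom ≫ BunConn.pullMap φ ((functor X).map f)
  base_id {X : Mfd.{u}} (a : DiffAct G M X) :
    (base ContMDiffMap.id a).hom ≫ ((functor X).obj a).pullId =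
      (functor X).map (DiffAct.ofEq a.pull_id)
  base_comp {X Y Z : Mfd.{u}} (φ : Y.Map X) (ψ : Z.Map Y) (a : DiffAct G M X) :
    (base (φ.comp ψ) a).hom ≫ ((functor X).obj a).pullComp φ ψ =
      (functor Z).map (DiffAct.ofEq (a.pull_comp φ ψ)) ≫ (base ψ (a.pull φ)).hom ≫
        BunConn.pullMap ψ (base φ a).hom

namespace BunConnOnQuot
variable {G K M : Mfd.{u}} [Group G] [LieGroup G.I ∞ G] [MulAction G M] [Group K]

/-- A morphism of `K`-bundles with connection on `M//_∇ G`, that is, a 2-morphism of prestacks. -/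
structure Hom (Q Q' : BunConnOnQuot G K M) where
  app (X : Mfd.{u}) : Q.functor X ⟶ Q'.functor X
  base_natural {X Y : Mfd.{u}} (φ : Y.Map X) (a : DiffAct G M X) :
    (app Y).app (a.pull φ) ≫ (Q'.base φ a).hom =
      (Q.base φ a).hom ≫ BunConn.pullMap φ ((app X).app a)

/-- The object `(0, id_M)` over `M`. -/
noncomputable def unit : DiffAct G M M := ⟨0, ContMDiffMap.id⟩

/-- The bundle with connection `(Q, Θ) = Q_∇(0, id_M)` on `M`. -/
noncomputable def value (Q : BunConnOnQuot G K M) : BunConn K M := (Q.functor M).obj unit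

variable [ContMDiffSMul G.I M.I ∞ G M]

/-- The action of `h ∈ G` on `M`, as a smooth map. -/
def smulMap (h : G) : M.Map M :=
  ⟨fun m => h • m, (contMDiff_smul (I := G.I) (I' := M.I) (n := ∞)).comp
    (contMDiff_const.prodMk contMDiff_id)⟩

/-- The morphism `(h, 0, id_M) : (0, id_M) ⟶ (0, h · id_M) = h^*(0, id_M)` for the constant map `h`. -/
noncomputable def unitHom (h : G) : (unit : DiffAct G M M) ⟶ unit.pull (smulMap h) where
  g := ContMDiffMap.const h
  form_eq := by
    have h1 : (ContMDiffMap.const h : M.Map G)⁻¹ = ContMDiffMap.const h⁻¹ := rfl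
    rw [h1]
    exact Eq.trans (OneForm.ext fun x v => rfl) (OneForm.zero_gauge_const (X := M) h⁻¹).symm
  map_eq x := rfl

/-- The action of `h ∈ G` on the total space of `(Q, Θ) = Q_∇(0, id_M)` that is induced by
`Q_∇(h, 0, id_M) : Q → Q_∇(0, h · id_M) ≅ h^*Q` and the projection `h^*Q → Q`. -/
noncomputable def translate (Q : BunConnOnQuot G K M) (h : G) (q : Q.value.total) : Q.value.total :=
  pullSnd ((Q.base (smulMap h) unit).hom.toFun (((Q.functor M).map (unitHom h)).toFun q))

end BunConnOnQuot

/-!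
Write `(Q, Θ) = Q_∇(0, id_M)`. There are no nonzero 1-forms on a point, so the restriction of an object
`(α, f)` to a point `x` is the pullback of `(0, id_M)` along `f(x)`. Base change therefore identifies
`Q_∇(α, f)_x` with `Q_{f(x)}`; together these identifications form a map `BunConnOnQuot.eval` from the
total space of `Q_∇(α, f)` to `Q`. Every algebraic property of this map (`K`-equivariance, bijectivity on
fibres, compatibility with base change, with the morphisms `(g, α, f)` and with morphisms
`Q_∇ → Q'_∇`) can be checked over points, where it follows from the coherence of `Q_∇`:
`eval_baseMap`, `eval_trans`, `eval_hom`. What is left is smoothness, and the formula for the connection.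

**Smoothness** (`eval_smooth`, `exists_smooth_lift`, `translate_smooth`). If `α = 0`, then `(α, f)` is the
pullback of `(0, id_M)` along `f`, and `eval` is smooth. For general `α`, consider the object `(tα, f)` over
`X × ℝ`. Its form vanishes along the lines `{x} × ℝ`, so moving along these lines while keeping the value
of `eval` is the same as moving along horizontal curves. The horizontal curves are the integral curves of
the horizontal lift of `∂_t`, a smooth vector field, and so form a smooth flow (`contMDiff_flow`). The flow
transports the bundle `Q_∇(α, f)` at `t = 1` smoothly to the bundle with the zero form at `t = 0`.

Smooth dependence of a flow on the initial value is proved with the implicit function theorem in the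
Banach space of continuous curves: the solutions of `γ(t) = x + s ∫₀ᵗ F(γ)` form a smooth family because
`γ ↦ F ∘ γ` is smooth (`contDiff_superpose`, `exists_smooth_family_of_solutions`).

**Connection** (`defect_eq_zero`). The difference between the connection of `Q_∇(α, f)` and the pullback
of `(1 - ι_{ρ(α)}) f^*Θ` is a horizontal form that is natural under base change, so it can be computed for
objects over `ℝ`, at `t = 0`. Such an object is a pullback of the universal object over `(𝔤 × M) × ℝ` with
form `A dt`. On the slice `t = 0` this form restricts to zero and there is no difference there; by linearity
the difference at `t = 0` only depends on the values of the form and the map at `t = 0`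
(`defect_congr`). Every pair of values is attained by a gauge transformation of `(0, const)`
(`exists_defect_eq_zero`), and for these the connection is known, as `Q_∇` is a functor.

Conversely a `G`-equivariant morphism `ψ : Q → Q'` commutes with the vector fields `ρ(A)`, hence
`(x, q) ↦ (x, ψ(q))` preserves the twisted connections (`EquivStr.twistMap`); conjugating with the
comparison isomorphisms extends it to a morphism `Q_∇ → Q'_∇`.
-/

/-! ### Families of solutions of an ordinary differential equation -/

section Nemytskii
set_option synthInstance.maxHeartbeats 200000
variable {T : Type*} [TopologicalSpace T] [CompactSpace T]
  {E E' : Type u} [NormedAddCommGroup E] [NormedSpace ℝ E] [NormedAddCommGroup E']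
  [NormedSpace ℝ E']

/-- The bounded bilinear map `C(T, W) × C(T, E) → C(T, E')` that applies a bounded bilinear map `B`
pointwise. -/
noncomputable def pointwiseCLM (T : Type*) [TopologicalSpace T] [CompactSpace T] {W : Type u}
    [NormedAddCommGroup W] [NormedSpace ℝ W] (B : W →L[ℝ] E →L[ℝ] E') :
    C(T, W) →L[ℝ] C(T, E) →L[ℝ] C(T, E') :=
  LinearMap.mkContinuous₂
    (LinearMap.mk₂ ℝ (fun (A : C(T, W)) (h : C(T, E)) =>
        (⟨fun t => B (A t) (h t), (B.continuous.comp A.continuous).clm_apply h.continuous⟩ : C(T, E')))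
      (fun _ _ _ => by ext; simp) (fun _ _ _ => by ext; simp) (fun _ _ _ => by ext; simp)
      (fun _ _ _ => by ext; simp)) ‖B‖ fun A h => by
    refine (ContinuousMap.norm_le _ (by positivity)).2 fun t => ?_
    refine (B.le_opNorm₂ (A t) (h t)).trans ?_
    gcongr
    exacts [A.norm_coe_le_norm t, h.norm_coe_le_norm t]

/-- The superposition operator `γ ↦ F ∘ γ`. -/
def superpose (T : Type*) [TopologicalSpace T] (F : E → E') (hF : Continuous F) :
    C(T, E) → C(T, E') := fun γ => (⟨F, hF⟩ : C(E, E')).comp γ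

theorem continuous_superpose (F : E → E') (hF : Continuous F) : Continuous (superpose T F hF) :=
  ContinuousMap.continuous_postcomp _

theorem hasFDerivAt_superpose (F : E → E') (hF : ContDiff ℝ 1 F) (γ : C(T, E)) :
    HasFDerivAt (superpose T F hF.continuous)
      (pointwiseCLM T (ContinuousLinearMap.id ℝ (E →L[ℝ] E'))
        (superpose T (fderiv ℝ F) (hF.continuous_fderiv (by simp)) γ)) γ := by
  have hD := hF.continuous_fderiv (by simp)
  rw [hasFDerivAt_iff_isLittleO, Asymptotics.isLittleO_iff]
  intro ε hε
  obtain ⟨δ, hδ, hc⟩ := Metric.continuous_iff.1 (continuous_superpose (T := T) _ hD) γ ε hε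
  filter_upwards [Metric.ball_mem_nhds γ hδ] with η hη
  refine (ContinuousMap.norm_le _ (by positivity)).2 fun t => ?_
  have key : ∀ y ∈ Metric.ball (γ t) δ, ‖fderiv ℝ F y - fderiv ℝ F (γ t)‖ ≤ ε := by
    intro y hy
    -- translating the whole curve by `y - γ t` moves it by less than `δ`
    have h1 : dist (γ + ContinuousMap.const T (y - γ t)) γ < δ := by
      rw [dist_eq_norm, add_sub_cancel_left]
      refine lt_of_le_of_lt ((ContinuousMap.norm_le _ (norm_nonneg (y - γ t))).2 fun s => le_rfl) ?_
      rwa [← dist_eq_norm]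
    have h2 := (ContinuousMap.dist_apply_le_dist (x := t)).trans (hc _ h1).le
    rw [dist_eq_norm] at h2
    simpa [superpose] using h2
  have hη' : η t ∈ Metric.ball (γ t) δ :=
    (ContinuousMap.dist_apply_le_dist t).trans_lt hη
  have hF' := (convex_ball (γ t) δ).norm_image_sub_le_of_norm_hasFDerivWithin_le' (f := F)
    (f' := fderiv ℝ F) (φ := fderiv ℝ F (γ t))
    (fun y _ => ((hF.differentiable (by simp)) y).hasFDerivAt.hasFDerivWithinAt) key
    (Metric.mem_ball_self hδ) hη'
  refine hF'.trans (mul_le_mul_of_nonneg_left ?_ hε.le)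
  exact (η - γ).norm_coe_le_norm t

theorem contDiff_nat_superpose (n : ℕ) : ∀ {E' : Type u} [NormedAddCommGroup E']
    [NormedSpace ℝ E'] (F : E → E') (hF : ContDiff ℝ ∞ F),
    ContDiff ℝ n (superpose T F hF.continuous) := by
  induction n with
  | zero => exact fun F hF => contDiff_zero.2 (continuous_superpose F hF.continuous)
  | succ n ih =>
    intro E' _ _ F hF
    have hF' : ContDiff ℝ ∞ (fderiv ℝ F) := hF.fderiv_right (by simp)
    refine contDiff_succ_iff_hasFDerivAt.2
      ⟨_, (pointwiseCLM T (ContinuousLinearMap.id ℝ (E →L[ℝ] E'))).contDiff.comp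
        (ih (fderiv ℝ F) hF'), fun γ => ?_⟩
    exact hasFDerivAt_superpose F (hF.of_le (by simp)) γ

theorem contDiff_superpose (F : E → E') (hF : ContDiff ℝ ∞ F) :
    ContDiff ℝ ∞ (superpose T F hF.continuous) :=
  contDiff_infty.2 fun n => contDiff_nat_superpose n F hF

end Nemytskii

section LocalFlow
open Set
variable {E : Type u} [NormedAddCommGroup E] [NormedSpace ℝ E]

/-- The compact time interval on which integral curves are parametrized; it contains `[0, 1]` in its
interior. -/
abbrev TimeIcc : Type := Icc (-1 : ℝ) 2

/-- The extension of a curve on the time interval to `ℝ`, constant outside. -/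
noncomputable def extendTime (γ : C(TimeIcc, E)) : ℝ → E :=
  fun τ => γ (projIcc (-1) 2 (by norm_num) τ)

theorem continuous_extendTime (γ : C(TimeIcc, E)) : Continuous (extendTime γ) :=
  γ.continuous.comp continuous_projIcc

/-- The integration operator `γ ↦ (t ↦ ∫₀ᵗ γ)`. -/
noncomputable def integrateCLM (E : Type u) [NormedAddCommGroup E] [NormedSpace ℝ E] :
    C(TimeIcc, E) →L[ℝ] C(TimeIcc, E) :=
  LinearMap.mkContinuous
    { toFun := fun γ => ⟨fun t => ∫ τ in (0 : ℝ)..t, extendTime γ τ,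
        (intervalIntegral.continuous_primitive
          (fun _ _ => (continuous_extendTime γ).intervalIntegrable _ _) 0).comp
          continuous_subtype_val⟩
      map_add' := fun γ η => by
        ext t
        exact intervalIntegral.integral_add ((continuous_extendTime γ).intervalIntegrable _ _)
          ((continuous_extendTime η).intervalIntegrable _ _)
      map_smul' := fun c γ => by
        ext t
        exact intervalIntegral.integral_smul c _ } 2 fun γ => by
    refine (ContinuousMap.norm_le _ (by positivity)).2 fun t => ?_
    have h := intervalIntegral.norm_integral_le_of_norm_le_const (a := 0) (b := (t : ℝ))
      (f := extendTime γ) (C := ‖γ‖) (fun τ _ => γ.norm_coe_le_norm _)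
    refine h.trans ?_
    rw [mul_comm]
    refine mul_le_mul_of_nonneg_right ?_ (norm_nonneg _)
    rw [sub_zero, abs_le]
    exact ⟨by linarith [t.2.1], t.2.2⟩

/-- The solutions of `γ(t) = x + s ∫₀ᵗ F(γ)` form a smooth family in `(s, x)`, by the implicit function
theorem in the Banach space of continuous curves. -/
theorem exists_smooth_family_of_solutions [CompleteSpace E] (F : E → E) (hF : ContDiff ℝ ∞ F)
    (x₀ : E) : ∃ Γ : ℝ × E → C(TimeIcc, E), ContDiffAt ℝ ∞ Γ (0, x₀) ∧
      Γ (0, x₀) = ContinuousMap.const _ x₀ ∧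
      ∀ᶠ z in 𝓝 ((0 : ℝ), x₀), ∀ t : TimeIcc,
        Γ z t = z.2 + z.1 • ∫ τ in (0 : ℝ)..t, F (extendTime (Γ z) τ) := by
  let cst : E →L[ℝ] C(TimeIcc, E) := ContinuousLinearMap.const ℝ TimeIcc
  let N := superpose TimeIcc F hF.continuous
  have hN : ContDiff ℝ ∞ N := contDiff_superpose F hF
  let J := integrateCLM E
  let G : (ℝ × E) × C(TimeIcc, E) → (ℝ × E) × C(TimeIcc, E) :=
    fun w => (w.1, w.2 - (cst w.1.2 + w.1.1 • J (N w.2)))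
  have hG : ContDiff ℝ ∞ G := by
    refine contDiff_fst.prodMk (contDiff_snd.sub ((cst.contDiff.comp
      (contDiff_snd.comp contDiff_fst)).add ((contDiff_fst.comp contDiff_fst).smul
        (J.contDiff.comp (hN.comp contDiff_snd)))))
  let c := J (N (cst x₀))
  let A : (ℝ × E) →L[ℝ] C(TimeIcc, E) :=
    -(cst.comp (ContinuousLinearMap.snd ℝ ℝ E) +
      (ContinuousLinearMap.fst ℝ ℝ E).smulRight c)
  let e : ((ℝ × E) × C(TimeIcc, E)) ≃L[ℝ] ((ℝ × E) × C(TimeIcc, E)) :=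
    (ContinuousLinearEquiv.refl ℝ _).skewProd (ContinuousLinearEquiv.refl ℝ _) A
  let w₀ : (ℝ × E) × C(TimeIcc, E) := ((0, x₀), cst x₀)
  have hw₀ : G w₀ = ((0, x₀), 0) := by simp [G, w₀]
  have hJN : DifferentiableAt ℝ (fun w : (ℝ × E) × C(TimeIcc, E) => J (N w.2)) w₀ :=
    ((J.contDiff.comp (hN.comp contDiff_snd)).differentiable (by simp)) w₀
  have hD : HasFDerivAt G (e : _ →L[ℝ] _) w₀ := by
    have h1 := (hasFDerivAt_fst (𝕜 := ℝ) (p := w₀))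
    have h2 := (hasFDerivAt_snd (𝕜 := ℝ) (p := w₀))
    have h11 : HasFDerivAt (fun w : (ℝ × E) × C(TimeIcc, E) => w.1.1) _ w₀ := h1.fst
    have h12 : HasFDerivAt (fun w : (ℝ × E) × C(TimeIcc, E) => w.1.2) _ w₀ := h1.snd
    have h3 := h1.prodMk (h2.sub (((cst.hasFDerivAt).comp w₀ h12).add (h11.smul hJN.hasFDerivAt)))
    refine h3.congr_fderiv ?_
    ext v
    all_goals simp [e, A, w₀, c, ContinuousLinearEquiv.skewProd_apply]
  have hGa := hG.contDiffAt (x := w₀)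
  have hn : (∞ : WithTop ℕ∞) ≠ 0 := by simp
  let inv := hGa.localInverse hD hn
  have hinv : ContDiffAt ℝ ∞ inv ((0, x₀), 0) := hw₀ ▸ hGa.to_localInverse hD hn
  have hι : ContDiffAt ℝ ∞ (fun z : ℝ × E => (z, (0 : C(TimeIcc, E)))) (0, x₀) :=
    contDiffAt_id.prodMk contDiffAt_const
  refine ⟨fun z => (inv (z, 0)).2, contDiffAt_snd.comp _ (ContDiffAt.comp (0, x₀) hinv hι), ?_, ?_⟩
  · have h0 : inv ((0, x₀), 0) = w₀ := by
      rw [← hw₀]; exact hGa.localInverse_apply_image hD hn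
    change (inv ((0, x₀), 0)).2 = _
    rw [h0]; rfl
  · have hr : ∀ᶠ y in 𝓝 (G w₀), G (inv y) = y :=
      (hGa.hasStrictFDerivAt' hD hn).eventually_right_inverse
    rw [hw₀] at hr
    have := hι.continuousAt.eventually hr
    filter_upwards [this] with z hz t
    have h1 : (inv (z, 0)).1 = z := congrArg Prod.fst hz
    have h2 : (inv (z, 0)).2 - (cst (inv (z, 0)).1.2 + (inv (z, 0)).1.1 • J (N (inv (z, 0)).2)) = 0 :=
      congrArg Prod.snd hz
    rw [h1, sub_eq_zero] at h2
    exact congrArg (fun γ : C(TimeIcc, E) => γ t) h2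

/-- The solutions of the integral equation solve the differential equation. -/
theorem hasDerivAt_of_solution [CompleteSpace E] {F : E → E} (hF : Continuous F) {s : ℝ} {x : E}
    {γ : C(TimeIcc, E)}
    (h : ∀ t : TimeIcc, γ t = x + s • ∫ τ in (0 : ℝ)..t, F (extendTime γ τ)) {t : ℝ}
    (ht : t ∈ Ioo (-1 : ℝ) 2) :
    HasDerivAt (extendTime γ) (s • F (extendTime γ t)) t := by
  have hc := hF.comp (continuous_extendTime γ)
  have h1 := ((hc.integral_hasStrictDerivAt 0 t).hasDerivAt.const_smul s).const_add x
  refine h1.congr_of_eventuallyEq ?_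
  filter_upwards [Ioo_mem_nhds ht.1 ht.2] with t' ht'
  have := h ⟨t', ht'.1.le, ht'.2.le⟩
  simp only [extendTime, projIcc_of_mem _ (Ioo_subset_Icc_self ht')]
  exact this

end LocalFlow

/-! ### Smoothness of flows on manifolds -/

section ManifoldFlow
open Set
variable {E : Type u} [NormedAddCommGroup E] [NormedSpace ℝ E]
  {H : Type*} [TopologicalSpace H] {I : ModelWithCorners ℝ E H}
  {P : Type*} [TopologicalSpace P] [ChartedSpace H P] [IsManifold I ∞ P]
  {V : ∀ p : P, TangentSpace I p} {Φ : ℝ → P → P}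

/-- A vector field read in the extended chart at `p₀`. -/
noncomputable def fieldInChart (I : ModelWithCorners ℝ E H) [IsManifold I 1 P]
    (V : ∀ p : P, TangentSpace I p) (p₀ : P) (x : E) : E :=
  tangentCoordChange I ((extChartAt I p₀).symm x) p₀ ((extChartAt I p₀).symm x)
    (V ((extChartAt I p₀).symm x))

theorem contDiffOn_fieldInChart
    (hV : ContMDiff I I.tangent ∞ (fun p => (⟨p, V p⟩ : TangentBundle I P)))
    (p₀ : P) : ContDiffOn ℝ ∞ (fieldInChart I V p₀) (extChartAt I p₀).target := by
  rw [← contMDiffOn_iff_contDiffOn]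
  have h1 := ((trivializationAt E (TangentSpace I) p₀).contMDiffOn_section_iff (s := V)
    (n := ∞) (IB := I) (a := (chartAt H p₀).source) (chartAt H p₀).open_source
    (by rw [TangentBundle.trivializationAt_baseSet])).1 hV.contMDiffOn
  refine (h1.comp (contMDiffOn_extChartAt_symm (n := ∞) p₀) fun x hx => ?_)
  have := (extChartAt I p₀).map_target hx
  rwa [extChartAt_source] at this

variable [I.Boundaryless]

theorem hasMFDerivAt_of_chart {p₀ : P} {f : ℝ → E} {t : ℝ} {c : ℝ}
    (h : HasDerivAt f (c • fieldInChart I V p₀ (f t)) t) (ht : f t ∈ (extChartAt I p₀).target) :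
    HasMFDerivAt 𝓘(ℝ, ℝ) I ((extChartAt I p₀).symm ∘ f) t
      ((1 : ℝ →L[ℝ] ℝ).smulRight (c • V ((extChartAt I p₀).symm (f t)))) := by
  have hn : (extChartAt I p₀).target ∈ 𝓝 (f t) := (isOpen_extChartAt_target p₀).mem_nhds ht
  set q := (extChartAt I p₀).symm (f t) with hq
  have hft1 : q ∈ (extChartAt I p₀).source := (extChartAt I p₀).map_target ht
  have hft2 := mem_extChartAt_source (I := I) q
  refine ⟨(continuousAt_extChartAt_symm'' ht).comp h.continuousAt, ?_⟩
  obtain ⟨v, hv⟩ : ∃ v : E, v = V q := ⟨_, rfl⟩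
  have hv' : tangentCoordChange I p₀ q q (fieldInChart I V p₀ (f t)) = v := by
    have h1 := tangentCoordChange_comp (I := I) (v := v) (x := p₀) ⟨⟨hft2, hft1⟩, hft2⟩
    rw [tangentCoordChange_self hft2] at h1
    refine Eq.trans ?_ h1
    rw [hv]
    rfl
  have e : c • v = tangentCoordChange I p₀ q q (c • fieldInChart I V p₀ (f t)) := by
    rw [map_smul, hv']
  have key : HasDerivAt ((extChartAt I q ∘ (extChartAt I p₀).symm) ∘ f) (c • v) t := by
    rw [e]
    apply HasFDerivAt.comp_hasDerivAt _ _ h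
    apply HasFDerivWithinAt.hasFDerivAt (s := range I) _
      (Filter.mem_of_superset hn (extChartAt_target_subset_range ..))
    rw [← (extChartAt I p₀).right_inv ht]
    exact hasFDerivWithinAt_tangentCoordChange ⟨hft1, hft2⟩
  have key' := key.hasFDerivAt.hasFDerivWithinAt (s := range 𝓘(ℝ, ℝ))
  rw [hv] at key'
  exact key'

variable [FiniteDimensional ℝ E] [T2Space P]

/-- A flow whose orbits are the integral curves of a smooth vector field is smooth for small times. -/
theorem contMDiffAt_flow_zero
    (hV : ContMDiff I I.tangent ∞ (fun p => (⟨p, V p⟩ : TangentBundle I P)))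
    (h0 : ∀ p, Φ 0 p = p) (hΦ : ∀ p, IsMIntegralCurve (fun s => Φ s p) V) (p₀ : P) :
    ContMDiffAt (𝓘(ℝ, ℝ).prod I) I ∞ (fun z : ℝ × P => Φ z.1 z.2) (0, p₀) := by
  have : CompleteSpace E := FiniteDimensional.complete ℝ E
  set φ := extChartAt I p₀ with hφ
  set x₀ := φ p₀ with hx₀
  have htn : φ.target ∈ 𝓝 x₀ := extChartAt_target_mem_nhds p₀
  have hto : IsOpen φ.target := isOpen_extChartAt_target p₀
  obtain ⟨r, hr, hball⟩ := Metric.nhds_basis_closedBall.mem_iff.1 htn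
  -- cut the vector field off outside a ball in the chart
  let b : ContDiffBump x₀ := ⟨r / 2, r, by positivity, by linarith⟩
  let F : E → E := fun x => b x • fieldInChart I V p₀ x
  have hF : ContDiff ℝ ∞ F := by
    refine contDiff_iff_contDiffAt.2 fun x => ?_
    by_cases hx : x ∈ φ.target
    · exact b.contDiffAt.smul ((contDiffOn_fieldInChart hV p₀).contDiffAt (hto.mem_nhds hx))
    · have hx' : x ∈ (Metric.closedBall x₀ r)ᶜ := fun h => hx (hball h)
      refine (contDiffAt_const (c := (0 : E))).congr_of_eventuallyEq ?_
      filter_upwards [Metric.isClosed_closedBall.isOpen_compl.mem_nhds hx'] with y hy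
      have : b y = 0 := b.zero_of_le_dist (not_le.1 (fun h => hy (Metric.mem_closedBall.2 h))).le
      simp [F, this]
  obtain ⟨Γ, hΓ, hΓ0, hsol⟩ := exists_smooth_family_of_solutions F hF x₀
  have hcoord : ContMDiffAt (𝓘(ℝ, ℝ).prod I) 𝓘(ℝ, ℝ × E) ∞
      (fun z : ℝ × P => (z.1, φ z.2)) (0, p₀) := by
    have h2 : ContMDiffAt (𝓘(ℝ, ℝ).prod I) 𝓘(ℝ, E) ∞ (fun z : ℝ × P => φ z.2) (0, p₀) :=
      ContMDiffAt.comp (0, p₀) (contMDiffAt_extChartAt (n := ∞) (x := p₀)) contMDiffAt_snd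
    exact (contMDiffAt_fst.prodMk_space h2)
  have hΓ' : ContMDiffAt (𝓘(ℝ, ℝ).prod I) 𝓘(ℝ, C(TimeIcc, E)) ∞
      (fun z : ℝ × P => Γ (z.1, φ z.2)) (0, p₀) :=
    ContMDiffAt.comp (0, p₀) (g := Γ) (f := fun z : ℝ × P => (z.1, φ z.2)) hΓ.contMDiffAt hcoord
  let one : TimeIcc := ⟨1, by norm_num⟩
  let zero : TimeIcc := ⟨0, by norm_num⟩
  have hone : ContDiff ℝ ∞ (fun γ : C(TimeIcc, E) => γ one) :=
    (ContinuousMap.evalCLM ℝ one : C(TimeIcc, E) →L[ℝ] E).contDiff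
  have hev : ContMDiffAt (𝓘(ℝ, ℝ).prod I) 𝓘(ℝ, E) ∞
      (fun z : ℝ × P => Γ (z.1, φ z.2) one) (0, p₀) :=
    ContMDiffAt.comp (0, p₀) (g := fun γ : C(TimeIcc, E) => γ one)
      hone.contMDiff.contMDiffAt hΓ'
  have hval : Γ (0, φ p₀) one = x₀ := congrArg (fun γ : C(TimeIcc, E) => γ one) hΓ0
  have hsymm : ContMDiffAt 𝓘(ℝ, E) I ∞ φ.symm (Γ (0, φ p₀) one) := by
    rw [hval]
    exact (contMDiffOn_extChartAt_symm (n := ∞) p₀).contMDiffAt htn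
  refine (ContMDiffAt.comp (0, p₀) (g := φ.symm) hsymm hev).congr_of_eventuallyEq ?_
  have hnear : ∀ᶠ z : ℝ × P in 𝓝 (0, p₀),
      Γ (z.1, φ z.2) ∈ Metric.ball (ContinuousMap.const _ x₀) (r / 2) := by
    refine hΓ'.continuousAt.eventually (Metric.isOpen_ball.mem_nhds ?_)
    change Γ (0, x₀) ∈ _
    rw [hΓ0]
    exact Metric.mem_ball_self (by positivity)
  have hsrc : ∀ᶠ z : ℝ × P in 𝓝 (0, p₀), z.2 ∈ φ.source :=
    continuousAt_snd.eventually (extChartAt_source_mem_nhds p₀)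
  filter_upwards [hcoord.continuousAt.eventually hsol, hnear, hsrc] with z hz hzb hzs
  have hin : ∀ t, extendTime (Γ (z.1, φ z.2)) t ∈ Metric.ball x₀ (r / 2) := fun t =>
    (ContinuousMap.dist_apply_le_dist (f := Γ (z.1, φ z.2)) (g := ContinuousMap.const _ x₀)
      _).trans_lt hzb
  have hint : IsMIntegralCurveOn (φ.symm ∘ extendTime (Γ (z.1, φ z.2))) (z.1 • V) (Ioo (-1) 2) := by
    intro t ht
    refine (hasMFDerivAt_of_chart ?_ (hball ?_)).hasMFDerivWithinAt
    · have := hasDerivAt_of_solution hF.continuous hz ht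
      have hb : b (extendTime (Γ (z.1, φ z.2)) t) = 1 :=
        b.one_of_mem_closedBall (Metric.ball_subset_closedBall (hin t))
      simpa only [F, hb, one_smul] using this
    · exact (Metric.ball_subset_closedBall.trans
        (Metric.closedBall_subset_closedBall (by linarith))) (hin t)
  have hint' := ((hΦ z.2).comp_mul z.1).isMIntegralCurveOn (Ioo (-1) 2)
  have hsm : ContMDiff I I.tangent 1 (fun p => (⟨p, (z.1 • V) p⟩ : TangentBundle I P)) :=
    ContMDiff.const_smul_section (hV.of_le (mod_cast le_top))
  have huniq := isMIntegralCurveOn_Ioo_eqOn_of_contMDiff_boundaryless (t₀ := 0) (by norm_num)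
    hsm hint hint' (by
      have e1 : extendTime (Γ (z.1, φ z.2)) 0 = φ z.2 := by
        have e2 := hz zero
        simp only [zero, intervalIntegral.integral_same, smul_zero, add_zero] at e2
        rw [extendTime, projIcc_of_mem _ zero.2]
        exact e2
      simp only [Function.comp_apply, e1, zero_mul, h0]
      exact φ.left_inv hzs)
  have h1 := huniq (show (1 : ℝ) ∈ Ioo (-1) 2 by norm_num)
  simp only [Function.comp_apply, one_mul] at h1
  rw [← h1, extendTime, projIcc_of_mem _ one.2]
  rfl

/-- An action of `ℝ` whose orbits are the integral curves of a smooth vector field is smooth. -/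
theorem contMDiff_flow
    (hV : ContMDiff I I.tangent ∞ (fun p => (⟨p, V p⟩ : TangentBundle I P)))
    (h0 : ∀ p, Φ 0 p = p) (hadd : ∀ s t p, Φ (s + t) p = Φ s (Φ t p))
    (hΦ : ∀ p, IsMIntegralCurve (fun s => Φ s p) V) :
    ContMDiff (𝓘(ℝ, ℝ).prod I) I ∞ (fun z : ℝ × P => Φ z.1 z.2) := by
  refine contMDiff_infty.2 fun n => ?_
  rintro ⟨s₀, p⟩
  have hM : IsManifold I n P := IsManifold.of_le (n := ∞) (mod_cast le_top)
  have hM' : IsManifold (𝓘(ℝ, ℝ).prod I) n (ℝ × P) := inferInstance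
  have hn : (n : WithTop ℕ∞) ≠ ∞ := by simp
  let T : Set ℝ := {s | ContMDiffAt (𝓘(ℝ, ℝ).prod I) I n (fun z : ℝ × P => Φ z.1 z.2) (s, p)}
  have hopen : IsOpen T := by
    rw [isOpen_iff_eventually]
    intro s hs
    have h1 := (contMDiffAt_iff_contMDiffAt_nhds hn).1 hs
    have h2 : ContinuousAt (fun s' : ℝ => (s', p)) s := by fun_prop
    exact h2.eventually h1
  have hclosed : IsClosed T := by
    rw [isClosed_iff_frequently]
    intro s hs
    have h1 := (contMDiffAt_iff_contMDiffAt_nhds hn).1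
      ((contMDiffAt_flow_zero hV h0 hΦ (Φ s p)).of_le
        (show (n : WithTop ℕ∞) ≤ ∞ from mod_cast le_top))
    have h2 : ContinuousAt (fun s' : ℝ => (s - s', Φ s' p)) s := by
      have := ((hΦ p) s).continuousAt
      fun_prop
    have h2' : Filter.Tendsto (fun s' : ℝ => (s - s', Φ s' p)) (𝓝 s) (𝓝 (0, Φ s p)) := by
      simpa only [ContinuousAt, sub_self] using h2
    obtain ⟨s', hs', hT⟩ := (hs.and_eventually (h2'.eventually h1)).exists
    -- flow first for the time `s'`, then for the short time that is left
    have e : (fun z : ℝ × P => Φ z.1 z.2) = fun z => Φ (z.1 - s') (Φ s' z.2) := by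
      funext z
      rw [← hadd, sub_add_cancel]
    have h3 : ContMDiffAt (𝓘(ℝ, ℝ).prod I) I n (fun z : ℝ × P => Φ s' z.2) (s, p) :=
      ContMDiffAt.comp (s, p) (g := fun z : ℝ × P => Φ z.1 z.2) (f := fun z : ℝ × P => (s', z.2)) hs'
        (contMDiffAt_const.prodMk contMDiffAt_snd)
    have h4 : ContMDiffAt (𝓘(ℝ, ℝ).prod I) 𝓘(ℝ, ℝ) n (fun z : ℝ × P => z.1 - s') (s, p) :=
      contMDiffAt_fst.sub contMDiffAt_const
    change ContMDiffAt _ _ _ _ _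
    rw [e]
    exact ContMDiffAt.comp (s, p) (g := fun z : ℝ × P => Φ z.1 z.2)
      (f := fun z : ℝ × P => (z.1 - s', Φ s' z.2)) hT (h4.prodMk h3)
  have hne : T.Nonempty := ⟨0, (contMDiffAt_flow_zero hV h0 hΦ p).of_le (mod_cast le_top)⟩
  have hT := IsClopen.eq_univ ⟨hclosed, hopen⟩ hne
  have hs₀ : s₀ ∈ T := hT ▸ mem_univ s₀
  exact hs₀

end ManifoldFlow

/-! ### Manifolds, derivatives and curves -/

namespace Mfd

/-- The product of two manifolds. -/
noncomputable abbrev prod (X Y : Mfd.{u}) : Mfd.{u} where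
  carrier := X × Y
  E := X.E × Y.E
  H := ModelProd X.H Y.H
  I := X.I.prod Y.I

/-- A finite-dimensional normed space as a manifold. -/
noncomputable abbrev ofSpace (V : Type u) [NormedAddCommGroup V] [NormedSpace ℝ V]
    [FiniteDimensional ℝ V] : Mfd.{u} where
  carrier := V
  E := V
  H := V
  I := 𝓘(ℝ, V)
  countable := by
    have := FiniteDimensional.proper ℝ V
    infer_instance

/-- The one-point manifold. -/
noncomputable abbrev point : Mfd.{u} := ofSpace PUnit.{u + 1}

/-- The real line, lifted to the universe `u`. -/
noncomputable abbrev line : Mfd.{u} := ofSpace (ULift.{u} ℝ)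

theorem contDiff_down : ContDiff ℝ ∞ (ULift.down : ULift.{u} ℝ → ℝ) :=
  (ContinuousLinearEquiv.ulift (R₁ := ℝ) (M₁ := ℝ)).contDiff

section Derivatives
variable {X Y Z : Mfd.{u}}

theorem der_comp_at {f : X → Y} {g : Y → Z} {x : X} (hg : MDifferentiableAt Y.I Z.I g (f x))
    (hf : MDifferentiableAt X.I Y.I f x) (v : X.E) :
    der (fun x => g (f x)) x v = der g (f x) (der f x v) :=
  mfderiv_comp_apply (I' := Y.I) x hg hf v

theorem der_congr {f g : X → Y} {x : X} (h : f =ᶠ[𝓝 x] g) (v : X.E) : der f x v = der g x v :=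
  congrArg (fun T : X.E →L[ℝ] Y.E => T v) h.mfderiv_eq

theorem der_prodMk {f : X → Y} {g : X → Z} {x : X} (hf : MDifferentiableAt X.I Y.I f x)
    (hg : MDifferentiableAt X.I Z.I g x) (v : X.E) :
    der (Y := prod Y Z) (fun x => (f x, g x)) x v = (der f x v, der g x v) :=
  congrArg (fun T : X.E →L[ℝ] Y.E × Z.E => T v) (mfderiv_prodMk hf hg)

theorem der_fst (z : prod X Y) (v : X.E × Y.E) : der (X := prod X Y) (Y := X) Prod.fst z v = v.1 :=
  congrArg (fun T : X.E × Y.E →L[ℝ] X.E => T v) (mfderiv_fst (x := z))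

theorem der_snd (z : prod X Y) (v : X.E × Y.E) : der (X := prod X Y) (Y := Y) Prod.snd z v = v.2 :=
  congrArg (fun T : X.E × Y.E →L[ℝ] Y.E => T v) (mfderiv_snd (x := z))

/-- The positive unit tangent vector of the line. -/
abbrev unitVec : line.{u}.E := ULift.up 1

theorem hasMFDerivAt_line {N : Mfd.{u}} (c : line.{u}.Map N) (t : ℝ) :
    HasMFDerivAt 𝓘(ℝ, ℝ) N.I (fun s : ℝ => c (ULift.up s)) t
      ((1 : ℝ →L[ℝ] ℝ).smulRight (der c (ULift.up t) unitVec : TangentSpace N.I (c (ULift.up t)))) := by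
  have h1 : HasMFDerivAt 𝓘(ℝ, ℝ) 𝓘(ℝ, ULift.{u} ℝ) (ULift.up : ℝ → ULift.{u} ℝ) t
      ((ContinuousLinearEquiv.ulift (R₁ := ℝ) (M₁ := ℝ)).symm : ℝ →L[ℝ] ULift.{u} ℝ) :=
    ((ContinuousLinearEquiv.ulift (R₁ := ℝ) (M₁ := ℝ)).symm.hasFDerivAt).hasMFDerivAt
  have h2 := (mdiff c.contMDiff (ULift.up t)).hasMFDerivAt
  refine (h2.comp t h1).congr_mfderiv ?_
  ext
  exact (one_smul ℝ (der c (ULift.up t) unitVec)).symm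

/-- Every tangent vector is the velocity of a smooth curve that is defined on the whole line. -/
theorem exists_curve (N : Mfd.{u}) (n : N) (v : N.E) :
    ∃ c : line.{u}.Map N, c 0 = n ∧ der c 0 unitVec = v := by
  set φ := extChartAt N.I n with hφ
  have htn : φ.target ∈ 𝓝 (φ n) := extChartAt_target_mem_nhds n
  have hto : IsOpen φ.target := isOpen_extChartAt_target n
  obtain ⟨r, hr, hball⟩ := Metric.nhds_basis_ball.mem_iff.1 htn
  let w : N.E := mfderiv N.I 𝓘(ℝ, N.E) φ n v
  -- the bound `δ ‖w‖ < r` keeps the curve inside the chart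
  let δ : ℝ := r / (‖w‖ + 1)
  have hw : 0 < ‖w‖ + 1 := by positivity
  have hδ : 0 < δ := by positivity
  let τ : line.{u} → ofSpace N.E := fun t => φ n + (δ * Real.sin (t.down / δ)) • w
  have hτ : ContDiff ℝ ∞ τ :=
    contDiff_const.add ((contDiff_const.mul (Real.contDiff_sin.comp
      (contDiff_down.div_const δ))).smul contDiff_const)
  have hmem : ∀ t, τ t ∈ φ.target := fun t => by
    refine hball (mem_ball_iff_norm.2 ?_)
    simp only [τ, add_sub_cancel_left, norm_smul, norm_mul, Real.norm_eq_abs, abs_of_pos hδ]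
    have h1 : |Real.sin (t.down / δ)| ≤ 1 := Real.abs_sin_le_one _
    have h2 : δ * (‖w‖ + 1) = r := div_mul_cancel₀ _ hw.ne'
    have h3 : δ * |Real.sin (t.down / δ)| * ‖w‖ ≤ δ * 1 * ‖w‖ := by gcongr
    nlinarith
  have hsymm := contMDiffOn_extChartAt_symm (I := N.I) (n := ∞) n
  have hc : ContMDiff line.{u}.I N.I ∞ (fun t => φ.symm (τ t)) := fun t =>
    ContMDiffAt.comp t (g := φ.symm) (hsymm.contMDiffAt (hto.mem_nhds (hmem t)))
      hτ.contMDiff.contMDiffAt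
  have hτ0 : τ 0 = φ n := by simp [τ]
  refine ⟨⟨_, hc⟩, ?_, ?_⟩
  · change φ.symm (τ 0) = n
    rw [hτ0]
    exact φ.left_inv (mem_extChartAt_source n)
  · have hd : der τ 0 unitVec = w := by
      have h1 : HasDerivAt (fun t : ℝ => δ * Real.sin (t / δ)) 1 0 := by
        have h := ((Real.hasDerivAt_sin (0 / δ)).comp (0 : ℝ)
          ((hasDerivAt_id (0 : ℝ)).div_const δ)).const_mul δ
        refine h.congr_deriv ?_
        simp [hδ.ne']
      have h2 : HasFDerivAt (ULift.down : ULift.{u} ℝ → ℝ) _ 0 :=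
        (ContinuousLinearEquiv.ulift (R₁ := ℝ) (M₁ := ℝ)).hasFDerivAt
      have h3 := ((h1.hasFDerivAt.comp (0 : ULift.{u} ℝ) h2).smul_const w).const_add (φ n)
      have h4 := h3.hasMFDerivAt.mfderiv
      refine (congrArg (fun T : ULift.{u} ℝ →L[ℝ] N.E => T unitVec) h4).trans ?_
      change ((1 : ℝ) • (1 : ℝ)) • w = w
      simp
    have hs : MDifferentiableAt 𝓘(ℝ, N.E) N.I φ.symm (τ 0) := by
      rw [hτ0]
      exact (hsymm.contMDiffAt htn).mdifferentiableAt (by simp)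
    have h1 := der_comp_at (X := line.{u}) (Y := ofSpace N.E) (Z := N) (g := φ.symm) (f := τ) (x := 0)
      hs (hτ.contMDiff.mdifferentiableAt (by simp)) unitVec
    refine h1.trans ?_
    rw [hd, hτ0]
    have h2 : MDifferentiableAt N.I 𝓘(ℝ, N.E) φ n :=
      (contMDiffAt_extChartAt (n := ∞)).mdifferentiableAt (by simp)
    have h3 := der_comp_at (X := N) (Y := ofSpace N.E) (Z := N) (g := φ.symm) (f := φ) (x := n)
      (hτ0 ▸ hs) h2 v
    refine h3.symm.trans ((der_congr ?_ v).trans (der_id n v))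
    filter_upwards [extChartAt_source_mem_nhds (I := N.I) n] with y hy using φ.left_inv hy

end Derivatives

end Mfd

/-- The value of a 1-form at a point, as a linear map on the model space, to which the tangent space is
definitionally equal. -/
def OneForm.val {X : Mfd.{u}} {F : Type u} [NormedAddCommGroup F] [NormedSpace ℝ F]
    (α : OneForm X F) (x : X) : X.E →L[ℝ] F := α x

/-! ### Tangent vectors of principal bundles -/

namespace PrincipalBundle
variable {K Y : Mfd.{u}} [Group K] (P : PrincipalBundle K Y)

theorem mdifferentiableAt_triv {e : Trivialization K P.proj} (he : P.IsTriv e) {p : P.total}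
    (hp : p ∈ e.source) : MDifferentiableAt P.total.I (prod Y K).I e p ∧
      MDifferentiableAt (prod Y K).I P.total.I e.toOpenPartialHomeomorph.symm (e p) :=
  ⟨(he.smooth.contMDiffAt (e.open_source.mem_nhds hp)).mdifferentiableAt (by simp),
    (he.smooth_symm.contMDiffAt (e.open_target.mem_nhds
      (e.toOpenPartialHomeomorph.map_source hp))).mdifferentiableAt (by simp)⟩

theorem smooth_act_left (p : P.total) : ContMDiff K.I P.total.I ∞ (P.act p) :=
  P.act_smooth.comp (contMDiff_const.prodMk contMDiff_id)

/-- In a trivialization, the derivative of the projection is the first component. -/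
theorem der_triv {e : Trivialization K P.proj} (he : P.IsTriv e) {p : P.total}
    (hp : p ∈ e.source) (w : P.total.E) :
    der (Y := prod Y K) e p w = (der P.proj p w, (der (Y := prod Y K) e p w).2) := by
  refine Prod.ext ?_ rfl
  have h1 := der_comp_at (Y := prod Y K) (Z := Y) (g := Prod.fst) (f := e) (x := p)
    mdifferentiableAt_fst (P.mdifferentiableAt_triv he hp).1 w
  rw [der_fst] at h1
  rw [← h1]
  refine der_congr ?_ w
  filter_upwards [e.open_source.mem_nhds hp] with q hq using e.coe_fst hq

theorem der_symm_triv {e : Trivialization K P.proj} (he : P.IsTriv e) {p : P.total}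
    (hp : p ∈ e.source) (w : P.total.E) :
    der (X := prod Y K) e.toOpenPartialHomeomorph.symm (e p) (der (Y := prod Y K) e p w) = w := by
  obtain ⟨h1, h2⟩ := P.mdifferentiableAt_triv he hp
  rw [← der_comp_at (Y := prod Y K) h2 h1]
  refine (der_congr ?_ w).trans (der_id p w)
  filter_upwards [e.open_source.mem_nhds hp] with q hq using e.left_inv hq

theorem der_proj_symm {e : Trivialization K P.proj} (he : P.IsTriv e) {p : P.total}
    (hp : p ∈ e.source) (v : Y.E × K.E) :
    der P.proj p (der (X := prod Y K) e.toOpenPartialHomeomorph.symm (e p) v) = v.1 := by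
  obtain ⟨h1, h2⟩ := P.mdifferentiableAt_triv he hp
  have hl : e.toOpenPartialHomeomorph.symm (e p) = p := e.left_inv hp
  have h3 := der_comp_at (X := prod Y K) (Z := Y) (g := P.proj) (x := e p)
    (mdiff P.proj_smooth _) h2 v
  rw [hl] at h3
  rw [← h3, ← der_fst (X := Y) (Y := K) (e p) v]
  refine der_congr (X := prod Y K) ?_ v
  filter_upwards [e.open_target.mem_nhds (e.toOpenPartialHomeomorph.map_source hp)] with q hq
    using e.proj_symm_apply hq

theorem exists_der_proj (p : P.total) (v : Y.E) : ∃ w : P.total.E, der P.proj p w = v := by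
  obtain ⟨e, hp, he⟩ := P.exists_triv (P.proj p)
  exact ⟨_, P.der_proj_symm he (e.mem_source.2 hp) (v, 0)⟩

variable [LieGroup K.I ∞ K]

/-- A vector is vertical only if it is tangent to the orbit of `K`. -/
theorem exists_der_act (p : P.total) (w : P.total.E) (hw : der P.proj p w = 0) :
    ∃ A : K.E, der (P.act p) 1 A = w := by
  obtain ⟨e, hp, he⟩ := P.exists_triv (P.proj p)
  have hp := e.mem_source.2 hp
  set k := (e p).2 with hk
  have hl : ∀ g : K, ContMDiff K.I K.I ∞ (fun h : K => g * h) :=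
    fun g => contMDiff_const.mul contMDiff_id
  set B := (der (Y := prod Y K) e p w).2 with hB
  let A : K.E := der (fun h : K => k⁻¹ * h) k B
  have hA : der (fun h : K => k * h) 1 A = B := by
    have h1 := der_comp (hl k) (hl k⁻¹) k B
    simp only [inv_mul_cancel, mul_inv_cancel_left] at h1
    exact h1.symm.trans (der_id k B)
  refine ⟨A, ?_⟩
  -- the orbit map is `k' ↦ e⁻¹ (y, k k')` in the trivialization
  have hact : P.act p = fun k' : K => e.toOpenPartialHomeomorph.symm ((e p).1, k * k') := by
    funext k'
    rw [← he.equivariant p hp k']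
    exact (e.left_inv (e.mem_source.2 (by rw [P.proj_act]; exact e.mem_source.1 hp))).symm
  have hpair : ∀ k' : K, MDifferentiableAt K.I (prod Y K).I (fun k' : K => ((e p).1, k * k')) k' :=
    fun k' => (contMDiff_const.prodMk (hl k)).mdifferentiableAt (by simp)
  have hpt : ((e p).1, k * 1) = e p := by rw [mul_one]
  rw [hact]
  have h2 := der_comp_at (Y := prod Y K) (Z := P.total) (g := e.toOpenPartialHomeomorph.symm)
    (f := fun k' : K => ((e p).1, k * k')) (x := 1) (by
      rw [hpt]
      exact (P.mdifferentiableAt_triv he hp).2)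
    (hpair 1) A
  rw [h2, hpt]
  have h3 := der_prodMk (X := K) (Y := Y) (Z := K) (f := fun _ => (e p).1) (g := fun k' => k * k')
    (x := 1) mdifferentiableAt_const (mdiff (hl k) 1) A
  rw [h3, der_const, hA, ← hw, hB, ← P.der_triv he hp w]
  exact P.der_symm_triv he hp w

end PrincipalBundle

namespace BunConn
variable {K Y : Mfd.{u}} [Group K] [LieGroup K.I ∞ K] (P : BunConn K Y)

/-- A vertical vector is the value of the fundamental vector field of its image under the
connection. -/
theorem vertical_eq (p : P.total) (w : P.total.E) (hw : der P.proj p w = 0) :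
    w = der (P.act p) 1 (P.conn.val p w) := by
  obtain ⟨A, rfl⟩ := P.exists_der_act p w hw
  have h : P.conn.val p (der (P.act p) 1 A) = A :=
    (P.conn_congr (P.act_one p) (der (P.act p) 1 A)).symm.trans (P.conn_vertical p A)
  rw [h]

theorem horizontal_unique (p : P.total) {w w' : P.total.E} (hw : der P.proj p w = der P.proj p w')
    (hc : P.conn.val p w = P.conn.val p w') : w = w' := by
  have h0 : der P.proj p (w - w') = 0 := by rw [map_sub, hw, sub_self]
  have h1 := P.vertical_eq p (w - w') h0
  have h2 : P.conn.val p (w - w') = 0 := by rw [map_sub, hc, sub_self]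
  rw [h2, map_zero] at h1
  exact sub_eq_zero.1 h1

/-- The horizontal lift of a smooth vector field is smooth. -/
theorem smooth_horizontal_lift (W : Y → Y.E)
    (hW : ContMDiff Y.I Y.I.tangent ∞ (fun y => (⟨y, W y⟩ : TangentBundle Y.I Y)))
    (V : P.total → P.total.E) (hV : ∀ p, der P.proj p (V p) = W (P.proj p))
    (hc : ∀ p, P.conn.val p (V p) = 0) :
    ContMDiff P.total.I P.total.I.tangent ∞
      (fun p => (⟨p, V p⟩ : TangentBundle P.total.I P.total)) := by
  intro p₀
  obtain ⟨e, hp₀, he⟩ := P.exists_triv (P.proj p₀)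
  have hp₀ := e.mem_source.2 hp₀
  -- the lift `V₀` that is constant in the trivialization
  let V₀ : ∀ p : P.total, TangentSpace P.total.I p := fun p =>
    der (X := prod Y K) e.toOpenPartialHomeomorph.symm (e p) (W (P.proj p), 0)
  have hV₀ : ContMDiffAt P.total.I P.total.I.tangent ∞
      (fun p => (⟨p, V₀ p⟩ : TangentBundle P.total.I P.total)) p₀ := by
    have h1 : ContMDiffAt P.total.I K.I ∞ (fun p => (e p).2) p₀ :=
      contMDiff_snd.contMDiffAt.comp p₀ (he.smooth.contMDiffAt (e.open_source.mem_nhds hp₀))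
    have h2 : ContMDiffAt P.total.I K.I.tangent ∞
        (fun p => (⟨(e p).2, 0⟩ : TangentBundle K.I K)) p₀ :=
      (contMDiff_zeroSection ℝ (TangentSpace K.I)).contMDiffAt.comp p₀ h1
    have h3 : ContMDiffAt P.total.I Y.I.tangent ∞
        (fun p => (⟨P.proj p, W (P.proj p)⟩ : TangentBundle Y.I Y)) p₀ :=
      (hW.comp P.proj_smooth).contMDiffAt
    have h4 : ContMDiffAt P.total.I (Y.I.prod K.I).tangent ∞
        (fun p => (equivTangentBundleProd Y.I Y K.I K).symm
          (⟨P.proj p, W (P.proj p)⟩, ⟨(e p).2, 0⟩)) p₀ :=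
      contMDiff_equivTangentBundleProd_symm.contMDiffAt.comp p₀ (h3.prodMk h2)
    have ht : e.target ∈ 𝓝 (P.proj p₀, (e p₀).2) := by
      rw [← e.coe_fst hp₀]
      exact e.open_target.mem_nhds (e.toOpenPartialHomeomorph.map_source hp₀)
    have h5 := he.smooth_symm.contMDiffOn_tangentMapWithin (m := ∞) (by simp)
      e.open_target.uniqueMDiffOn
    have h6 := h5.contMDiffAt (x := (equivTangentBundleProd Y.I Y K.I K).symm
          (⟨P.proj p₀, W (P.proj p₀)⟩, ⟨(e p₀).2, 0⟩))
      ((FiberBundle.continuous_proj (Y.E × K.E)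
        (TangentSpace (Y.I.prod K.I))).continuousAt.preimage_mem_nhds ht)
    refine (ContMDiffAt.comp p₀ h6 h4).congr_of_eventuallyEq ?_
    filter_upwards [e.open_source.mem_nhds hp₀] with p hp
    have hpe : (P.proj p, (e p).2) = e p := Prod.ext (e.coe_fst hp).symm rfl
    have hmem : (P.proj p, (e p).2) ∈ e.target := by
      rw [hpe]; exact e.toOpenPartialHomeomorph.map_source hp
    have h7 : tangentMapWithin (Y.I.prod K.I) P.total.I e.toOpenPartialHomeomorph.symm e.target
        ((equivTangentBundleProd Y.I Y K.I K).symm (⟨P.proj p, W (P.proj p)⟩, ⟨(e p).2, 0⟩)) =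
        (⟨e.toOpenPartialHomeomorph.symm (P.proj p, (e p).2),
          der (X := prod Y K) e.toOpenPartialHomeomorph.symm (P.proj p, (e p).2) (W (P.proj p), 0)⟩ :
          TangentBundle P.total.I P.total) :=
      congrArg (fun T : Y.E × K.E →L[ℝ] P.total.E =>
        (⟨e.toOpenPartialHomeomorph.symm (P.proj p, (e p).2), T (W (P.proj p), 0)⟩ :
          TangentBundle P.total.I P.total)) (mfderivWithin_of_isOpen e.open_target hmem)
    refine Eq.trans ?_ h7.symm
    rw [hpe]
    exact congrArg (fun q => (⟨q, V₀ p⟩ : TangentBundle P.total.I P.total)) (e.left_inv hp).symm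
  let U : ∀ p : P.total, TangentSpace P.total.I p := fun p =>
    der (P.act p) 1 (P.conn.val p (V₀ p))
  have hU : ContMDiffAt P.total.I P.total.I.tangent ∞
      (fun p => (⟨p, U p⟩ : TangentBundle P.total.I P.total)) p₀ := by
    have h1 : ContMDiffAt P.total.I 𝓘(ℝ, K.E) ∞ (fun p => (P.conn.val p (V₀ p) : K.E)) p₀ :=
      P.conn.smooth.contMDiffAt.comp p₀ hV₀
    -- the fundamental vector fields depend smoothly on the point and the generator
    have h2 : ContMDiff (P.total.I.prod 𝓘(ℝ, K.E)) P.total.I.tangent ∞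
        (fun z : P.total × K.E => (⟨P.act z.1 1, mfderiv K.I P.total.I (P.act z.1) 1 z.2⟩ :
          TangentBundle P.total.I P.total)) :=
      family_deriv P.total K P.total P.act P.act_smooth _ contMDiff_fst _
        ((tangent_incl K 1).comp contMDiff_snd)
    refine (ContMDiffAt.comp p₀ (g := fun z : P.total × K.E =>
      (⟨P.act z.1 1, mfderiv K.I P.total.I (P.act z.1) 1 z.2⟩ : TangentBundle P.total.I P.total))
      (f := fun p => (p, P.conn.val p (V₀ p))) h2.contMDiffAt
      (contMDiffAt_id.prodMk h1)).congr_of_eventuallyEq (Filter.Eventually.of_forall fun p => ?_)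
    exact congrArg (fun q => (⟨q, U p⟩ : TangentBundle P.total.I P.total)) (P.act_one p).symm
  refine (hV₀.sub_section hU).congr_of_eventuallyEq ?_
  filter_upwards [e.open_source.mem_nhds hp₀] with p hp
  have h8 : V p = V₀ p - U p := by
    let w : P.total.E := V₀ p
    let w' : P.total.E := U p
    change V p = w - w'
    have hp1 : der P.proj p (V p - w) = 0 := by
      rw [map_sub, hV, P.der_proj_symm he hp, sub_self]
    have h9 := P.vertical_eq p _ hp1
    have h10 : P.conn.val p (V p - w) = - P.conn.val p w := by
      rw [map_sub, hc, zero_sub]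
    rw [h10, map_neg] at h9
    change V p - w = - w' at h9
    rw [← sub_add_cancel (V p) w, h9]
    abel
  exact congrArg (fun v : P.total.E => (⟨p, v⟩ : TangentBundle P.total.I P.total)) h8

end BunConn

/-! ### The comparison map and the group action, pointwise -/

namespace BunConn
variable {K X : Mfd.{u}} [Group K]

theorem iso_hom_inv {P R : BunConn K X} (f : P ≅ R) (p : P.total) :
    f.inv.toFun (f.hom.toFun p) = p :=
  congrArg (fun g : P ⟶ P => g.toFun p) f.hom_inv_id

theorem iso_inv_hom {P R : BunConn K X} (f : P ≅ R) (r : R.total) :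
    f.hom.toFun (f.inv.toFun r) = r :=
  congrArg (fun g : R ⟶ R => g.toFun r) f.inv_hom_id

theorem hom_conn {P R : BunConn K X} (f : P ⟶ R) (p : P.total) (w : P.total.E) :
    R.conn.val (f.toFun p) (der f.toFun p w) = P.conn.val p w :=
  f.conn_eq p w

end BunConn

namespace DiffAct
variable {G M X Y : Mfd.{u}}

theorem ext' {a b : DiffAct G M X} (h1 : a.form = b.form) (h2 : a.map = b.map) : a = b := by
  cases a; cases b; cases h1; cases h2; rfl

/-- There are no nonzero 1-forms on a point. -/
theorem ext_point {a b : DiffAct G M point.{u}} (h : a.map = b.map) : a = b := by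
  refine ext' (OneForm.ext fun x (v : PUnit) => ?_) h
  have hv : v = (0 : point.{u}.E) := rfl
  rw [hv]
  exact (map_zero (a.form.val x)).trans (map_zero (b.form.val x)).symm

theorem pull_const_eq (a : DiffAct G M X) (x : X) :
    a.pull (ContMDiffMap.const x : point.{u}.Map X) =
      (BunConnOnQuot.unit : DiffAct G M M).pull (ContMDiffMap.const (a.map x)) :=
  ext_point rfl

theorem pull_point_eq (a : DiffAct G M X) (c : point.{u}.Map X) :
    a.pull c = (BunConnOnQuot.unit : DiffAct G M M).pull (a.map.comp c) := ext_point rfl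

end DiffAct

namespace BunConnOnQuot
variable {G K M : Mfd.{u}} [Group G] [LieGroup G.I ∞ G] [MulAction G M] [Group K]
  (Q : BunConnOnQuot G K M) {X Y Z : Mfd.{u}}

/-- The bundle with connection `Q_∇(a)`. -/
noncomputable abbrev bun (a : DiffAct G M X) : BunConn K X := (Q.functor X).obj a

/-- The map on total spaces that is the value of `Q_∇` on a morphism. -/
noncomputable def trans {a b : DiffAct G M X} (f : a ⟶ b) : (Q.bun a).total → (Q.bun b).total :=
  ((Q.functor X).map f).toFun

/-- The map of total spaces `Q_∇(φ^*a) ≅ φ^*Q_∇(a) → Q_∇(a)` covering `φ`. -/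
noncomputable def baseMap (φ : Y.Map X) (a : DiffAct G M X) (p : (Q.bun (a.pull φ)).total) :
    (Q.bun a).total := pullSnd ((Q.base φ a).hom.toFun p)

/-- The point of `Q_∇(φ^*a)` over `y` that `baseMap` sends to `p`. -/
noncomputable def baseLift (φ : Y.Map X) (a : DiffAct G M X) (y : Y) (p : (Q.bun a).total)
    (h : φ y = (Q.bun a).proj p) : (Q.bun (a.pull φ)).total := (Q.base φ a).inv.toFun (pullMk y p h)

section trans
variable {a b c : DiffAct G M X}

theorem trans_smooth (f : a ⟶ b) :
    ContMDiff (Q.bun a).total.I (Q.bun b).total.I ∞ (Q.trans f) := ((Q.functor X).map f).smooth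

theorem proj_trans (f : a ⟶ b) (p) : (Q.bun b).proj (Q.trans f p) = (Q.bun a).proj p :=
  ((Q.functor X).map f).proj_eq p

theorem trans_act (f : a ⟶ b) (p k) :
    Q.trans f ((Q.bun a).act p k) = (Q.bun b).act (Q.trans f p) k :=
  ((Q.functor X).map f).equivariant p k

theorem conn_trans (f : a ⟶ b) (p) (w : (Q.bun a).total.E) :
    (Q.bun b).conn.val (Q.trans f p) (der (Q.trans f) p w) = (Q.bun a).conn.val p w :=
  ((Q.functor X).map f).conn_eq p w

theorem trans_comp (f : a ⟶ b) (g : b ⟶ c) (p) : Q.trans (f ≫ g) p = Q.trans g (Q.trans f p) :=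
  congrArg (fun t : Q.bun a ⟶ Q.bun c => t.toFun p) ((Q.functor X).map_comp f g)

theorem trans_id (p) : Q.trans (𝟙 a) p = p :=
  congrArg (fun t : Q.bun a ⟶ Q.bun a => t.toFun p) ((Q.functor X).map_id a)

theorem trans_ofEq_rfl (p) : Q.trans (DiffAct.ofEq (rfl : a = a)) p = p :=
  Q.trans_id p

theorem trans_ofEq_trans (h : a = b) (h' : b = c) (p) :
    Q.trans (DiffAct.ofEq h') (Q.trans (DiffAct.ofEq h) p) = Q.trans (DiffAct.ofEq (h.trans h')) p := by
  subst h h'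
  simp only [trans_ofEq_rfl]

end trans

section base
variable (φ : Y.Map X) (a : DiffAct G M X)

theorem baseMap_smooth :
    ContMDiff (Q.bun (a.pull φ)).total.I (Q.bun a).total.I ∞ (Q.baseMap φ a) :=
  pullSnd_smooth.comp (Q.base φ a).hom.smooth

theorem proj_baseMap (p) : (Q.bun a).proj (Q.baseMap φ a p) = φ ((Q.bun (a.pull φ)).proj p) :=
  (pull_eq _).symm.trans (congrArg φ ((Q.base φ a).hom.proj_eq p))

theorem baseMap_act (p k) :
    Q.baseMap φ a ((Q.bun (a.pull φ)).act p k) = (Q.bun a).act (Q.baseMap φ a p) k :=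
  congrArg pullSnd ((Q.base φ a).hom.equivariant p k)

theorem conn_baseMap (p) (w : (Q.bun (a.pull φ)).total.E) :
    (Q.bun a).conn.val (Q.baseMap φ a p) (der (Q.baseMap φ a) p w) =
      (Q.bun (a.pull φ)).conn.val p w := by
  have h1 := (Q.base φ a).hom.conn_eq p w
  have h2 := der_comp (pullSnd_smooth (P := (Q.bun a).toPrincipalBundle) (φ := φ))
    (Q.base φ a).hom.smooth p w
  exact (congrArg ((Q.bun a).conn.val (Q.baseMap φ a p)) h2).trans h1

theorem baseMap_baseLift (y p h) : Q.baseMap φ a (Q.baseLift φ a y p h) = p :=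
  congrArg pullSnd (BunConn.iso_inv_hom (Q.base φ a) (pullMk y p h))

theorem proj_baseLift (y p h) : (Q.bun (a.pull φ)).proj (Q.baseLift φ a y p h) = y :=
  (Q.base φ a).inv.proj_eq (pullMk y p h)

theorem baseMap_injective {p p'} (h : (Q.bun (a.pull φ)).proj p = (Q.bun (a.pull φ)).proj p')
    (h' : Q.baseMap φ a p = Q.baseMap φ a p') : p = p' := by
  have h1 : (Q.base φ a).hom.toFun p = (Q.base φ a).hom.toFun p' :=
    pull_ext (((Q.base φ a).hom.proj_eq p).trans (h.trans ((Q.base φ a).hom.proj_eq p').symm)) h'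
  rw [← BunConn.iso_hom_inv (Q.base φ a) p, h1, BunConn.iso_hom_inv]

theorem baseLift_smooth {N : Mfd.{u}} {y : N → Y} {p : N → (Q.bun a).total}
    (hy : ContMDiff N.I Y.I ∞ y) (hp : ContMDiff N.I (Q.bun a).total.I ∞ p)
    (h : ∀ n, φ (y n) = (Q.bun a).proj (p n)) :
    ContMDiff N.I (Q.bun (a.pull φ)).total.I ∞ (fun n => Q.baseLift φ a (y n) (p n) (h n)) :=
  (Q.base φ a).inv.smooth.comp (pullMk_smooth hy hp h)

theorem baseMap_trans {b : DiffAct G M X} (f : a ⟶ b) (p) :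
    Q.baseMap φ b (Q.trans (DiffAct.pullMap f φ) p) = Q.trans f (Q.baseMap φ a p) :=
  congrArg (fun t : Q.bun (a.pull φ) ⟶ (Q.bun b).pull φ => pullSnd (t.toFun p)) (Q.base_natural φ f)

theorem baseMap_comp (ψ : Z.Map Y) (p) :
    Q.baseMap (φ.comp ψ) a p =
      Q.baseMap φ a (Q.baseMap ψ (a.pull φ) (Q.trans (DiffAct.ofEq (a.pull_comp φ ψ)) p)) :=
  congrArg (fun t : Q.bun (a.pull (φ.comp ψ)) ⟶ ((Q.bun a).pull φ).pull ψ =>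
    pullSnd (pullSnd (t.toFun p))) (Q.base_comp φ ψ a)

end base

section eval
variable (a : DiffAct G M X)

/-- The comparison map from the total space of `Q_∇(α, f)` to `Q = Q_∇(0, id_M)`. Over a point `x`, it is
the composite `Q_∇(α, f)_x ≅ Q_∇(x^*(α, f)) = Q_∇(f(x)^*(0, id_M)) ≅ Q_{f(x)}`, as there are no nonzero
1-forms on the point. -/
noncomputable def eval (p : (Q.bun a).total) : Q.value.total :=
  Q.baseMap (ContMDiffMap.const (a.map ((Q.bun a).proj p))) unit
    (Q.trans (DiffAct.ofEq (DiffAct.pull_const_eq a ((Q.bun a).proj p)))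
      (Q.baseLift (ContMDiffMap.const ((Q.bun a).proj p)) a PUnit.unit p rfl))

theorem eval_baseMap_point (c : point.{u}.Map X) (m : point.{u}.Map M)
    (h : a.pull c = (unit : DiffAct G M M).pull m) (p) :
    Q.eval a (Q.baseMap c a p) = Q.baseMap m unit (Q.trans (DiffAct.ofEq h) p) := by
  obtain ⟨x, rfl⟩ : ∃ x, c = ContMDiffMap.const x := ⟨c PUnit.unit, rfl⟩
  have hx : (Q.bun a).proj (Q.baseMap (ContMDiffMap.const x) a p) = x := Q.proj_baseMap _ _ _
  obtain rfl : m = ContMDiffMap.const (a.map x) := (congrArg DiffAct.map h).symm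
  have key : ∀ (x' : X) (q : (Q.bun a).total) (hq : x' = (Q.bun a).proj q) (hx' : x' = x)
      (_ : q = Q.baseMap (ContMDiffMap.const x) a p),
      Q.baseMap (ContMDiffMap.const (a.map x')) unit
        (Q.trans (DiffAct.ofEq (DiffAct.pull_const_eq a x'))
          (Q.baseLift (ContMDiffMap.const x') a PUnit.unit q hq)) =
      Q.baseMap (ContMDiffMap.const (a.map x)) unit (Q.trans (DiffAct.ofEq h) p) := by
    rintro _ _ hq rfl rfl
    have : Q.baseLift (ContMDiffMap.const _) a PUnit.unit
        (Q.baseMap (ContMDiffMap.const _) a p) hq = p :=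
      Q.baseMap_injective _ _ (Subsingleton.elim _ _) (Q.baseMap_baseLift _ _ _ _ _)
    rw [this]
  exact key _ _ rfl hx rfl

/-- Every point of a bundle comes from the restriction of the bundle to a point of the base. -/
theorem exists_point (p : (Q.bun a).total) :
    ∃ (c : point.{u}.Map X) (p₀ : (Q.bun (a.pull c)).total),
    c PUnit.unit = (Q.bun a).proj p ∧ Q.baseMap c a p₀ = p :=
  ⟨ContMDiffMap.const ((Q.bun a).proj p), Q.baseLift _ _ PUnit.unit p rfl, rfl,
    Q.baseMap_baseLift _ _ _ _ _⟩

/-- Restricting to points shows that `eval` is compatible with all base changes, as the isomorphisms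
`Q_∇(φ^*a) ≅ φ^*Q_∇(a)` are compatible with composition. -/
theorem eval_baseMap (φ : Y.Map X) (p : (Q.bun (a.pull φ)).total) :
    Q.eval a (Q.baseMap φ a p) = Q.eval (a.pull φ) p := by
  obtain ⟨c, p₀, -, rfl⟩ := Q.exists_point _ p
  obtain ⟨p₁, rfl⟩ : ∃ p₁, Q.trans (DiffAct.ofEq (a.pull_comp φ c)) p₁ = p₀ :=
    ⟨Q.trans (DiffAct.ofEq (a.pull_comp φ c).symm) p₀, by
      rw [trans_ofEq_trans, trans_ofEq_rfl]⟩
  rw [← Q.baseMap_comp, Q.eval_baseMap_point a _ _ (DiffAct.pull_point_eq a (φ.comp c)),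
    Q.eval_baseMap_point (a.pull φ) _ _ (DiffAct.pull_point_eq (a.pull φ) c), trans_ofEq_trans]
  rfl

theorem eval_unit (q : (Q.bun (unit : DiffAct G M M)).total) : Q.eval unit q = q := by
  obtain ⟨c, p₀, -, rfl⟩ := Q.exists_point _ q
  rw [Q.eval_baseMap_point _ c c rfl, trans_ofEq_rfl]

theorem eval_ofEq {b : DiffAct G M X} (h : a = b) (p) :
    Q.eval b (Q.trans (DiffAct.ofEq h) p) = Q.eval a p := by
  subst h
  rw [trans_ofEq_rfl]

theorem proj_eval (p) : Q.value.proj (Q.eval a p) = a.map ((Q.bun a).proj p) :=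
  Q.proj_baseMap _ _ _

theorem eval_act (p k) : Q.eval a ((Q.bun a).act p k) = Q.value.act (Q.eval a p) k := by
  obtain ⟨c, p₀, -, rfl⟩ := Q.exists_point _ p
  rw [← Q.baseMap_act, Q.eval_baseMap_point _ c _ (DiffAct.pull_point_eq a c),
    Q.eval_baseMap_point _ c _ (DiffAct.pull_point_eq a c), Q.trans_act]
  exact Q.baseMap_act _ _ _ _

theorem trans_ofEq_injective {b : DiffAct G M X} (h : a = b) {p p'}
    (hp : Q.trans (DiffAct.ofEq h) p = Q.trans (DiffAct.ofEq h) p') : p = p' := by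
  subst h
  rwa [trans_ofEq_rfl, trans_ofEq_rfl] at hp

/-- `eval` is injective on the fibres. -/
theorem eval_injective {p p'} (h : (Q.bun a).proj p = (Q.bun a).proj p')
    (h' : Q.eval a p = Q.eval a p') : p = p' := by
  obtain ⟨c, p₀, hc, rfl⟩ := Q.exists_point _ p
  obtain ⟨c', p₁, hc', rfl⟩ := Q.exists_point _ p'
  obtain rfl : c = c' := ContMDiffMap.ext fun t => hc.trans (h.trans hc'.symm)
  rw [Q.eval_baseMap_point _ c _ (DiffAct.pull_point_eq a c),
    Q.eval_baseMap_point _ c _ (DiffAct.pull_point_eq a c)] at h'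
  rw [Q.trans_ofEq_injective _ _ (Q.baseMap_injective _ _ (Subsingleton.elim _ _) h')]

theorem eval_hom {Q Q' : BunConnOnQuot G K M} (τ : Hom Q Q') (p) :
    Q'.eval a (((τ.app X).app a).toFun p) = ((τ.app M).app unit).toFun (Q.eval a p) := by
  have hb : ∀ {Y X : Mfd.{u}} (φ : Y.Map X) (a : DiffAct G M X) (p : (Q.bun (a.pull φ)).total),
      Q'.baseMap φ a (((τ.app Y).app (a.pull φ)).toFun p) =
        ((τ.app X).app a).toFun (Q.baseMap φ a p) := fun φ a p =>
    congrArg (fun t : Q.bun (a.pull φ) ⟶ (Q'.bun a).pull φ => pullSnd (t.toFun p))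
      (τ.base_natural φ a)
  have hn : ∀ {X : Mfd.{u}} {a b : DiffAct G M X} (f : a ⟶ b) (p : (Q.bun a).total),
      ((τ.app X).app b).toFun (Q.trans f p) = Q'.trans f (((τ.app X).app a).toFun p) :=
    fun {X a b} f p => congrArg (fun t : Q.bun a ⟶ Q'.bun b => t.toFun p) ((τ.app X).naturality f)
  obtain ⟨c, p₀, -, rfl⟩ := Q.exists_point _ p
  rw [← hb, Q'.eval_baseMap_point _ c _ (DiffAct.pull_point_eq a c),
    Q.eval_baseMap_point _ c _ (DiffAct.pull_point_eq a c), ← hb, hn]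

/-- A morphism `Q_∇ → Q'_∇` is determined by its value at `(0, id_M)`. -/
theorem Hom.ext_unit {Q Q' : BunConnOnQuot G K M} {τ τ' : Hom Q Q'}
    (h : (τ.app M).app unit = (τ'.app M).app unit) : τ = τ' := by
  have h1 : τ.app = τ'.app := by
    funext X
    ext a
    refine BunConn.Hom.ext' fun p => Q'.eval_injective a ?_ ?_
    · exact (((τ.app X).app a).proj_eq p).trans (((τ'.app X).app a).proj_eq p).symm
    · rw [eval_hom, eval_hom, h]
  cases τ; cases τ'; cases h1; rfl

end eval

section action
variable [ContMDiffSMul G.I M.I ∞ G M]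

theorem translate_eq_eval (h : G) (q : Q.value.total) :
    Q.translate h q = Q.eval ((unit : DiffAct G M M).pull (smulMap h)) (Q.trans (unitHom h) q) := by
  rw [← Q.eval_baseMap, Q.eval_unit]
  rfl

/-- The morphisms `(g, α, f)` act on the right-hand side by `(x, q) ↦ (x, g(x) q)`: over a point, a
morphism of `M//_∇ G` is a constant element of `G`. -/
theorem eval_trans {a b : DiffAct G M X} (f : a ⟶ b) (p : (Q.bun a).total) :
    Q.eval b (Q.trans f p) = Q.translate (f.g ((Q.bun a).proj p)) (Q.eval a p) := by
  obtain ⟨c, p₀, hc, rfl⟩ := Q.exists_point _ p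
  obtain ⟨h, hh⟩ : ∃ h : G, f.g ((Q.bun a).proj (Q.baseMap c a p₀)) = h := ⟨_, rfl⟩
  rw [hh]
  rw [← hc] at hh
  let m := a.map.comp c
  have hb : b.map.comp c = (smulMap h).comp m :=
    ContMDiffMap.ext fun t => (f.map_eq (c t)).trans (congrArg (· • a.map (c t)) hh)
  have e1 : Q.eval b (Q.trans f (Q.baseMap c a p₀)) = Q.baseMap (b.map.comp c) unit
      (Q.trans (DiffAct.pullMap f c ≫ DiffAct.ofEq (DiffAct.pull_point_eq b c)) p₀) := by
    rw [← Q.baseMap_trans, Q.eval_baseMap_point _ c _ (DiffAct.pull_point_eq b c), Q.trans_comp]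
  have e2 : Q.eval a (Q.baseMap c a p₀) =
      Q.baseMap m unit (Q.trans (DiffAct.ofEq (DiffAct.pull_point_eq a c)) p₀) :=
    Q.eval_baseMap_point _ c _ _ _
  have e3 : ∀ (m : point.{u}.Map M) (q₀ : (Q.bun ((unit : DiffAct G M M).pull m)).total),
      Q.baseMap (smulMap h) unit (Q.trans (unitHom h) (Q.baseMap m unit q₀)) =
        Q.baseMap ((smulMap h).comp m) unit (Q.trans (DiffAct.pullMap (unitHom h) m ≫
          DiffAct.ofEq (DiffAct.pull_comp unit (smulMap h) m).symm) q₀) := fun m q₀ => by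
    rw [← Q.baseMap_trans, Q.baseMap_comp, Q.trans_comp, trans_ofEq_trans, trans_ofEq_rfl]
  have hmor : ∀ (m' m'' : point.{u}.Map M) (_ : m' = m'')
      (F : a.pull c ⟶ (unit : DiffAct G M M).pull m')
      (F' : a.pull c ⟶ (unit : DiffAct G M M).pull m''),
      F.g = F'.g → Q.baseMap m' unit (Q.trans F p₀) = Q.baseMap m'' unit (Q.trans F' p₀) := by
    rintro m' _ rfl F F' hF
    obtain rfl : F = F' := DiffAct.Hom.ext' hF
    rfl
  rw [e1, e2]
  refine Eq.trans ?_ (e3 _ _).symm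
  rw [← Q.trans_comp]
  refine hmor _ _ hb _ _ (ContMDiffMap.ext fun t => ?_)
  change 1 * f.g (c t) = (1 * h) * 1
  rw [one_mul, mul_one, one_mul]
  exact hh

theorem translate_one (q : Q.value.total) : Q.translate 1 q = q := by
  have h := Q.eval_trans (𝟙 (unit : DiffAct G M M)) q
  have h1 := (congrArg (Q.eval unit) (Q.trans_id q)).trans (Q.eval_unit q)
  exact ((h1.symm.trans h).trans (congrArg (Q.translate 1) (Q.eval_unit q))).symm

theorem translate_mul (g h : G) (q : Q.value.total) :
    Q.translate (g * h) q = Q.translate g (Q.translate h q) := by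
  have e : DiffAct.form ((unit : DiffAct G M M).pull (smulMap (g * h))) =
      (DiffAct.form ((unit : DiffAct G M M).pull (smulMap h))).gauge
        (ContMDiffMap.const g : M.Map G)⁻¹ := by
    have h1 : (ContMDiffMap.const g : M.Map G)⁻¹ = ContMDiffMap.const g⁻¹ := rfl
    rw [h1]
    have h2 : ∀ k : G, DiffAct.form ((unit : DiffAct G M M).pull (smulMap k)) = 0 :=
      fun k => OneForm.ext fun x v => rfl
    rw [h2, h2, OneForm.zero_gauge_const]
  let f : (unit : DiffAct G M M).pull (smulMap h) ⟶ unit.pull (smulMap (g * h)) :=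
    ⟨ContMDiffMap.const g, e, fun x => mul_smul g h x⟩
  have hf : unitHom h ≫ f = unitHom (g * h) := DiffAct.Hom.ext' rfl
  have hq : ∀ q : (Q.bun (unit : DiffAct G M M)).total,
      Q.trans f (Q.trans (unitHom h) q) = Q.trans (unitHom (g * h)) q := fun q => by
    rw [← Q.trans_comp, hf]
  have h1 := (congrArg (Q.eval _) (hq q).symm).trans (Q.eval_trans f (Q.trans (unitHom h) q))
  exact (Q.translate_eq_eval _ _).trans (h1.trans
    (congrArg (Q.translate g) (Q.translate_eq_eval h q).symm))

theorem proj_translate (h : G) (q : Q.value.total) :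
    Q.value.proj (Q.translate h q) = h • Q.value.proj q :=
  (Q.proj_baseMap (smulMap h) unit _).trans (congrArg (h • ·) (Q.proj_trans (unitHom h) q))

theorem translate_act (h : G) (q : Q.value.total) (k : K) :
    Q.translate h (Q.value.act q k) = Q.value.act (Q.translate h q) k :=
  (congrArg (Q.baseMap (smulMap h) unit) (Q.trans_act (unitHom h) q k)).trans
    (Q.baseMap_act (smulMap h) unit _ k)

theorem conn_translate (h : G) (q : Q.value.total) (w : Q.value.total.E) :
    Q.value.conn.val (Q.translate h q) (der (Q.translate h) q w) = Q.value.conn.val q w := by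
  have h1 := der_comp (Q.baseMap_smooth (smulMap h) unit) (Q.trans_smooth (unitHom h)) q w
  exact (congrArg (Q.value.conn.val (Q.translate h q)) h1).trans
    ((Q.conn_baseMap (smulMap h) unit _ _).trans (Q.conn_trans (unitHom h) q w))

end action

end BunConnOnQuot

/-! ### The product of a manifold with the line -/

section Slices
variable {X : Mfd.{u}} {F : Type u} [NormedAddCommGroup F] [NormedSpace ℝ F]

/-- The projection `X × ℝ → X`. -/
def fstMap (X Y : Mfd.{u}) : (prod X Y).Map X := ⟨Prod.fst, contMDiff_fst⟩

/-- The slice `X ≅ X × {t} ⊆ X × ℝ`. -/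
def sliceMap (X : Mfd.{u}) (t : ℝ) : X.Map (prod X line) :=
  ⟨fun x => (x, ULift.up t), contMDiff_id.prodMk contMDiff_const⟩

theorem down_smooth : ContMDiff line.{u}.I 𝓘(ℝ, ℝ) ∞ (ULift.down : line.{u} → ℝ) :=
  contDiff_down.contMDiff

/-- The curve `s ↦ (x, t + s)` in `X × ℝ`. -/
def rayMap (z : prod X line) : line.{u}.Map (prod X line) :=
  ⟨fun s => (z.1, z.2 + s), contMDiff_const.prodMk
    (contDiff_const.add contDiff_id : ContDiff ℝ ∞ (fun s : ULift.{u} ℝ => z.2 + s)).contMDiff⟩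

/-- The form `t α` on `X × ℝ`, where `t` is the coordinate of `ℝ`. -/
noncomputable def scaleForm (α : OneForm X F) : OneForm (prod X line) F where
  toFun z := z.2.down • (α.pull (fstMap X line)) z
  smooth := by
    have hπ : ContMDiff (prod X line).I.tangent (prod X line).I ∞
        (fun v : TangentBundle (prod X line).I (prod X line) => v.1) :=
      contMDiff_proj (TangentSpace (prod X line).I)
    exact (down_smooth.comp (contMDiff_snd.comp hπ)).smul (α.pull (fstMap X line)).smooth

theorem scaleForm_val (α : OneForm X F) (z : prod X line) (v : X.E × line.{u}.E) :
    (scaleForm α).val z v = z.2.down • α.val z.1 v.1 :=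
  congrArg (fun w => z.2.down • α.val z.1 w) (der_fst (X := X) z v)

theorem der_slice (x : X) (t : ℝ) (v : X.E) : der (sliceMap X t) x v = (v, 0) := by
  have := der_prodMk (X := X) (Y := X) (Z := line) (f := fun x => x)
    (g := fun _ => ULift.up t) (x := x)
    mdifferentiableAt_id mdifferentiableAt_const v
  rw [der_id, der_const] at this
  exact this

theorem der_ray (z : prod X line) (s : line.{u}) (v : line.{u}.E) : der (rayMap z) s v = (0, v) := by
  have h0 : ContDiff ℝ ∞ (fun s : ULift.{u} ℝ => z.2 + s) := contDiff_const.add contDiff_id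
  have h := der_prodMk (X := line) (Y := X) (Z := line) (f := fun _ => z.1)
    (g := fun s => z.2 + s) (x := s)
    mdifferentiableAt_const (h0.contMDiff.mdifferentiableAt (by simp)) v
  rw [der_const] at h
  refine h.trans (congrArg (Prod.mk _) ?_)
  have h2 : HasFDerivAt (fun s : ULift.{u} ℝ => z.2 + s)
      (ContinuousLinearMap.id ℝ (ULift.{u} ℝ)) s := (hasFDerivAt_id (𝕜 := ℝ) s).const_add z.2
  exact congrArg (fun T : ULift.{u} ℝ →L[ℝ] ULift.{u} ℝ => T v) h2.hasMFDerivAt.mfderiv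

theorem smooth_unitVec : ContMDiff line.{u}.I line.{u}.I.tangent ∞
    (fun t : line.{u} => (⟨t, unitVec⟩ : TangentBundle line.{u}.I line.{u})) := by
  intro t
  rw [Bundle.contMDiffAt_totalSpace]
  refine ⟨contMDiffAt_id, (contMDiffAt_const (c := (unitVec : ULift.{u} ℝ))).congr_of_eventuallyEq
    (Filter.Eventually.of_forall fun s => ?_)⟩
  have := trivializationAt_model_space_apply (I := 𝓘(ℝ, ULift.{u} ℝ))
    (⟨s, unitVec⟩ : TangentBundle 𝓘(ℝ, ULift.{u} ℝ) (ULift.{u} ℝ)) t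
  exact congrArg Prod.snd this

/-- The vector field `∂_t` on `X × ℝ` is smooth. -/
theorem smooth_unit_field : ContMDiff (prod X line.{u}).I (prod X line.{u}).I.tangent ∞
    (fun z => (⟨z, ((0 : X.E), (unitVec : line.{u}.E))⟩ :
      TangentBundle (prod X line.{u}).I (prod X line.{u}))) := by
  have h1 : ContMDiff (prod X line.{u}).I X.I.tangent ∞
      (fun z : prod X line.{u} => (⟨z.1, 0⟩ : TangentBundle X.I X)) :=
    (contMDiff_zeroSection ℝ (TangentSpace X.I)).comp contMDiff_fst
  exact contMDiff_equivTangentBundleProd_symm.comp (h1.prodMk (smooth_unitVec.comp contMDiff_snd))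

end Slices

/-! ### Horizontal transport and smoothness of the comparison map -/

namespace DiffAct
variable {G M X : Mfd.{u}}

/-- The object `(tα, f)` over `X × ℝ`. -/
noncomputable def scale (a : DiffAct G M X) : DiffAct G M (prod X line) :=
  ⟨scaleForm a.form, a.map.comp (fstMap X line)⟩

theorem scale_slice_one (a : DiffAct G M X) : a.scale.pull (sliceMap X 1) = a := by
  refine ext' (OneForm.ext fun x (v : X.E) => ?_) rfl
  change (scaleForm a.form).val (x, ULift.up 1) (der (sliceMap X 1) x v) = a.form.val x v
  rw [der_slice, scaleForm_val]
  exact one_smul ℝ _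

theorem scale_slice_zero (a : DiffAct G M X) :
    a.scale.pull (sliceMap X 0) = (BunConnOnQuot.unit : DiffAct G M M).pull a.map := by
  refine ext' (OneForm.ext fun x (v : X.E) => ?_) rfl
  change (scaleForm a.form).val (x, ULift.up 0) (der (sliceMap X 0) x v) = 0
  rw [der_slice, scaleForm_val]
  exact zero_smul ℝ _

/-- The form `tα` vanishes in the direction of `ℝ`. -/
theorem scale_ray (a : DiffAct G M X) (z : prod X line) :
    a.scale.pull (rayMap z) =
      (BunConnOnQuot.unit : DiffAct G M M).pull (ContMDiffMap.const (a.map z.1)) := by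
  refine ext' (OneForm.ext fun s (v : line.{u}.E) => ?_) rfl
  change (scaleForm a.form).val (rayMap z s) (der (rayMap z) s v) = 0
  rw [der_ray, scaleForm_val, map_zero, smul_zero]

end DiffAct

namespace BunConnOnQuot
variable {G K M : Mfd.{u}} [Group G] [LieGroup G.I ∞ G] [MulAction G M] [Group K]
  (Q : BunConnOnQuot G K M) {X Y N : Mfd.{u}} (a : DiffAct G M X)

theorem conn_baseMap_comp (φ : Y.Map X) {σ : N → (Q.bun (a.pull φ)).total}
    (hσ : ContMDiff N.I (Q.bun (a.pull φ)).total.I ∞ σ) (n : N) (v : N.E) :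
    (Q.bun a).conn.val (Q.baseMap φ a (σ n)) (der (fun n => Q.baseMap φ a (σ n)) n v) =
      (Q.bun (a.pull φ)).conn.val (σ n) (der σ n v) := by
  rw [der_comp (Q.baseMap_smooth φ a) hσ, conn_baseMap]

theorem conn_trans_comp {a b : DiffAct G M X} (f : a ⟶ b) {σ : N → (Q.bun a).total}
    (hσ : ContMDiff N.I (Q.bun a).total.I ∞ σ) (n : N) (v : N.E) :
    (Q.bun b).conn.val (Q.trans f (σ n)) (der (fun n => Q.trans f (σ n)) n v) =
      (Q.bun a).conn.val (σ n) (der σ n v) := by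
  rw [der_comp (Q.trans_smooth f) hσ, conn_trans]

theorem eval_of_eq_pull {a : DiffAct G M X} {f : X.Map M}
    (h : a = (unit : DiffAct G M M).pull f) (p) :
    Q.eval a p = Q.baseMap f unit (Q.trans (DiffAct.ofEq h) p) := by
  rw [← Q.eval_ofEq a h, ← Q.eval_baseMap]
  exact Q.eval_unit _

theorem eval_smooth_of_eq_pull {a : DiffAct G M X} {f : X.Map M}
    (h : a = (unit : DiffAct G M M).pull f) :
    ContMDiff (Q.bun a).total.I Q.value.total.I ∞ (Q.eval a) :=
  ((Q.baseMap_smooth f unit).comp (Q.trans_smooth (DiffAct.ofEq h))).congr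
    fun p => Q.eval_of_eq_pull h p

theorem conn_eval_of_eq_pull {a : DiffAct G M X} {f : X.Map M}
    (h : a = (unit : DiffAct G M M).pull f) (p) (w : (Q.bun a).total.E) :
    Q.value.conn.val (Q.eval a p) (der (Q.eval a) p w) = (Q.bun a).conn.val p w := by
  have e : Q.eval a = fun p => Q.baseMap f unit (Q.trans (DiffAct.ofEq h) p) :=
    funext fun p => Q.eval_of_eq_pull h p
  rw [e]
  exact (Q.conn_baseMap_comp unit f (Q.trans_smooth _) p w).trans (Q.conn_trans _ p w)

/-- The point of `Q_∇(f^*(0, id_M)) ≅ f^*Q` that corresponds to `(x, q)`. -/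
noncomputable def unitLift (f : X.Map M) (x : X) (q : Q.value.total) (h : f x = Q.value.proj q) :
    (Q.bun ((unit : DiffAct G M M).pull f)).total := Q.baseLift f unit x q h

theorem proj_unitLift (f : X.Map M) (x q h) : (Q.bun _).proj (Q.unitLift f x q h) = x :=
  Q.proj_baseLift f unit x q h

theorem eval_unitLift (f : X.Map M) (x q h) : Q.eval _ (Q.unitLift f x q h) = q :=
  (Q.eval_baseMap unit f _).symm.trans ((Q.eval_unit _).trans (Q.baseMap_baseLift f unit x q h))

theorem unitLift_smooth (f : X.Map M) {x : N → X} (hx : ContMDiff N.I X.I ∞ x)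
    {q : N → Q.value.total} (hq : ContMDiff N.I Q.value.total.I ∞ q)
    (h : ∀ n, f (x n) = Q.value.proj (q n)) :
    ContMDiff N.I (Q.bun ((unit : DiffAct G M M).pull f)).total.I ∞
      (fun n => Q.unitLift f (x n) (q n) (h n)) :=
  Q.baseLift_smooth f unit hx hq h

section flow

theorem const_eq_proj_eval (p : (Q.bun a.scale).total) (s : line.{u}) :
    (ContMDiffMap.const (a.map ((Q.bun a.scale).proj p).1) : line.{u}.Map M) s =
      Q.value.proj (Q.eval a.scale p) := (Q.proj_eval a.scale p).symm

/-- The horizontal curve in `Q_∇(tα, f)` through `p` that covers `s ↦ (x, t + s)`. -/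
noncomputable def orbit (p : (Q.bun a.scale).total) (s : line.{u}) : (Q.bun a.scale).total :=
  Q.baseMap (rayMap ((Q.bun a.scale).proj p)) a.scale
    (Q.trans (DiffAct.ofEq (a.scale_ray ((Q.bun a.scale).proj p)).symm)
      (Q.unitLift (ContMDiffMap.const (a.map ((Q.bun a.scale).proj p).1)) s (Q.eval a.scale p)
        (Q.const_eq_proj_eval a p s)))

theorem orbit_smooth (p) : ContMDiff line.{u}.I (Q.bun a.scale).total.I ∞ (Q.orbit a p) :=
  (Q.baseMap_smooth _ _).comp ((Q.trans_smooth _).comp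
    (Q.unitLift_smooth _ contMDiff_id contMDiff_const (Q.const_eq_proj_eval a p)))

theorem proj_orbit (p s) :
    (Q.bun a.scale).proj (Q.orbit a p s) = rayMap ((Q.bun a.scale).proj p) s := by
  refine (Q.proj_baseMap _ _ _).trans (congrArg _ ((Q.proj_trans _ _).trans ?_))
  exact Q.proj_unitLift _ _ _ _

theorem eval_orbit (p s) : Q.eval a.scale (Q.orbit a p s) = Q.eval a.scale p := by
  refine (Q.eval_baseMap _ _ _).trans ((Q.eval_ofEq _ _ _).trans ?_)
  exact Q.eval_unitLift _ _ _ _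

theorem conn_orbit (p s v) :
    (Q.bun a.scale).conn.val (Q.orbit a p s) (der (Q.orbit a p) s v) = 0 := by
  have h1 : ContMDiff line.{u}.I _ ∞ fun s =>
      Q.unitLift (ContMDiffMap.const (a.map ((Q.bun a.scale).proj p).1)) s
        (Q.eval a.scale p) (Q.const_eq_proj_eval a p s) :=
    Q.unitLift_smooth _ contMDiff_id contMDiff_const (Q.const_eq_proj_eval a p)
  refine (Q.conn_baseMap_comp a.scale _ ((Q.trans_smooth _).comp h1) s v).trans
    ((Q.conn_trans_comp _ h1 s v).trans ((Q.conn_eval_of_eq_pull rfl _ _).symm.trans ?_))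
  rw [← der_comp (Q.eval_smooth_of_eq_pull rfl) h1]
  have h2 : (fun s => Q.eval _ (Q.unitLift (ContMDiffMap.const (a.map ((Q.bun a.scale).proj p).1)) s
      (Q.eval a.scale p) (Q.const_eq_proj_eval a p s))) = fun _ => Q.eval a.scale p :=
    funext fun s => Q.eval_unitLift _ _ _ _
  have h3 := (congrArg (fun f => der f s v) h2).trans (der_const (Q.eval a.scale p) s v)
  exact (congrArg _ h3).trans (map_zero _)

theorem der_proj_orbit (p s) :
    der (Q.bun a.scale).proj (Q.orbit a p s) (der (Q.orbit a p) s unitVec) = (0, unitVec) := by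
  rw [← der_comp (Q.bun a.scale).proj_smooth (Q.orbit_smooth a p)]
  have : (fun s => (Q.bun a.scale).proj (Q.orbit a p s)) = rayMap ((Q.bun a.scale).proj p) :=
    funext fun s => Q.proj_orbit a p s
  rw [this, der_ray]

theorem orbit_eq {p p' : (Q.bun a.scale).total} {s : line.{u}}
    (h : (Q.bun a.scale).proj p' = rayMap ((Q.bun a.scale).proj p) s)
    (h' : Q.eval a.scale p' = Q.eval a.scale p) : Q.orbit a p s = p' :=
  Q.eval_injective _ ((Q.proj_orbit a p s).trans h.symm) ((Q.eval_orbit a p s).trans h'.symm)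

theorem orbit_zero (p) : Q.orbit a p 0 = p :=
  Q.orbit_eq a (Prod.ext rfl (add_zero _).symm) rfl

theorem orbit_add (p s t) : Q.orbit a p (s + t) = Q.orbit a (Q.orbit a p t) s :=
  Q.orbit_eq a (by
    rw [proj_orbit, proj_orbit]
    refine Prod.ext rfl ?_
    change _ + t + s = _ + (s + t)
    rw [add_assoc, add_comm t s]) (by rw [eval_orbit, eval_orbit])

variable [LieGroup K.I ∞ K]

/-- Horizontal transport in the direction of `ℝ` is a smooth action of `ℝ` on `Q_∇(tα, f)`. -/
theorem flow_smooth : ContMDiff (𝓘(ℝ, ℝ).prod (Q.bun a.scale).total.I) (Q.bun a.scale).total.I ∞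
    (fun z : ℝ × (Q.bun a.scale).total => Q.orbit a z.2 (ULift.up z.1)) := by
  let V : (Q.bun a.scale).total → (Q.bun a.scale).total.E := fun p => der (Q.orbit a p) 0 unitVec
  have hV := (Q.bun a.scale).smooth_horizontal_lift _ (smooth_unit_field (X := X)) V
    (fun p => by
      have := Q.der_proj_orbit a p 0
      rwa [orbit_zero] at this)
    (fun p => by
      have := Q.conn_orbit a p 0 unitVec
      rwa [orbit_zero] at this)
  refine contMDiff_flow (V := V) (Φ := fun s p => Q.orbit a p (ULift.up s)) hV
    (fun p => Q.orbit_zero a p) (fun s t p => Q.orbit_add a p _ _) fun p s => ?_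
  have h1 := hasMFDerivAt_line ⟨Q.orbit a p, Q.orbit_smooth a p⟩ s
  have h2 : der (Q.orbit a p) (ULift.up s) unitVec = V (Q.orbit a p (ULift.up s)) := by
    refine (Q.bun a.scale).horizontal_unique (Q.orbit a p (ULift.up s)) ?_ ?_
    · have := Q.der_proj_orbit a (Q.orbit a p (ULift.up s)) 0
      rw [orbit_zero] at this
      rw [this, der_proj_orbit]
    · have := Q.conn_orbit a (Q.orbit a p (ULift.up s)) 0 unitVec
      rw [orbit_zero] at this
      rw [this, conn_orbit]
  exact h1.congr_mfderiv (congrArg (fun w : (Q.bun a.scale).total.E =>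
    (1 : ℝ →L[ℝ] ℝ).smulRight w) h2)

theorem transport_smooth (s : ℝ) : ContMDiff (Q.bun a.scale).total.I (Q.bun a.scale).total.I ∞
    (fun p => Q.orbit a p (ULift.up s)) :=
  (Q.flow_smooth a).comp (contMDiff_const.prodMk contMDiff_id)

end flow

variable [LieGroup K.I ∞ K]

/-- The comparison map is smooth, although it is defined pointwise. -/
theorem eval_smooth : ContMDiff (Q.bun a).total.I Q.value.total.I ∞ (Q.eval a) := by
  -- transport from `t = 1`, where the bundle is `Q_∇(α, f)`, to `t = 0`, where the form vanishes
  let p₁ : (Q.bun a).total → (Q.bun a.scale).total := fun p =>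
    Q.baseMap (sliceMap X 1) a.scale (Q.trans (DiffAct.ofEq a.scale_slice_one.symm) p)
  have hp₁ : ContMDiff (Q.bun a).total.I (Q.bun a.scale).total.I ∞ p₁ :=
    (Q.baseMap_smooth _ _).comp (Q.trans_smooth _)
  have hproj : ∀ p, (Q.bun a.scale).proj (p₁ p) = sliceMap X 1 ((Q.bun a).proj p) := fun p =>
    (Q.proj_baseMap _ _ _).trans (congrArg _ (Q.proj_trans _ _))
  have hs : ∀ p, sliceMap X 0 ((Q.bun a).proj p) =
      (Q.bun a.scale).proj (Q.orbit a (p₁ p) (ULift.up (-1))) := fun p => by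
    rw [proj_orbit, hproj]
    refine Prod.ext rfl (ULift.ext _ _ ?_)
    change (0 : ℝ) = 1 + -1
    norm_num
  have hsm := (Q.eval_smooth_of_eq_pull a.scale_slice_zero).comp
    (Q.baseLift_smooth (sliceMap X 0) a.scale (Q.bun a).proj_smooth
      ((Q.transport_smooth a (-1)).comp hp₁) hs)
  refine hsm.congr fun p => ?_
  change _ = Q.eval _ (Q.baseLift _ _ _ _ _)
  rw [← eval_baseMap, baseMap_baseLift]
  change _ = Q.eval _ (Q.orbit a (p₁ p) _)
  rw [eval_orbit, eval_baseMap, eval_ofEq]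

/-- The inverse of the comparison map `eval` is smooth. -/
theorem exists_smooth_lift {x : N → X} (hx : ContMDiff N.I X.I ∞ x) {q : N → Q.value.total}
    (hq : ContMDiff N.I Q.value.total.I ∞ q) (h : ∀ n, a.map (x n) = Q.value.proj (q n)) :
    ∃ p : N → (Q.bun a).total, ContMDiff N.I (Q.bun a).total.I ∞ p ∧
      (∀ n, (Q.bun a).proj (p n) = x n) ∧ ∀ n, Q.eval a (p n) = q n := by
  let p₀ : N → (Q.bun a.scale).total := fun n => Q.baseMap (sliceMap X 0) a.scale
    (Q.trans (DiffAct.ofEq a.scale_slice_zero.symm) (Q.unitLift a.map (x n) (q n) (h n)))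
  have hp₀ : ContMDiff N.I (Q.bun a.scale).total.I ∞ p₀ :=
    (Q.baseMap_smooth _ _).comp ((Q.trans_smooth _).comp (Q.unitLift_smooth _ hx hq h))
  have hproj : ∀ n, (Q.bun a.scale).proj (p₀ n) = sliceMap X 0 (x n) := fun n =>
    (Q.proj_baseMap _ _ _).trans (congrArg _ ((Q.proj_trans _ _).trans (Q.proj_unitLift _ _ _ _)))
  have hev : ∀ n, Q.eval a.scale (p₀ n) = q n := fun n => by
    change Q.eval a.scale (Q.baseMap _ _ _) = _
    rw [eval_baseMap, eval_ofEq, eval_unitLift]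
  have hs : ∀ n, sliceMap X 1 (x n) =
      (Q.bun a.scale).proj (Q.orbit a (p₀ n) (ULift.up 1)) := fun n => by
    rw [proj_orbit, hproj]
    refine Prod.ext rfl (ULift.ext _ _ ?_)
    change (1 : ℝ) = 0 + 1
    norm_num
  refine ⟨fun n => Q.trans (DiffAct.ofEq a.scale_slice_one)
    (Q.baseLift (sliceMap X 1) a.scale (x n) (Q.orbit a (p₀ n) (ULift.up 1)) (hs n)),
    (Q.trans_smooth _).comp (Q.baseLift_smooth _ _ hx ((Q.transport_smooth a 1).comp hp₀) hs),
    fun n => (Q.proj_trans _ _).trans (Q.proj_baseLift _ _ _ _ _), fun n => ?_⟩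
  rw [eval_ofEq, ← eval_baseMap, baseMap_baseLift, eval_orbit, hev]

/-- The action is smooth, as it is `Q_∇` of the universal morphism over `G × M`. -/
theorem translate_smooth [ContMDiffSMul G.I M.I ∞ G M] :
    ContMDiff (G.I.prod Q.value.total.I) Q.value.total.I ∞
      (fun z : G × Q.value.total => Q.translate z.1 z.2) := by
  -- the universal group element is the projection `G × M → G`
  let g : (prod G M).Map G := ⟨Prod.fst, contMDiff_fst⟩
  let pr : (prod G M).Map M := ⟨Prod.snd, contMDiff_snd⟩
  let a : DiffAct G M (prod G M) := (unit : DiffAct G M M).pull pr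
  let b : DiffAct G M (prod G M) := ⟨a.form.gauge g⁻¹, ⟨fun z => z.1 • z.2,
    contMDiff_smul (I := G.I) (I' := M.I) (n := ∞)⟩⟩
  let f : a ⟶ b := ⟨g, rfl, fun z => rfl⟩
  have hx : ContMDiff (G.I.prod Q.value.total.I) (prod G M).I ∞
      (fun z : G × Q.value.total => (z.1, Q.value.proj z.2)) :=
    contMDiff_fst.prodMk (Q.value.proj_smooth.comp contMDiff_snd)
  obtain ⟨p, hp, hp', hev⟩ := Q.exists_smooth_lift (N := prod G Q.value.total) a hx contMDiff_snd
    fun n => rfl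
  refine ((Q.eval_smooth b).comp ((Q.trans_smooth f).comp hp)).congr fun z => ?_
  refine Eq.trans ?_ (Q.eval_trans f (p z)).symm
  rw [hev, hp']
  rfl

/-- The `G`-equivariant bundle with invariant connection `(Q, Θ) = Q_∇(0, id_M)`. -/
noncomputable def equivStr [ContMDiffSMul G.I M.I ∞ G M] : EquivStr G Q.value where
  act := Q.translate
  act_smooth := Q.translate_smooth
  one_act := Q.translate_one
  mul_act := Q.translate_mul
  proj_act := Q.proj_translate
  act_comm := Q.translate_act
  conn_invariant := Q.conn_translate

end BunConnOnQuot

/-! ### The universal object over the line -/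

section Universal

/-- The form `dt` on the line. -/
noncomputable def lineForm : OneForm line.{u} (ULift.{u} ℝ) where
  toFun _ := ContinuousLinearMap.id ℝ (ULift.{u} ℝ)
  smooth := by
    intro v
    have h := (Bundle.contMDiffAt_totalSpace.1 (contMDiffAt_id (I := line.{u}.I.tangent) (n := ∞)
      (x := v))).2
    refine h.congr_of_eventuallyEq (Filter.Eventually.of_forall fun w => ?_)
    exact (congrArg Prod.snd
      (trivializationAt_model_space_apply (I := 𝓘(ℝ, ULift.{u} ℝ)) w v.1)).symm

/-- The base `(𝔤 × M) × ℝ` of the object that is universal for objects over the line. -/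
noncomputable abbrev universalBase (G M : Mfd.{u}) : Mfd.{u} := prod (prod (ofSpace G.E) M) line

namespace DiffAct
variable {G M : Mfd.{u}}

/-- The object over `(𝔤 × M) × ℝ` whose form is `A dt` at `((A, m), t)` and whose map is the projection
to `M`. Every object over the line is a pullback of this one. -/
noncomputable def universal (G M : Mfd.{u}) : DiffAct G M (universalBase G M) where
  form :=
    { toFun := fun z =>
        ((ContinuousLinearEquiv.ulift (R₁ := ℝ) (M₁ := ℝ) : ULift.{u} ℝ →L[ℝ] ℝ).comp
          ((lineForm.pull ⟨Prod.snd, contMDiff_snd⟩ : OneForm (universalBase G M) _) z)).smulRight z.1.1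
      smooth := by
        have hπ : ContMDiff (universalBase G M).I.tangent (universalBase G M).I ∞
            (fun v : TangentBundle (universalBase G M).I (universalBase G M) => v.1) :=
          contMDiff_proj (TangentSpace (universalBase G M).I)
        exact (down_smooth.comp (lineForm.pull (⟨Prod.snd, contMDiff_snd⟩ :
          (universalBase G M).Map line)).smooth).smul
            (contMDiff_fst.comp (contMDiff_fst.comp hπ)) }
  map := ⟨fun z => z.1.2, contMDiff_snd.comp contMDiff_fst⟩

theorem universal_form_val (z : universalBase G M) (v : (G.E × M.E) × line.{u}.E) :
    (universal G M).form.val z v = v.2.down • z.1.1 :=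
  congrArg (fun w : ULift.{u} ℝ => w.down • z.1.1)
    (der_snd (X := prod (ofSpace G.E) M) (Y := line) z v)

/-- The map `t ↦ ((α_t(∂_t), f(t)), t)` that classifies an object `(α, f)` over the line. -/
noncomputable def classify (b : DiffAct G M line.{u}) : line.{u}.Map (universalBase G M) :=
  ⟨fun t => ((b.form.val t unitVec, b.map t), t),
    ((b.form.smooth.comp smooth_unitVec).prodMk b.map.contMDiff).prodMk contMDiff_id⟩

theorem der_classify_snd (b : DiffAct G M line.{u}) (t : line.{u}) (v : line.{u}.E) :
    (der b.classify t v : (G.E × M.E) × line.{u}.E).2 = v := by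
  have h := der_comp (X := line) (Y := universalBase G M) (Z := line) (g := Prod.snd) contMDiff_snd
    b.classify.contMDiff t v
  rw [der_snd] at h
  exact h.symm.trans (der_id t v)

theorem universal_pull_classify (b : DiffAct G M line.{u}) :
    (universal G M).pull b.classify = b := by
  refine ext' (OneForm.ext fun t (v : line.{u}.E) => ?_) rfl
  change (universal G M).form.val (b.classify t) (der b.classify t v) = b.form.val t v
  rw [universal_form_val, der_classify_snd]
  change v.down • b.form.val t unitVec = b.form.val t v
  rw [← map_smul]
  congr 1
  exact ULift.ext _ _ (mul_one v.down)

theorem universal_pull_slice :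
    (universal G M).pull (sliceMap (prod (ofSpace G.E) M) 0) =
      (BunConnOnQuot.unit : DiffAct G M M).pull ⟨Prod.snd, contMDiff_snd⟩ := by
  refine ext' (OneForm.ext fun y (v : G.E × M.E) => ?_) rfl
  change (universal G M).form.val (sliceMap _ 0 y) (der (sliceMap (prod (ofSpace G.E) M) 0) y v) = 0
  rw [universal_form_val, der_slice]
  exact zero_smul ℝ _

end DiffAct

end Universal

/-! ### The connection under the comparison map -/

namespace BunConnOnQuot
variable {G K M : Mfd.{u}} [Group G] [LieGroup G.I ∞ G] [MulAction G M] [Group K] [LieGroup K.I ∞ K]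
  (Q : BunConnOnQuot G K M) {X Y N : Mfd.{u}}

/-- The vector field `ρ(A)` on `Q`: the derivative of `g ↦ g⁻¹ q` at `1` in direction `A`. -/
noncomputable def rho [ContMDiffSMul G.I M.I ∞ G M] (q : Q.value.total) :
    G.E →L[ℝ] Q.value.total.E := Q.equivStr.rho q

section defect
variable [ContMDiffSMul G.I M.I ∞ G M] (a : DiffAct G M X)

/-- The difference between the connection of `Q_∇(α, f)` and the pullback along `eval` of the connection
`(1 - ι_{ρ(α)}) f^*Θ`. -/
noncomputable def defect (p : (Q.bun a).total) : (Q.bun a).total.E →L[ℝ] K.E :=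
  (Q.bun a).conn.val p - ((Q.value.conn.val (Q.eval a p)).comp (der (Q.eval a) p) -
    (Q.value.conn.val (Q.eval a p)).comp ((Q.rho (Q.eval a p)).comp
      ((a.form.val ((Q.bun a).proj p)).comp (der (Q.bun a).proj p))))

theorem defect_apply (p : (Q.bun a).total) (w : (Q.bun a).total.E) :
    Q.defect a p w = (Q.bun a).conn.val p w -
      (Q.value.conn.val (Q.eval a p) (der (Q.eval a) p w) -
        Q.value.conn.val (Q.eval a p) (Q.rho (Q.eval a p)
          (a.form.val ((Q.bun a).proj p) (der (Q.bun a).proj p w)))) := rfl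

theorem defect_baseMap (φ : Y.Map X) (p : (Q.bun (a.pull φ)).total)
    (w : (Q.bun (a.pull φ)).total.E) :
    Q.defect a (Q.baseMap φ a p) (der (Q.baseMap φ a) p w) = Q.defect (a.pull φ) p w := by
  rw [defect_apply, defect_apply, conn_baseMap, ← der_comp (Q.eval_smooth a) (Q.baseMap_smooth φ a),
    ← der_comp (Q.bun a).proj_smooth (Q.baseMap_smooth φ a)]
  have h1 : (fun p => Q.eval a (Q.baseMap φ a p)) = Q.eval (a.pull φ) :=
    funext fun p => Q.eval_baseMap a φ p
  have h2 : (fun p => (Q.bun a).proj (Q.baseMap φ a p)) = fun p => φ ((Q.bun (a.pull φ)).proj p) :=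
    funext fun p => Q.proj_baseMap φ a p
  rw [h1, h2, der_comp φ.contMDiff (Q.bun (a.pull φ)).proj_smooth, eval_baseMap, proj_baseMap]
  rfl

theorem defect_ofEq {a b : DiffAct G M X} (h : a = b) (p) (w : (Q.bun a).total.E) :
    Q.defect b (Q.trans (DiffAct.ofEq h) p) (der (Q.trans (DiffAct.ofEq h)) p w) =
      Q.defect a p w := by
  subst h
  have h1 : Q.trans (DiffAct.ofEq (rfl : a = a)) = fun p => p :=
    funext fun p => Q.trans_ofEq_rfl p
  rw [h1, der_id]

theorem defect_vertical (p) (w : (Q.bun a).total.E) (hw : der (Q.bun a).proj p w = 0) :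
    Q.defect a p w = 0 := by
  have h1 := (Q.bun a).vertical_eq p w hw
  set A := (Q.bun a).conn.val p w with hA
  have h2 : Q.value.conn.val (Q.eval a p) (der (Q.eval a) p w) = A := by
    have h3 := der_comp (Q.eval_smooth a) ((Q.bun a).smooth_act_left p) 1 A
    rw [(Q.bun a).act_one, ← h1] at h3
    have h4 : (fun k => Q.eval a ((Q.bun a).act p k)) = Q.value.act (Q.eval a p) :=
      funext fun k => Q.eval_act a p k
    rw [← h3, h4]
    exact (Q.value.conn_congr (Q.value.act_one _) _).symm.trans
      (Q.value.conn_vertical (Q.eval a p) A)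
  rw [defect_apply, hw, h2, map_zero, map_zero, map_zero, sub_zero, sub_self]

/-- By linearity, the defect at a point only depends on the tangent vector of the base. -/
theorem defect_eq_of_der_proj (p) (w w' : (Q.bun a).total.E)
    (h : der (Q.bun a).proj p w = der (Q.bun a).proj p w') : Q.defect a p w = Q.defect a p w' := by
  rw [← sub_eq_zero, ← map_sub]
  exact Q.defect_vertical a p _ (by rw [map_sub, h, sub_self])

theorem defect_of_eq_pull {a : DiffAct G M X} {f : X.Map M} (h : a = (unit : DiffAct G M M).pull f)
    (p) (w : (Q.bun a).total.E) : Q.defect a p w = 0 := by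
  have h1 := Q.conn_eval_of_eq_pull h p w
  have h2 : a.form.val ((Q.bun a).proj p) (der (Q.bun a).proj p w) = 0 := by
    subst h
    rfl
  rw [defect_apply, h1, h2, map_zero, map_zero, sub_zero, sub_self]

end defect

section line
variable [ContMDiffSMul G.I M.I ∞ G M]

/-- The defect of the universal object vanishes along the slice `t = 0`, where its form restricts to
zero. -/
theorem defect_universal (p : (Q.bun (DiffAct.universal G M)).total)
    (w : (Q.bun (DiffAct.universal G M)).total.E)
    (hp : ((Q.bun (DiffAct.universal G M)).proj p).2 = 0)
    (hw : (der (Q.bun (DiffAct.universal G M)).proj p w : (G.E × M.E) × line.{u}.E).2 = 0) :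
    Q.defect (DiffAct.universal G M) p w = 0 := by
  let s := sliceMap (prod (ofSpace G.E) M) 0
  obtain ⟨p₀, rfl⟩ : ∃ p₀, Q.baseMap s (DiffAct.universal G M) p₀ = p :=
    ⟨_, Q.baseMap_baseLift s _ ((Q.bun (DiffAct.universal G M)).proj p).1 p (Prod.ext rfl hp.symm)⟩
  obtain ⟨w₀, hw₀⟩ := (Q.bun ((DiffAct.universal G M).pull s)).exists_der_proj p₀
    (der (Q.bun (DiffAct.universal G M)).proj (Q.baseMap s _ p₀) w : (G.E × M.E) × line.{u}.E).1
  have h1 : der (Q.bun (DiffAct.universal G M)).proj (Q.baseMap s _ p₀)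
      (der (Q.baseMap s _) p₀ w₀) =
      der (Q.bun (DiffAct.universal G M)).proj (Q.baseMap s _ p₀) w := by
    rw [← der_comp (Q.bun _).proj_smooth (Q.baseMap_smooth s _)]
    have h2 : (fun p => (Q.bun (DiffAct.universal G M)).proj (Q.baseMap s _ p)) =
        fun p => s ((Q.bun _).proj p) := funext fun p => Q.proj_baseMap s _ p
    rw [h2, der_comp s.contMDiff (Q.bun _).proj_smooth, hw₀, der_slice]
    exact Prod.ext rfl hw.symm
  rw [← Q.defect_eq_of_der_proj _ _ _ _ h1, defect_baseMap]
  exact Q.defect_of_eq_pull DiffAct.universal_pull_slice _ _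

/-- Over the line, the connection at `t = 0` only depends on the values of the form and the map at
`t = 0`. -/
theorem defect_congr {b b' : DiffAct G M line.{u}}
    (hform : b.form.val 0 unitVec = b'.form.val 0 unitVec) (hmap : b.map 0 = b'.map 0)
    {p : (Q.bun b).total} {p' : (Q.bun b').total} (hp : (Q.bun b).proj p = 0)
    (hp' : (Q.bun b').proj p' = 0) (he : Q.eval b p = Q.eval b' p')
    {w : (Q.bun b).total.E} {w' : (Q.bun b').total.E} (hw : der (Q.bun b).proj p w = unitVec)
    (hw' : der (Q.bun b').proj p' w' = unitVec) : Q.defect b p w = Q.defect b' p' w' := by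
  have key : ∀ (b : DiffAct G M line.{u}) (p : (Q.bun b).total) (w : (Q.bun b).total.E),
      (Q.bun b).proj p = 0 → der (Q.bun b).proj p w = unitVec →
      ∃ (r : (Q.bun (DiffAct.universal G M)).total) (x : (Q.bun (DiffAct.universal G M)).total.E),
        (Q.bun _).proj r = b.classify 0 ∧ Q.eval _ r = Q.eval b p ∧
        (der (Q.bun (DiffAct.universal G M)).proj r x : (G.E × M.E) × line.{u}.E).2 = unitVec ∧
        Q.defect _ r x = Q.defect b p w := by
    intro b p w hp hw
    have e := b.universal_pull_classify.symm
    let F : (Q.bun b).total → (Q.bun (DiffAct.universal G M)).total := fun p =>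
      Q.baseMap b.classify _ (Q.trans (DiffAct.ofEq e) p)
    have hF : ContMDiff (Q.bun b).total.I (Q.bun (DiffAct.universal G M)).total.I ∞ F :=
      (Q.baseMap_smooth _ _).comp (Q.trans_smooth _)
    have hproj : ∀ p, (Q.bun _).proj (F p) = b.classify ((Q.bun b).proj p) := fun p =>
      (Q.proj_baseMap _ _ _).trans (congrArg _ (Q.proj_trans _ _))
    refine ⟨F p, der F p w, (hproj p).trans (congrArg _ hp),
      (Q.eval_baseMap _ _ _).trans (Q.eval_ofEq _ _ _), ?_, ?_⟩
    · rw [← der_comp (Q.bun _).proj_smooth hF, funext hproj,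
        der_comp b.classify.contMDiff (Q.bun b).proj_smooth, DiffAct.der_classify_snd, hw]
    · rw [der_comp (Q.baseMap_smooth _ _) (Q.trans_smooth _)]
      exact (Q.defect_baseMap _ _ _ _).trans (Q.defect_ofEq e p w)
  obtain ⟨r, x, h1, h2, h3, h4⟩ := key b p w hp hw
  obtain ⟨r', x', h1', h2', h3', h4'⟩ := key b' p' w' hp' hw'
  have hc : b.classify 0 = b'.classify 0 := Prod.ext (Prod.ext hform hmap) rfl
  obtain rfl : r = r' := Q.eval_injective _ (h1.trans (hc.trans h1'.symm))
    (h2.trans (he.trans h2'.symm))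
  rw [← h4, ← h4', ← sub_eq_zero, ← map_sub]
  refine Q.defect_universal _ _ (congrArg Prod.snd h1) ?_
  rw [map_sub]
  exact (congrArg₂ (fun u v : line.{u}.E => u - v) h3 h3').trans (sub_self _)

/-- For a curve `c` in `G` through `1` with velocity `A`, the morphism `(c⁻¹, 0, m)` over the line has the
target `(c^*θ, c⁻¹ m)`, whose form is `A dt` at `t = 0`. As `Q_∇` turns it into an isomorphism of bundles
with connection, the connection over its target is known. -/
theorem exists_defect_eq_zero (q : Q.value.total) (A : G.E) :
    ∃ (b : DiffAct G M line.{u}) (p : (Q.bun b).total) (w : (Q.bun b).total.E),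
      b.form.val 0 unitVec = A ∧ b.map 0 = Q.value.proj q ∧ (Q.bun b).proj p = 0 ∧
      Q.eval b p = q ∧ der (Q.bun b).proj p w = unitVec ∧ Q.defect b p w = 0 := by
  obtain ⟨c, hc0, hc⟩ := exists_curve G 1 A
  let m : line.{u}.Map M := ContMDiffMap.const (Q.value.proj q)
  let a : DiffAct G M line.{u} := (unit : DiffAct G M M).pull m
  let b : DiffAct G M line.{u} := ⟨a.form.gauge (c⁻¹)⁻¹, ⟨fun s => (c s)⁻¹ • Q.value.proj q,
    (contMDiff_smul (I := G.I) (I' := M.I) (n := ∞)).comp (c.contMDiff.inv.prodMk contMDiff_const)⟩⟩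
  let f : a ⟶ b := ⟨c⁻¹, rfl, fun _ => rfl⟩
  let σ : line.{u} → (Q.bun a).total := fun s => Q.unitLift m s q rfl
  have hσ : ContMDiff line.{u}.I (Q.bun a).total.I ∞ σ :=
    Q.unitLift_smooth m contMDiff_id contMDiff_const fun _ => rfl
  have hτ : ContMDiff line.{u}.I (Q.bun b).total.I ∞ (fun s => Q.trans f (σ s)) :=
    (Q.trans_smooth f).comp hσ
  have hproj : ∀ s, (Q.bun b).proj (Q.trans f (σ s)) = s := fun s =>
    (Q.proj_trans _ _).trans (Q.proj_unitLift _ _ _ _)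
  have heval : ∀ s, Q.eval b (Q.trans f (σ s)) = Q.translate (c s)⁻¹ q := fun s =>
    (Q.eval_trans f _).trans (congrArg₂ (fun s q => Q.translate (c s)⁻¹ q)
      (Q.proj_unitLift _ _ _ _) (Q.eval_unitLift _ _ _ _))
  have heval0 : Q.eval b (Q.trans f (σ 0)) = q := by
    rw [heval, hc0, inv_one, translate_one]
  have hform : b.form.val 0 unitVec = A := by
    have e : b.form.val 0 unitVec = Ad G ((c⁻¹)⁻¹ 0)⁻¹ (0 : G.E) +
      maurerCartan G ((c⁻¹)⁻¹ 0) (der ((c⁻¹)⁻¹ : line.{u}.Map G) 0 unitVec) := rfl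
    rw [e, inv_inv, map_zero, zero_add, hc, hc0]
    have h1 : (fun h : G => (1 : G)⁻¹ * h) = fun h => h := by
      funext h
      rw [inv_one, one_mul]
    change der (fun h : G => (1 : G)⁻¹ * h) 1 A = A
    rw [h1, der_id]
  have hw : der (Q.bun b).proj (Q.trans f (σ 0)) (der (fun s => Q.trans f (σ s)) 0 unitVec) =
      unitVec := by
    rw [← der_comp (Q.bun b).proj_smooth hτ]
    have h1 : (fun s => (Q.bun b).proj (Q.trans f (σ s))) = fun s => s := funext hproj
    rw [h1, der_id]
  refine ⟨b, Q.trans f (σ 0), der (fun s => Q.trans f (σ s)) 0 unitVec, hform, ?_, hproj 0, heval0,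
    hw, ?_⟩
  · change (c 0)⁻¹ • Q.value.proj q = _
    rw [hc0, inv_one, one_smul]
  · have h1 : (Q.bun b).conn.val (Q.trans f (σ 0))
        (der (fun s => Q.trans f (σ s)) 0 unitVec) = 0 := by
      rw [conn_trans_comp Q f hσ, ← Q.conn_eval_of_eq_pull (f := m) rfl,
        ← der_comp (Q.eval_smooth a) hσ]
      have h2 : (fun s => Q.eval a (σ s)) = fun _ => q := funext fun s => Q.eval_unitLift _ _ _ _
      rw [h2, der_const, map_zero]
    have h2 : der (Q.eval b) (Q.trans f (σ 0)) (der (fun s => Q.trans f (σ s)) 0 unitVec) =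
        Q.rho q A := by
      rw [← der_comp (Q.eval_smooth b) hτ]
      have h3 : (fun s => Q.eval b (Q.trans f (σ s))) = fun s => Q.translate (c s)⁻¹ q :=
        funext heval
      have h4 : ContMDiff G.I Q.value.total.I ∞ (fun g : G => Q.translate g⁻¹ q) :=
        Q.equivStr.act_inv_smooth.comp (contMDiff_const.prodMk contMDiff_id)
      rw [h3, der_comp h4 c.contMDiff, hc, hc0]
      rfl
    rw [defect_apply, h1, h2, hw, hproj, hform, heval0, sub_self, sub_self]

/-- Every value of the form and the map at `t = 0` occurs in `exists_defect_eq_zero`. -/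
theorem defect_line {b : DiffAct G M line.{u}} {p : (Q.bun b).total} (hp : (Q.bun b).proj p = 0)
    {w : (Q.bun b).total.E} (hw : der (Q.bun b).proj p w = unitVec) : Q.defect b p w = 0 := by
  obtain ⟨b', p', w', h1, h2, h3, h4, h5, h6⟩ :=
    Q.exists_defect_eq_zero (Q.eval b p) (b.form.val 0 unitVec)
  rw [← h6]
  refine Q.defect_congr h1.symm (Eq.trans ?_ h2.symm) hp h3 h4.symm hw h5
  rw [proj_eval, hp]

/-- The comparison map `eval` takes the connection of `Q_∇(α, f)` to `(1 - ι_{ρ(α)}) f^*Θ`. -/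
theorem defect_eq_zero (a : DiffAct G M X) (p : (Q.bun a).total) (w : (Q.bun a).total.E) :
    Q.defect a p w = 0 := by
  -- restrict to the projection of a curve with velocity `w`
  obtain ⟨γ, rfl, rfl⟩ := exists_curve (Q.bun a).total p w
  let c : line.{u}.Map X := ⟨fun s => (Q.bun a).proj (γ s), (Q.bun a).proj_smooth.comp γ.contMDiff⟩
  let σ : line.{u} → (Q.bun (a.pull c)).total := fun s => Q.baseLift c a s (γ s) rfl
  have hσ : ContMDiff line.{u}.I (Q.bun (a.pull c)).total.I ∞ σ :=
    Q.baseLift_smooth c a contMDiff_id γ.contMDiff fun _ => rfl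
  have h1 : (fun s => Q.baseMap c a (σ s)) = γ := funext fun s => Q.baseMap_baseLift _ _ _ _ _
  have hproj : (fun s => (Q.bun (a.pull c)).proj (σ s)) = fun s => s :=
    funext fun s => Q.proj_baseLift _ _ _ _ _
  have h2 : Q.defect (a.pull c) (σ 0) (der σ 0 unitVec) = 0 :=
    Q.defect_line (congrFun hproj 0) (by
      rw [← der_comp (Q.bun (a.pull c)).proj_smooth hσ, hproj, der_id])
  rw [← defect_baseMap, ← der_comp (Q.baseMap_smooth c a) hσ, h1] at h2
  rwa [show Q.baseMap c a (σ 0) = γ 0 from congrFun h1 0] at h2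

end line

end BunConnOnQuot

/-! ### The comparison isomorphism -/

namespace BunConn
variable {K X : Mfd.{u}} [Group K]

/-- A morphism of bundles with connection that has a smooth inverse is an isomorphism. -/
def isoOfInverse {P R : BunConn K X} (f : P ⟶ R) (g : R.total → P.total)
    (hg : ContMDiff R.total.I P.total.I ∞ g) (hgf : ∀ p, g (f.toFun p) = p)
    (hfg : ∀ r, f.toFun (g r) = r) : P ≅ R where
  hom := f
  inv :=
    { toFun := g
      smooth := hg
      proj_eq := fun r => by rw [← f.proj_eq, hfg]
      equivariant := fun r k => by
        rw [← hgf (P.act (g r) k), f.equivariant, hfg]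
      conn_eq := fun r (v : R.total.E) => by
        have h1 := der_comp f.smooth hg r v
        have h2 : (fun r => f.toFun (g r)) = fun r => r := funext hfg
        rw [h2, der_id] at h1
        have h3 := hom_conn f (g r) (der g r v)
        rw [← h1, hfg] at h3
        exact h3.symm }
  hom_inv_id := Hom.ext' hgf
  inv_hom_id := Hom.ext' hfg

end BunConn

namespace EquivStr
variable {G K M X : Mfd.{u}} [Group G] [LieGroup G.I ∞ G] [Group K] [MulAction G M]
  {R R' : BunConn K M} (S : EquivStr G R) (S' : EquivStr G R')

theorem twist_conn_val (α : OneForm X G.E) (f : X.Map M) (z : R.pullTotal f)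
    (v : (R.pullTotal f).E) :
    (S.twist α f).conn.val z v = R.conn.val (pullSnd z) (der pullSnd z v) -
      R.conn.val (pullSnd z) (S.rho (pullSnd z) (α.val (pullFst z) (der pullFst z v))) := rfl

/-- A `G`-equivariant morphism commutes with the vector fields `ρ(A)`. -/
theorem der_rho (ψ : R ⟶ R') (hψ : ∀ h q, ψ.toFun (S.act h q) = S'.act h (ψ.toFun q)) (q : R.total)
    (A : G.E) : der ψ.toFun q (S.rho q A) = S'.rho (ψ.toFun q) A := by
  have h := der_comp (f := fun g : G => S.act g⁻¹ q) ψ.smooth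
    (S.act_inv_smooth.comp (contMDiff_const.prodMk contMDiff_id)) 1 A
  have e : S.act (1 : G)⁻¹ q = q := by rw [inv_one, S.one_act]
  rw [e] at h
  refine h.symm.trans ?_
  have h2 : (fun g : G => ψ.toFun (S.act g⁻¹ q)) = fun g : G => S'.act g⁻¹ (ψ.toFun q) :=
    funext fun g => hψ _ _
  rw [h2]
  rfl

/-- The map `(x, q) ↦ (x, ψ(q))` that is induced by a `G`-equivariant morphism `ψ`. -/
noncomputable def twistMap (ψ : R ⟶ R') (hψ : ∀ h q, ψ.toFun (S.act h q) = S'.act h (ψ.toFun q))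
    (α : OneForm X G.E) (f : X.Map M) : S.twist α f ⟶ S'.twist α f where
  toFun := (BunConn.pullMap f ψ).toFun
  smooth := (BunConn.pullMap f ψ).smooth
  proj_eq _ := rfl
  equivariant := (BunConn.pullMap f ψ).equivariant
  conn_eq z (v : (R.pullTotal f).E) := by
    have hm := (BunConn.pullMap f ψ).smooth
    have h1 : der (pullSnd (P := R'.toPrincipalBundle) (φ := f)) ((BunConn.pullMap f ψ).toFun z)
        (der (BunConn.pullMap f ψ).toFun z v) = der ψ.toFun (pullSnd z) (der pullSnd z v) :=
      (der_comp (pullSnd_smooth (P := R'.toPrincipalBundle) (φ := f)) hm z v).symm.trans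
        (der_comp ψ.smooth pullSnd_smooth z v)
    have h2 : der (pullFst (P := R'.toPrincipalBundle) (φ := f)) ((BunConn.pullMap f ψ).toFun z)
        (der (BunConn.pullMap f ψ).toFun z v) = der pullFst z v :=
      (der_comp (pullFst_smooth (P := R'.toPrincipalBundle) (φ := f)) hm z v).symm
    change (S'.twist α f).conn.val ((BunConn.pullMap f ψ).toFun z)
      (der (BunConn.pullMap f ψ).toFun z v) = (S.twist α f).conn.val z v
    have h3 := (S'.twist_conn_val α f ((BunConn.pullMap f ψ).toFun z)
      (der (BunConn.pullMap f ψ).toFun z v))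
    refine h3.trans ?_
    rw [h1, h2]
    refine congrArg₂ (fun a b : K.E => a - b) (BunConn.hom_conn ψ _ _) ?_
    exact (congrArg (R'.conn.val (ψ.toFun (pullSnd z))) (S.der_rho S' ψ hψ _ _).symm).trans
      (BunConn.hom_conn ψ _ _)

end EquivStr

namespace BunConnOnQuot
variable {G K M : Mfd.{u}} [Group G] [LieGroup G.I ∞ G] [MulAction G M] [Group K] [LieGroup K.I ∞ K]
  [ContMDiffSMul G.I M.I ∞ G M] (Q Q' : BunConnOnQuot G K M) {X : Mfd.{u}} (a : DiffAct G M X)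

/-- The map `p ↦ (x, eval p)` from `Q_∇(α, f)` to `(1 - ι_{ρ(α)}) f^*(Q, Θ)`, where `x` is the base point
of `p`. -/
noncomputable def compareHom : Q.bun a ⟶ Q.equivStr.twist a.form a.map where
  toFun p := pullMk ((Q.bun a).proj p) (Q.eval a p) (Q.proj_eval a p).symm
  smooth := pullMk_smooth (Q.bun a).proj_smooth (Q.eval_smooth a) _
  proj_eq _ := rfl
  equivariant p k := pull_ext ((Q.bun a).proj_act p k) (Q.eval_act a p k)
  conn_eq p (w : (Q.bun a).total.E) := by
    have hm : ContMDiff (Q.bun a).total.I (Q.value.pullTotal a.map).I ∞ (fun p : (Q.bun a).total =>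
      (pullMk ((Q.bun a).proj p) (Q.eval a p) (Q.proj_eval a p).symm : Q.value.pullTotal a.map)) :=
      pullMk_smooth (Q.bun a).proj_smooth (Q.eval_smooth a) _
    have h1 := der_comp (pullSnd_smooth (P := Q.value.toPrincipalBundle) (φ := a.map)) hm p w
    have h2 := der_comp (pullFst_smooth (P := Q.value.toPrincipalBundle) (φ := a.map)) hm p w
    have h3 := Q.defect_eq_zero a p w
    rw [defect_apply, sub_eq_zero] at h3
    refine Eq.trans ?_ h3.symm
    exact congrArg₂ (fun a b : K.E => a - b)
      (congrArg (Q.value.conn.val (Q.eval a p)) h1.symm)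
      (congrArg (fun v => Q.value.conn.val (Q.eval a p) (Q.rho (Q.eval a p)
        (a.form.val ((Q.bun a).proj p) v))) h2.symm)

/-- The isomorphism `Q_∇(α, f) ≅ (1 - ι_{ρ(α)}) f^*(Q, Θ)`. -/
noncomputable def compare : Q.bun a ≅ Q.equivStr.twist a.form a.map :=
  have h := Q.exists_smooth_lift (N := Q.value.pullTotal a.map) a
    (pullFst_smooth (P := Q.value.toPrincipalBundle) (φ := a.map)) pullSnd_smooth pull_eq
  BunConn.isoOfInverse (Q.compareHom a) h.choose h.choose_spec.1
    (fun _ => Q.eval_injective a (h.choose_spec.2.1 _) (h.choose_spec.2.2 _))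
    (fun z => pull_ext (h.choose_spec.2.1 z) (h.choose_spec.2.2 z))

theorem eval_compare_inv (z) : Q.eval a ((Q.compare a).inv.toFun z) = pullSnd z :=
  congrArg pullSnd (BunConn.iso_inv_hom (Q.compare a) z)

variable {Q Q'} (ψ : Q.value ⟶ Q'.value)
  (hψ : ∀ h q, ψ.toFun (Q.equivStr.act h q) = Q'.equivStr.act h (ψ.toFun q))

/-- The morphism `Q_∇(α, f) → Q'_∇(α, f)` that is induced by an equivariant morphism `Q → Q'`. -/
noncomputable def extendApp : Q.bun a ⟶ Q'.bun a :=
  (Q.compare a).hom ≫ Q.equivStr.twistMap Q'.equivStr ψ hψ a.form a.map ≫ (Q'.compare a).inv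

theorem eval_extendApp (p : (Q.bun a).total) :
    Q'.eval a ((extendApp a ψ hψ).toFun p) = ψ.toFun (Q.eval a p) :=
  Q'.eval_compare_inv a _

/-- The morphism `Q_∇ → Q'_∇` that is induced by an equivariant morphism `Q → Q'`. -/
noncomputable def extend : Hom Q Q' where
  app X :=
    { app := fun a => extendApp a ψ hψ
      naturality := fun a b f => BunConn.Hom.ext' fun p => by
        refine Q'.eval_injective b ?_ ?_
        · exact ((extendApp b ψ hψ).proj_eq _).trans ((Q.proj_trans f p).trans
            (((extendApp a ψ hψ).proj_eq p).symm.trans (Q'.proj_trans f _).symm))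
        · refine (eval_extendApp b ψ hψ (Q.trans f p)).trans ?_
          refine Eq.trans ?_ (Q'.eval_trans f ((extendApp a ψ hψ).toFun p)).symm
          rw [eval_trans, eval_extendApp, (extendApp a ψ hψ).proj_eq]
          exact hψ _ _ }
  base_natural φ a := BunConn.Hom.ext' fun p => by
    refine pull_ext ?_ ?_
    · exact ((Q'.base φ a).hom.proj_eq _).trans (((extendApp (a.pull φ) ψ hψ).proj_eq p).trans
        ((Q.base φ a).hom.proj_eq p).symm)
    · change Q'.baseMap φ a ((extendApp (a.pull φ) ψ hψ).toFun p) =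
        (extendApp a ψ hψ).toFun (Q.baseMap φ a p)
      refine Q'.eval_injective a ?_ ?_
      · rw [proj_baseMap, (extendApp _ ψ hψ).proj_eq, (extendApp _ ψ hψ).proj_eq, proj_baseMap]
      · rw [eval_baseMap, eval_extendApp, eval_extendApp, eval_baseMap]

theorem extend_unit : ((extend ψ hψ).app M).app unit = ψ :=
  BunConn.Hom.ext' fun q => ((Q'.eval_unit _).symm.trans (eval_extendApp unit ψ hψ q)).trans
    (congrArg ψ.toFun (Q.eval_unit q))

end BunConnOnQuot

/-- Every `K`-bundle with connection `Q_∇` on `M//_∇ G` is naturally isomorphic to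
`(α, f) ↦ (1 - ι_{ρ(α)}) f^*(Q, Θ)`, where `(Q, Θ) = Q_∇(0, id_M)` has the `G`-action given by `Q_∇`.
The conjuncts: the `G`-action on `Q` is the one induced by `Q_∇`; the isomorphism at `(0, id_M)` is the
canonical one; naturality in the morphisms `(g, α, f)`, which act on the right-hand side by
`(x, q) ↦ (x, g(x) q)`; naturality under base change; naturality in `Q_∇`; and `Q_∇`, with its
morphisms, is determined by the `G`-equivariant bundle with connection `(Q, Θ)`. -/
theorem lemma4p7 (G K M : Mfd.{u}) [Group G] [LieGroup G.I ∞ G] [Group K] [LieGroup K.I ∞ K]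
    [MulAction G M] [ContMDiffSMul G.I M.I ∞ G M] :
    ∃ (S : ∀ Q : BunConnOnQuot G K M, EquivStr G Q.value)
      (η : ∀ (Q : BunConnOnQuot G K M) (X : Mfd.{u}) (a : DiffAct G M X),
        (Q.functor X).obj a ≅ (S Q).twist a.form a.map),
      (∀ Q h q, (S Q).act h q = Q.translate h q) ∧
      (∀ Q q, pullSnd ((η Q M BunConnOnQuot.unit).hom.toFun q) = q) ∧
      (∀ Q X (a b : DiffAct G M X) (f : a ⟶ b) (p : ((Q.functor X).obj a).total),
        pullSnd ((η Q X b).hom.toFun (((Q.functor X).map f).toFun p)) =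
          (S Q).act (f.g (((Q.functor X).obj a).proj p)) (pullSnd ((η Q X a).hom.toFun p))) ∧
      (∀ Q X Y (φ : Y.Map X) (a : DiffAct G M X) (p : ((Q.functor Y).obj (a.pull φ)).total),
        pullSnd ((η Q Y (a.pull φ)).hom.toFun p) =
          pullSnd ((η Q X a).hom.toFun (pullSnd ((Q.base φ a).hom.toFun p)))) ∧
      (∀ Q Q' (τ : BunConnOnQuot.Hom Q Q') X (a : DiffAct G M X) (p : ((Q.functor X).obj a).total),
        pullSnd ((η Q' X a).hom.toFun (((τ.app X).app a).toFun p)) =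
          ((τ.app M).app BunConnOnQuot.unit).toFun (pullSnd ((η Q X a).hom.toFun p))) ∧
      (∀ (Q Q' : BunConnOnQuot G K M) (ψ : Q.value ⟶ Q'.value),
        (∀ h q, ψ.toFun ((S Q).act h q) = (S Q').act h (ψ.toFun q)) →
          ∃! τ : BunConnOnQuot.Hom Q Q', (τ.app M).app BunConnOnQuot.unit = ψ) := by
  refine ⟨fun Q => Q.equivStr, fun Q X a => Q.compare a, fun _ _ _ => rfl, fun Q q => Q.eval_unit q,
    fun Q _ _ _ f p => Q.eval_trans f p, fun Q _ _ φ a p => (Q.eval_baseMap a φ p).symm,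
    fun _ _ τ _ a p => BunConnOnQuot.eval_hom a τ p, fun Q Q' ψ hψ => ?_⟩
  exact ⟨BunConnOnQuot.extend ψ hψ, BunConnOnQuot.extend_unit ψ hψ, fun τ hτ =>
    BunConnOnQuot.Hom.ext_unit (hτ.trans (BunConnOnQuot.extend_unit ψ hψ).symm)⟩
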